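/- **Setting.** Identify distributions on $\mathbb T^2=(\mathbb R/2\pi\mathbb Z)^2$ with their Fourier coefficients $\widehat f(n)$, $n\in\mathbb Z^2$; put $\langle n\rangle=(1+|n|^2)^{1/2}$ and $\|f\|_{\mathcal FL^{s,p}}=\|\langle n\rangle^s\widehat f(n)\|_{\ell^p(\mathbb Z^2)}$. For $n=(j,k)$ let $|n|_-^2=j^2-k^2$, and let $S(t)=e^{it\Box}$, $\Box=\partial_{x_1}^2-\partial_{x_2}^2$, so that $\widehat{S(t)f}(n)=e^{-it|n|_-^2}\widehat f(n)$. *Ordered trees.* An ordered tree of generation $J\ge1$ is obtained from a root with three ordered children by $J-1$ successive steps, each of which turns one terminal node into a non-terminal node with three ordered children; the order of the steps is remembered. Let $a^{(1)}$ be the root and, for $k\ge2$, let $a^{(k)}$ be the node made non-terminal at the step from generation $k-1$ to generation $k$. Let $\mathfrak T(J)$ be the (finite) set of these trees, $\mathcal T^\infty$ the set of the $2J+1$ terminal nodes of $\mathcal T\in\mathfrak T(J)$, and $a_1,a_2,a_3$ the children of a non-terminal node $a$. The sign $\varepsilon_a\in\{\pm1\}$ of a node is $-1$ if the path from the root to $a$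 passes an odd number of times to a middle child, and $+1$ otherwise; write $z^{*a}=z$ if $\varepsilon_a=1$ and $z^{*a}=\overline z$ if $\varepsilon_a=-1$. An index function on $\mathcal T$ assigns to each node $a$ some $n_a\in\mathbb Z^2$ with $n_a=n_{a_1}-n_{a_2}+n_{a_3}$ and $\{n_a,n_{a_2}\}\cap\{n_{a_1},n_{a_3}\}=\emptyset$ at every non-terminal node $a$; $\mathfrak N_n(\mathcal T)$ is the set of those with value $n$ at the root. For an index function put $$\mu_k=|n_a|_-^2-|n_{a_1}|_-^2+|n_{a_2}|_-^2-|n_{a_3}|_-^2\ \ (a=a^{(k)}),\qquad \widetilde\mu_k=\sum_{l=1}^k\varepsilon_{a^{(l)}}\mu_l .$$ Given $K\ge1$ and $1<p<\infty$, let $A_k$ be the set where $|\widetilde\mu_k|\le((2k+1)K)^{4p}$, and let $\sigma_{\mathcal T}=(-1)^{J-1}\prod_{k=1}^J\varepsilon_{a^{(k)}}$ for $\mathcal T\in\mathfrak T(J)$. *Operators.* For $v=(v_n)_{n\in\mathbb Z^2}$ let $$\mathcal R^{(1)}(v)(n)=i\Big(-|v_n|^2v_n+2\Big(\sum_{m\in\mathbb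 Z^2}|v_m|^2\Big)v_n\Big)$$ and, for $J\ge1$ and $t\in\mathbb R$, $$\mathcal N_0^{(J+1)}(v)(t,n)=\sum_{\mathcal T\in\mathfrak T(J)}\ \sum_{\mathbf n\in\mathfrak N_n(\mathcal T)}\mathbf 1_{\bigcap_{k=1}^{J}A_k^c}\,\frac{\sigma_{\mathcal T}\,e^{it\widetilde\mu_J}}{\prod_{k=1}^{J}\widetilde\mu_k}\prod_{a\in\mathcal T^\infty}v_{n_a}^{*a},$$ $$\mathcal N_1^{(J)}(v)(t,n)=\sum_{\mathcal T\in\mathfrak T(J)}\ \sum_{\mathbf n\in\mathfrak N_n(\mathcal T)}\mathbf 1_{\bigcap_{k=1}^{J-1}A_k^c\cap A_J}\,\frac{i\,\sigma_{\mathcal T}\,e^{it\widetilde\mu_J}}{\prod_{k=1}^{J-1}\widetilde\mu_k}\prod_{a\in\mathcal T^\infty}v_{n_a}^{*a},$$ $$\mathcal R^{(J+1)}(v)(t,n)=-\sum_{\mathcal T\in\mathfrak T(J)}\ \sum_{\mathbf n\in\mathfrak N_n(\mathcal T)}\mathbf 1_{\bigcap_{k=1}^{J}A_k^c}\,\frac{\sigma_{\mathcal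 T}\,e^{it\widetilde\mu_J}}{\prod_{k=1}^{J}\widetilde\mu_k}\sum_{b\in\mathcal T^\infty}\big(\mathcal R^{(1)}(v)(n_b)\big)^{*b}\prod_{a\in\mathcal T^\infty\setminus\{b\}}v_{n_a}^{*a}.$$ Let $\mathfrak N_0^{(j)}(u)(t)=S(t)\,\mathcal N_0^{(j)}(S(-t)u(t))(t)$, and define $\mathfrak N_1^{(j)}$ and $\mathfrak R^{(j)}$ from $\mathcal N_1^{(j)}$ and $\mathcal R^{(j)}$ in the same way. The normal form equation with parameter $K$ is $$u(t)=S(t)u(0)+\sum_{j\ge2}\mathfrak N_0^{(j)}(u)(t)-S(t)\sum_{j\ge2}\mathfrak N_0^{(j)}(u)(0)+\int_0^tS(t-t')\Big\{\sum_{j\ge1}\mathfrak N_1^{(j)}(u)(t')+\sum_{j\ge1}\mathfrak R^{(j)}(u)(t')\Big\}dt'. \tag{NF}$$ **Theorem 1.3.** Let $1<p<\infty$. (i) Let $s>1-\frac1p$. Then (NF) is unconditionally semilinearly locally well-posed in $\mathcal FL^{s,p}(\mathbb T^2)$, in the following sense. * For all $K\ge1$, $T>0$ and $u\in C([0,T];\mathcal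 FL^{s,p})$, all multiple sums in (NF) converge absolutely, all series in $j$ converge absolutely in $\mathcal FL^{s,p}$ at each $t\in[0,T]$, and the Fourier coefficients of the integrand are integrable in time. * For every $R>0$ there is $K_0\ge1$ such that for every $K\ge K_0$ there is $T_0>0$ such that for every $T\in(0,T_0]$ there are $M>0$ and $\theta\in[0,1)$ with the following properties. For every $u_0$ with $\|u_0\|_{\mathcal FL^{s,p}}<R$, the map that sends $u$ to the right-hand side of (NF), with $u(0)$ replaced by $u_0$ in $S(t)u(0)$, maps the closed ball of radius $M$ of $C([0,T];\mathcal FL^{s,p})$ into itself and is a $\theta$-contraction there. There is a map $\Psi:\mathcal FL^{s,p}\to C([0,T];\mathcal FL^{s,p})$ that is $C^\infty$ (in the real sense) on the ball $\{\|u_0\|_{\mathcal FL^{s,p}}<R\}$, such that for each $u_0$ in this ball, $\Psi(u_0)$ has norm at most $M$, solves (NF) on $[0,T]$ with $u(0)=u_0$, and is the only solution with this initial datum in the whole space $C([0,T];\mathcal FL^{s,p})$. (ii) Let $s<1-\frac1p$. Then the solution map of (NF) on $\mathcal FL^{s,p}(\mathbb T^2)$ fails to be $C^3$, in the following sense. For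 all $K\ge1$, $T>0$ and $\sigma>1-\frac1p$ there is $\rho_0>0$ such that for every $u_0$ with $\|u_0\|_{\mathcal FL^{\sigma,p}}<\rho_0$, (NF) has exactly one solution $u\in C([0,T];\mathcal FL^{\sigma,p})$ with $u(0)=u_0$; and for all $\rho\in(0,\rho_0]$ and $t\in(0,T]$ there is no map $\Phi:\mathcal FL^{s,p}\to\mathcal FL^{s,p}$ that is $C^3$ (in the real sense) near $0$ and satisfies $\Phi(u_0)=u(t)$ for every trigonometric polynomial $u_0$ with $\|u_0\|_{\mathcal FL^{\sigma,p}}<\rho$, where $u$ is this solution. -/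

import Mathlib

open scoped ContDiff

namespace HNLS

noncomputable section

/-! ### Fourier--Lebesgue spaces on the two-dimensional torus

A periodic distribution is identified with the sequence of its Fourier coefficients. -/

/-- Frequencies: the lattice `ℤ²`. -/
abbrev Freq : Type := ℤ × ℤ

/-- The Japanese bracket `⟨n⟩ = (1 + |n|²)^{1/2}`. -/
def jap (n : Freq) : ℝ := Real.sqrt (1 + (n.1 : ℝ) ^ 2 + (n.2 : ℝ) ^ 2)

/-- The hyperbolic modulus `|n|₋² = n₁² - n₂²`. -/
def hsq (n : Freq) : ℤ := n.1 ^ 2 - n.2 ^ 2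

/-- The Fourier coefficient sequences `f` with `⟨n⟩^s f(n) ∈ ℓ^p(ℤ²)`. -/
def flSubmodule (s p : ℝ) : Submodule ℂ (Freq → ℂ) where
  carrier := {f | Memℓp (E := fun _ : Freq => ℂ)
    (fun n => ((jap n ^ s : ℝ) : ℂ) * f n) (ENNReal.ofReal p)}
  zero_mem' := by
    have h : (fun n : Freq => ((jap n ^ s : ℝ) : ℂ) * (0 : Freq → ℂ) n)
        = (0 : (n : Freq) → (fun _ : Freq => ℂ) n) := by
      funext n; simp
    simp only [Set.mem_ofPred_eq, h]
    exact zero_memℓp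
  add_mem' := by
    intro f g hf hg
    have h := Memℓp.add hf hg
    have e : (fun n : Freq => ((jap n ^ s : ℝ) : ℂ) * (f + g) n)
        = (fun n : Freq => ((jap n ^ s : ℝ) : ℂ) * f n)
          + (fun n : Freq => ((jap n ^ s : ℝ) : ℂ) * g n) := by
      funext n; simp [mul_add]
    simp only [Set.mem_ofPred_eq, e]
    exact h
  smul_mem' := by
    intro c f hf
    have h := Memℓp.const_smul hf c
    have e : (fun n : Freq => ((jap n ^ s : ℝ) : ℂ) * (c • f) n)
        = c • (fun n : Freq => ((jap n ^ s : ℝ) : ℂ) * f n) := by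
      funext n; simp [mul_left_comm]
    simp only [Set.mem_ofPred_eq, e]
    exact h

/-- The Fourier--Lebesgue space `FL^{s,p}(𝕋²)`. -/
def FL (s p : ℝ) : Type := flSubmodule s p

instance (s p : ℝ) : AddCommGroup (FL s p) := inferInstanceAs (AddCommGroup (flSubmodule s p))
instance (s p : ℝ) : Module ℂ (FL s p) := inferInstanceAs (Module ℂ (flSubmodule s p))
instance (s p : ℝ) : Module ℝ (FL s p) := Module.complexToReal (FL s p)

/-- The Fourier coefficients of an element of `FL^{s,p}`. -/
def FL.coeff {s p : ℝ} (f : FL s p) : Freq → ℂ := Subtype.val f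

instance (p : ℝ) [h : Fact (1 < p)] : Fact (1 ≤ ENNReal.ofReal p) :=
  ⟨by simpa using ENNReal.ofReal_le_ofReal h.out.le⟩

/-- The map `f ↦ ⟨n⟩^s f(n)` from `FL^{s,p}` to `ℓ^p(ℤ²)`. -/
def FL.toLp (s p : ℝ) : FL s p →ₗ[ℂ] lp (fun _ : Freq => ℂ) (ENNReal.ofReal p) where
  toFun f := ⟨fun n => ((jap n ^ s : ℝ) : ℂ) * f.coeff n, f.2⟩
  map_add' f g := by
    ext n
    exact mul_add _ _ _
  map_smul' c f := by
    ext n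
    exact mul_left_comm _ c _

theorem jap_pos (n : Freq) : 0 < jap n := Real.sqrt_pos.mpr (by positivity)

theorem FL.toLp_injective (s p : ℝ) : Function.Injective (FL.toLp s p) := by
  intro f g h
  apply Subtype.ext
  funext n
  have h1 : ((jap n ^ s : ℝ) : ℂ) * f.coeff n = ((jap n ^ s : ℝ) : ℂ) * g.coeff n :=
    congrFun (congrArg Subtype.val h) n
  have h2 : ((jap n ^ s : ℝ) : ℂ) ≠ 0 := by
    exact_mod_cast (Real.rpow_pos_of_pos (jap_pos n) s).ne'
  exact mul_left_cancel₀ h2 h1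

/-- The norm `‖f‖_{FL^{s,p}} = ‖⟨n⟩^s f(n)‖_{ℓ^p}`. -/
instance (s p : ℝ) [Fact (1 < p)] : NormedAddCommGroup (FL s p) :=
  NormedAddCommGroup.induced (FL s p) (lp (fun _ : Freq => ℂ) (ENNReal.ofReal p))
    (FL.toLp s p) (FL.toLp_injective s p)

instance (s p : ℝ) [Fact (1 < p)] : NormedSpace ℝ (FL s p) :=
  NormedSpace.induced ℝ (FL s p) (lp (fun _ : Freq => ℂ) (ENNReal.ofReal p))
    ((FL.toLp s p).restrictScalars ℝ)

/-- The propagator `S(t) = e^{it□}`, `□ = ∂₁² - ∂₂²`, on Fourier coefficients. -/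
def propagator (t : ℝ) (f : Freq → ℂ) : Freq → ℂ :=
  fun n => Complex.exp (-(Complex.I * t * (hsq n : ℂ))) * f n

/-! ### Ordered ternary trees -/

/-- Nodes of ternary trees, as addresses: `[]` is the root, and the three children
`a₁, a₂, a₃` of a node `a` are `0 :: a`, `1 :: a`, `2 :: a`. -/
abbrev Node : Type := List (Fin 3)

/-- The sign `±1` of a node: `-1` if and only if the factor attached to it carries a complex
conjugate, that is, if an odd number of steps from the root to it go to a middle child. -/
def Node.sign (a : Node) : ℤ := (-1) ^ (a.count 1)

/-- `z` or its conjugate, according to the sign of the node. -/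
def Node.star (a : Node) (z : ℂ) : ℂ :=
  if Even (a.count 1) then z else (starRingEnd ℂ) z

/-- An ordered tree of the `J`-th generation, given by its chronicle: `node k` is the terminal
node of the tree of generation `k` that is turned into a non-terminal node to get the tree of
generation `k + 1` (`k = 0` creates the root with its three children). -/
structure OrderedTree (J : ℕ) where
  node : Fin J → Node
  root_first : ∀ k : Fin J, (k : ℕ) = 0 → node k = []
  grows : ∀ k : Fin J, (k : ℕ) ≠ 0 → ∃ i < k, ∃ c : Fin 3, node k = c :: node i
  injective : Function.Injective node

theorem OrderedTree.length_le {J : ℕ} (T : OrderedTree J) :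
    ∀ (m : ℕ) (k : Fin J), (k : ℕ) = m → (T.node k).length ≤ m := by
  intro m
  induction m using Nat.strong_induction_on with
  | _ m ih =>
    intro k hk
    by_cases h0 : (k : ℕ) = 0
    · simp [T.root_first k h0]
    · obtain ⟨i, hi, c, hc⟩ := T.grows k h0
      have hi' : (i : ℕ) < m := hk ▸ hi
      have := ih i hi' i rfl
      rw [hc, List.length_cons]
      omega

instance (J : ℕ) : Finite (OrderedTree J) := by
  have hfin : Finite {a : Node // a.length ≤ J} := List.finite_length_le (Fin 3) J
  refine Finite.of_injective (β := Fin J → {a : Node // a.length ≤ J})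
    (fun T k => ⟨T.node k, (T.length_le k k rfl).trans k.2.le⟩) ?_
  intro T T' h
  have : T.node = T'.node := by
    funext k
    exact congrArg Subtype.val (congrFun h k)
  cases T; cases T'; cases this; rfl

instance (J : ℕ) : Fintype (OrderedTree J) := Fintype.ofFinite _

/-- The non-terminal nodes. -/
def OrderedTree.nonterminal {J : ℕ} (T : OrderedTree J) : Finset Node :=
  Finset.univ.image T.node

/-- All nodes: the root and the children of the non-terminal nodes. -/
def OrderedTree.nodes {J : ℕ} (T : OrderedTree J) : Finset Node :=
  insert [] (T.nonterminal.biUnion fun a => Finset.univ.image fun c : Fin 3 => c :: a)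

/-- The terminal nodes. -/
def OrderedTree.terminal {J : ℕ} (T : OrderedTree J) : Finset Node :=
  T.nodes \ T.nonterminal

/-- The index functions on `T` with value `m` at the root (extended by `0` off the tree). -/
def OrderedTree.indexFn {J : ℕ} (T : OrderedTree J) (m : Freq) : Set (Node → Freq) :=
  {n | (∀ a ∉ T.nodes, n a = 0) ∧ n [] = m ∧
    ∀ a ∈ T.nonterminal, n a = n (0 :: a) - n (1 :: a) + n (2 :: a) ∧
      Disjoint ({n a, n (1 :: a)} : Set Freq) {n (0 :: a), n (2 :: a)}}

/-- The modulation `|n_a|₋² - |n_{a₁}|₋² + |n_{a₂}|₋² - |n_{a₃}|₋²` at a non-terminal node. -/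
def modulation (n : Node → Freq) (a : Node) : ℤ :=
  hsq (n a) - hsq (n (0 :: a)) + hsq (n (1 :: a)) - hsq (n (2 :: a))

/-- The accumulated modulation `μ̃` of the generations `1, …, k + 1`; the modulation of a
conjugated node enters with a minus sign. -/
def OrderedTree.modSum {J : ℕ} (T : OrderedTree J) (n : Node → Freq) (k : Fin J) : ℤ :=
  ∑ l ∈ Finset.Iic k, (T.node l).sign * modulation n (T.node l)

/-- The nearly resonant set of generation `k + 1`: `|μ̃_{k+1}| ≤ ((2(k+1)+1)K)^{4p}`. -/
def OrderedTree.Near (K p : ℝ) {J : ℕ} (T : OrderedTree J) (n : Node → Freq) (k : Fin J) : Prop :=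
  |(T.modSum n k : ℝ)| ≤ ((2 * (k : ℝ) + 3) * K) ^ (4 * p)

/-- The sign `(-1)^(J-1) ∏ ε`, over the signs `ε` of the `J = j + 1` non-terminal nodes, which is
produced by `j` differentiations by parts. -/
def OrderedTree.sgn {j : ℕ} (T : OrderedTree (j + 1)) : ℤ :=
  (-1) ^ j * ∏ k, (T.node k).sign

/-- The phase `e^{itμ̃}` with the accumulated modulation of all generations. -/
def OrderedTree.phase {j : ℕ} (T : OrderedTree (j + 1)) (t : ℝ) (n : Node → Freq) : ℂ :=
  Complex.exp (Complex.I * t * (T.modSum n (Fin.last j) : ℂ))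

/-! ### The multilinear operators in the interaction representation

`v` is the sequence of Fourier coefficients of the interaction representation at time `t`. -/

/-- `ℛ⁽¹⁾(v)`: the trivial resonant part. -/
def calR1 (v : Freq → ℂ) (n : Freq) : ℂ :=
  Complex.I * (-(v n * (starRingEnd ℂ) (v n) * v n)
    + 2 * (∑' m, v m * (starRingEnd ℂ) (v m)) * v n)

open Classical in
/-- The summand of `𝒩₀⁽ʲ⁺²⁾` for a tree of generation `j + 1` and an index function. -/
def termN0 (K p : ℝ) {j : ℕ} (T : OrderedTree (j + 1)) (t : ℝ) (v : Freq → ℂ)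
    (n : Node → Freq) : ℂ :=
  if ∀ k, ¬ T.Near K p n k then
    (T.sgn : ℂ) * T.phase t n / (∏ k, (T.modSum n k : ℂ)) * ∏ a ∈ T.terminal, a.star (v (n a))
  else 0

open Classical in
/-- The summand of `𝒩₁⁽ʲ⁺¹⁾` for a tree of generation `j + 1` and an index function. -/
def termN1 (K p : ℝ) {j : ℕ} (T : OrderedTree (j + 1)) (t : ℝ) (v : Freq → ℂ)
    (n : Node → Freq) : ℂ :=
  if (∀ k : Fin j, ¬ T.Near K p n k.castSucc) ∧ T.Near K p n (Fin.last j) then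
    Complex.I * (T.sgn : ℂ) * T.phase t n / (∏ k : Fin j, (T.modSum n k.castSucc : ℂ))
      * ∏ a ∈ T.terminal, a.star (v (n a))
  else 0

open Classical in
/-- The summand of `ℛ⁽ʲ⁺²⁾` for a tree of generation `j + 1` and an index function. -/
def termR (K p : ℝ) {j : ℕ} (T : OrderedTree (j + 1)) (t : ℝ) (v : Freq → ℂ)
    (n : Node → Freq) : ℂ :=
  if ∀ k, ¬ T.Near K p n k then
    -((T.sgn : ℂ) * T.phase t n / (∏ k, (T.modSum n k : ℂ))
      * ∑ b ∈ T.terminal, b.star (calR1 v (n b)) * ∏ a ∈ T.terminal.erase b, a.star (v (n a)))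
  else 0

/-- `𝒩₀⁽ʲ⁺²⁾`, a `(2j+3)`-linear operator. -/
def calN0 (K p : ℝ) (j : ℕ) (t : ℝ) (v : Freq → ℂ) (m : Freq) : ℂ :=
  ∑ T : OrderedTree (j + 1), ∑' n : T.indexFn m, termN0 K p T t v n

/-- `𝒩₁⁽ʲ⁺¹⁾`, a `(2j+3)`-linear operator. -/
def calN1 (K p : ℝ) (j : ℕ) (t : ℝ) (v : Freq → ℂ) (m : Freq) : ℂ :=
  ∑ T : OrderedTree (j + 1), ∑' n : T.indexFn m, termN1 K p T t v n

/-- `ℛ⁽ʲ⁺¹⁾`, a `(2j+3)`-linear operator. -/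
def calR (K p : ℝ) : ℕ → ℝ → (Freq → ℂ) → Freq → ℂ
  | 0, _, v, m => calR1 v m
  | j + 1, t, v, m => ∑ T : OrderedTree (j + 1), ∑' n : T.indexFn m, termR K p T t v n

/-! ### The multilinear operators in the original variable -/

/-- `𝔑₀⁽ʲ⁺²⁾(u)(t) = S(t) 𝒩₀⁽ʲ⁺²⁾(S(-t)u)(t)`. -/
def frakN0 (K p : ℝ) (j : ℕ) (t : ℝ) (f : Freq → ℂ) : Freq → ℂ :=
  propagator t (calN0 K p j t (propagator (-t) f))

/-- `𝔑₁⁽ʲ⁺¹⁾(u)(t) = S(t) 𝒩₁⁽ʲ⁺¹⁾(S(-t)u)(t)`. -/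
def frakN1 (K p : ℝ) (j : ℕ) (t : ℝ) (f : Freq → ℂ) : Freq → ℂ :=
  propagator t (calN1 K p j t (propagator (-t) f))

/-- `ℜ⁽ʲ⁺¹⁾(u)(t) = S(t) ℛ⁽ʲ⁺¹⁾(S(-t)u)(t)`. -/
def frakR (K p : ℝ) (j : ℕ) (t : ℝ) (f : Freq → ℂ) : Freq → ℂ :=
  propagator t (calR K p j t (propagator (-t) f))

/-- The sequences `F 0, F 1, …` are the Fourier coefficients of elements of `FL^{s,p}`, and
`∑ F j` converges absolutely in `FL^{s,p}`. -/
def AbsConvergent (s p : ℝ) [Fact (1 < p)] (F : ℕ → Freq → ℂ) : Prop :=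
  ∃ G : ℕ → FL s p, (∀ j, (G j).coeff = F j) ∧ Summable fun j => ‖G j‖

/-- At the time `t` and the function `f`, all sums that define the multilinear operators converge
absolutely, and the three series of operators converge absolutely in `FL^{s,p}`. -/
structure OperatorsConverge (s p : ℝ) [Fact (1 < p)] (K t : ℝ) (f : Freq → ℂ) : Prop where
  sq : Summable fun m => ‖f m‖ ^ 2
  sumN0 : ∀ (j : ℕ) (T : OrderedTree (j + 1)) (m : Freq),
    Summable fun n : T.indexFn m => ‖termN0 K p T t (propagator (-t) f) n‖
  sumN1 : ∀ (j : ℕ) (T : OrderedTree (j + 1)) (m : Freq),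
    Summable fun n : T.indexFn m => ‖termN1 K p T t (propagator (-t) f) n‖
  sumR : ∀ (j : ℕ) (T : OrderedTree (j + 1)) (m : Freq),
    Summable fun n : T.indexFn m => ‖termR K p T t (propagator (-t) f) n‖
  seriesN0 : AbsConvergent s p fun j => frakN0 K p j t f
  seriesN1 : AbsConvergent s p fun j => frakN1 K p j t f
  seriesR : AbsConvergent s p fun j => frakR K p j t f

/-! ### The normal form equation -/

open Classical in
/-- The Fourier coefficients of `u(t)` for `u ∈ C([0,T]; FL^{s,p})` (and `0` if `t ∉ [0,T]`). -/
def traj {s p T : ℝ} [Fact (1 < p)] (u : C(Set.Icc (0 : ℝ) T, FL s p)) (t : ℝ) : Freq → ℂ :=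
  if h : t ∈ Set.Icc (0 : ℝ) T then (u ⟨t, h⟩).coeff else 0

/-- The `n`-th Fourier coefficient of the integrand
`S(t - t') {∑_{j ≥ 1} 𝔑₁⁽ʲ⁾(u)(t') + ∑_{j ≥ 1} ℜ⁽ʲ⁾(u)(t')}`. -/
def integrand (K : ℝ) {s p T : ℝ} [Fact (1 < p)] (u : C(Set.Icc (0 : ℝ) T, FL s p))
    (t : ℝ) (n : Freq) (t' : ℝ) : ℂ :=
  propagator (t - t') (fun m => (∑' j, frakN1 K p j t' (traj u t') m)
    + ∑' j, frakR K p j t' (traj u t') m) n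

/-- The `n`-th Fourier coefficient of the right-hand side of the normal form equation
`S(t)u₀ + ∑_{j ≥ 2} 𝔑₀⁽ʲ⁾(u)(t) - S(t) ∑_{j ≥ 2} 𝔑₀⁽ʲ⁾(u)(0) + ∫₀ᵗ S(t-t'){…}dt'`. -/
def nfRHS (K : ℝ) {s p T : ℝ} [Fact (1 < p)] (u₀ : FL s p)
    (u : C(Set.Icc (0 : ℝ) T, FL s p)) (t : ℝ) (n : Freq) : ℂ :=
  propagator t u₀.coeff n + (∑' j, frakN0 K p j t (traj u t) n)
    - propagator t (fun m => ∑' j, frakN0 K p j 0 (traj u 0) m) n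
    + ∫ t' in (0 : ℝ)..t, integrand K u t n t'

/-- Every sum, series and integral in the normal form equation converges for `u`. -/
structure NFConverges (K : ℝ) {s p T : ℝ} [Fact (1 < p)]
    (u : C(Set.Icc (0 : ℝ) T, FL s p)) : Prop where
  operators : ∀ t ∈ Set.Icc (0 : ℝ) T, OperatorsConverge s p K t (traj u t)
  integrable : ∀ t ∈ Set.Icc (0 : ℝ) T, ∀ n,
    IntervalIntegrable (integrand K u t n) MeasureTheory.volume 0 t

/-- `w` is the image of `u` under the map given by the right-hand side of the normal form
equation with initial datum `u₀`. -/
def IsNFImage (K : ℝ) {s p T : ℝ} [Fact (1 < p)] (u₀ : FL s p)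
    (u w : C(Set.Icc (0 : ℝ) T, FL s p)) : Prop :=
  NFConverges K u ∧ ∀ t ∈ Set.Icc (0 : ℝ) T, ∀ n, traj w t n = nfRHS K u₀ u t n

/-- `u ∈ C([0,T]; FL^{s,p})` solves the normal form equation with `u(0) = u₀`. -/
def IsNFSolution (K : ℝ) {s p T : ℝ} [Fact (1 < p)] (u₀ : FL s p)
    (u : C(Set.Icc (0 : ℝ) T, FL s p)) : Prop :=
  traj u 0 = u₀.coeff ∧ IsNFImage K u₀ u u

end

end HNLS

open HNLS

set_option linter.unusedSectionVars false

/-! Write q for the exponent dual to p. The condition s > 1 - 1/p says exactly that sq > 1, and this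
is the borderline of the arithmetic input. At a node of frequency n with children n₁, n₂, n₃ put x =
n - n₁ and y = n - n₃; the modulation is 2(x₁y₁ - x₂y₂), and the exclusion of trivial resonances
says x ≠ 0 and y ≠ 0. If two of the three children carry a weight ⟨·⟩^{-a} with a > 1, the sum over
any level set of this quadratic form is bounded uniformly in n and in the level. Indeed, with one
coordinate pair, say (x₂, y₂), fixed and summed against integrable weights, the other pair runs over
a hyperbola x₁y₁ = c with c ≠ 0. Such a hyperbola has O(L^δ) lattice points in a square of side L,
wherever the square lies and however large c is: for c at most a power of L by the divisor bound,
for larger c because three divisors of c above √c cannot be close together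
(`exists_card_hyperbola_le`, `tsum_quadric_le`, `exists_tripleSum_le`).

Induction over the generations turns this into a bound for trees. Peeling off the last generation
costs the sum of the factor φ(μ̃_J) over the integers, and the exemption of one leaf from the
weights either stays where it is or moves to a parent (`tsum_weight_le`). Hölder's inequality over
the index functions, with the weight of the root moved to the largest leaf, gives the multilinear
estimate in FL^{s,p} (`exists_tree_bound`). Off the nearly resonant sets each generation contributes
a constant times ((2k+1)K)^{-2}, which is what the exponent 4p of the threshold is for. The product
is about K^{-2J}/(J!)² and beats the number of trees, at most 3^J J!. All series are therefore
dominated by exponential series; the boundary terms 𝔑₀ are small when K is large, and the integral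
terms are small when T is small.

By conservation of frequency and telescoping of the modulations, the propagators cancel the phases,
so the operators in the original variable do not depend on time (`prod_star_propagator`). The
equation becomes u = S(t)u₀ + Q(u) with Q analytic and contracting on a ball. A quantitative inverse
function theorem gives existence and smooth dependence (`exists_contDiff_fixedPoint`), and a
continuity argument in time confines every solution with small data to that ball, which makes
uniqueness unconditional (`norm_lt_of_eq_flow_add`).

For ill-posedness take data supported on the null line n₁ = n₂. There |n|₋² vanishes, the propagator
acts trivially, and every cubic interaction is exactly resonant. For the indicator function of N ≤ k
< 6N on this line, the cubic coefficient of u(t) is at least tN² in modulus at N frequencies. A C³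
extension would force N^{1/p+s+2} ≲ N^{3(1/p+s)}, which fails for large N if s < 1 - 1/p. -/

namespace HNLS
open scoped ENNReal NNReal

/-! ### Divisors -/

/-- The divisor bound `d(n) ≤ C_ε n^ε`. -/
theorem exists_card_divisors_le {ε : ℝ} (hε : 0 < ε) :
    ∃ C : ℝ, 0 ≤ C ∧ ∀ n : ℕ, n ≠ 0 → (n.divisors.card : ℝ) ≤ C * (n : ℝ) ^ ε := by
  have hl : 0 < ε * Real.log 2 := mul_pos hε (Real.log_pos one_lt_two)
  set C₀ : ℝ := max 1 (1 / (ε * Real.log 2)) with hC₀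
  have hC₀1 : 1 ≤ C₀ := le_max_left _ _
  obtain ⟨P, hP⟩ := exists_nat_ge ((2 : ℝ) ^ (1 / ε))
  -- A prime q ≥ P has q^ε ≥ 2, so that k + 1 ≤ 2^k ≤ q^{kε} costs no constant. Only the fewer than
  -- P smaller primes cost a factor `C₀` each, whence the final constant `C₀ ^ P`.
  have key : ∀ (q k : ℕ), 2 ≤ q →
      ((k : ℝ) + 1) ≤ (if q < P then C₀ else 1) * ((q : ℝ) ^ k) ^ ε := by
    intro q k hq
    have hq' : (2 : ℝ) ≤ q := by exact_mod_cast hq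
    have e : ((q : ℝ) ^ k) ^ ε = ((q : ℝ) ^ ε) ^ k := by
      rw [← Real.rpow_natCast, ← Real.rpow_natCast, ← Real.rpow_mul (by positivity),
        ← Real.rpow_mul (by positivity), mul_comm]
    split_ifs with h
    · have h1 : (2 : ℝ) ^ ε ≤ (q : ℝ) ^ ε := Real.rpow_le_rpow (by norm_num) hq' hε.le
      have h2 : 1 + (k : ℝ) * (ε * Real.log 2) ≤ ((2 : ℝ) ^ ε) ^ k := by
        have : ((2 : ℝ) ^ ε) ^ k = Real.exp (k * (ε * Real.log 2)) := by
          rw [Real.rpow_def_of_pos (by norm_num), ← Real.exp_nat_mul]; ring_nf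
        rw [this]
        linarith [Real.add_one_le_exp ((k : ℝ) * (ε * Real.log 2))]
      have h3 : 1 ≤ C₀ * (ε * Real.log 2) := by
        calc 1 = 1 / (ε * Real.log 2) * (ε * Real.log 2) := by field_simp
          _ ≤ _ := by gcongr; exact le_max_right _ _
      calc (k : ℝ) + 1 ≤ k * (C₀ * (ε * Real.log 2)) + C₀ := by
            gcongr; nlinarith [(Nat.cast_nonneg k : (0 : ℝ) ≤ k)]
        _ = C₀ * (1 + k * (ε * Real.log 2)) := by ring
        _ ≤ C₀ * ((q : ℝ) ^ k) ^ ε := by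
            rw [e]; gcongr
            exact h2.trans (pow_le_pow_left₀ (by positivity) h1 k)
    · have h1 : (2 : ℝ) ≤ (q : ℝ) ^ ε := by
        calc (2 : ℝ) = ((2 : ℝ) ^ (1 / ε)) ^ ε := by
              rw [← Real.rpow_mul (by norm_num)]; field_simp; simp
          _ ≤ _ := by
              apply Real.rpow_le_rpow (by positivity) _ hε.le
              exact hP.trans (by exact_mod_cast not_lt.mp h)
      rw [e, one_mul]
      calc (k : ℝ) + 1 ≤ 2 ^ k := by exact_mod_cast Nat.lt_two_pow_self
        _ ≤ _ := pow_le_pow_left₀ (by norm_num) h1 k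
  refine ⟨C₀ ^ P, by positivity, fun n hn => ?_⟩
  have h1 : (n.divisors.card : ℝ) = ∏ q ∈ n.primeFactors, ((n.factorization q : ℝ) + 1) := by
    rw [Nat.card_divisors hn]; push_cast; rfl
  have h2 : (n : ℝ) ^ ε = ∏ q ∈ n.primeFactors, ((q : ℝ) ^ (n.factorization q)) ^ ε := by
    rw [Real.finsetProd_rpow _ _ (fun i _ => by positivity)]
    congr 1
    conv_lhs => rw [← Nat.prod_factorization_pow_eq_self hn]
    rw [Finsupp.prod, Nat.support_factorization]; push_cast; rfl
  rw [h1]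
  calc _ ≤ ∏ q ∈ n.primeFactors, ((if q < P then C₀ else 1) *
          ((q : ℝ) ^ (n.factorization q)) ^ ε) :=
        Finset.prod_le_prod (fun _ _ => by positivity)
          fun q hq => key q _ (Nat.prime_of_mem_primeFactors hq).two_le
    _ = (∏ q ∈ n.primeFactors, (if q < P then C₀ else 1)) * (n : ℝ) ^ ε := by
        rw [Finset.prod_mul_distrib, h2]
    _ ≤ _ := by
        gcongr
        rw [← Finset.prod_filter, Finset.prod_const]
        apply pow_le_pow_right₀ hC₀1
        calc _ ≤ (Finset.range P).card := Finset.card_le_card fun q hq => by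
                simp at hq ⊢; exact hq.2
          _ = P := Finset.card_range P

/-- The product abd equals lcm(a,b,d) · gcd(a,b) · gcd(lcm(a,b), d). The first factor divides c, and
the last divides gcd(a,d) gcd(b,d). -/
theorem mul_mul_dvd_of_dvd {a b d c : ℕ} (ha : a ∣ c) (hb : b ∣ c) (hd : d ∣ c) :
    a * b * d ∣ c * (a.gcd b * (a.gcd d * b.gcd d)) := by
  have h1 : (a.lcm b).lcm d ∣ c := Nat.lcm_dvd (Nat.lcm_dvd ha hb) hd
  have h2 : (a.lcm b).gcd d ∣ a.gcd d * b.gcd d := by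
    have h : (a.lcm b).gcd d ∣ (a * b).gcd d :=
      Nat.gcd_dvd_gcd_of_dvd_left _ (Nat.lcm_dvd_mul a b)
    refine h.trans ?_
    rw [Nat.gcd_comm, Nat.gcd_comm a, Nat.gcd_comm b]
    exact Nat.gcd_mul_right_dvd_mul_gcd d a b
  have e : a * b * d = (a.lcm b).lcm d * (a.gcd b * (a.lcm b).gcd d) := by
    calc a * b * d = (a.gcd b * a.lcm b) * d := by rw [Nat.gcd_mul_lcm]
      _ = a.gcd b * (a.lcm b * d) := by ring
      _ = a.gcd b * ((a.lcm b).gcd d * (a.lcm b).lcm d) := by rw [Nat.gcd_mul_lcm]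
      _ = _ := by ring
  rw [e]
  exact mul_dvd_mul h1 (mul_dvd_mul_left _ h2)

/-- The gcd divides the nonzero difference. -/
theorem gcd_le_of_abs_sub_le {a b L : ℕ} (hab : a ≠ b) (h : |(a : ℤ) - b| ≤ L) :
    a.gcd b ≤ L := by
  have h1 : ((a.gcd b : ℕ) : ℤ) ∣ (a : ℤ) - b :=
    dvd_sub (by exact_mod_cast Nat.gcd_dvd_left a b) (by exact_mod_cast Nat.gcd_dvd_right a b)
  have h2 : (0 : ℤ) < |(a : ℤ) - b| := abs_pos.mpr (sub_ne_zero.mpr (by exact_mod_cast hab))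
  have h3 := Int.le_of_dvd h2 ((dvd_abs _ _).mpr h1)
  exact_mod_cast h3.trans h

/-- Three distinct divisors of `c`, all of them at least `√c`, cannot be close to each other. -/
theorem le_pow_six_of_three_divisors {a b d c L : ℕ} (hc : 0 < c) (ha : a ∣ c) (hb : b ∣ c)
    (hd : d ∣ c) (hab : a ≠ b) (had : a ≠ d) (hbd : b ≠ d) (h1 : |(a : ℤ) - b| ≤ L)
    (h2 : |(a : ℤ) - d| ≤ L) (h3 : |(b : ℤ) - d| ≤ L) (ha' : c ≤ a * a) (hb' : c ≤ b * b)
    (hd' : c ≤ d * d) : c ≤ L ^ 6 := by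
  have hpos : 0 < c * (a.gcd b * (a.gcd d * b.gcd d)) := by
    have := Nat.gcd_pos_of_pos_left b (Nat.pos_of_dvd_of_pos ha hc)
    have := Nat.gcd_pos_of_pos_left d (Nat.pos_of_dvd_of_pos ha hc)
    have := Nat.gcd_pos_of_pos_left d (Nat.pos_of_dvd_of_pos hb hc)
    positivity
  have h4 : a * b * d ≤ c * (L * (L * L)) :=
    (Nat.le_of_dvd hpos (mul_mul_dvd_of_dvd ha hb hd)).trans (by
      gcongr
      · exact gcd_le_of_abs_sub_le hab h1
      · exact gcd_le_of_abs_sub_le had h2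
      · exact gcd_le_of_abs_sub_le hbd h3)
  -- Lower and upper bounds for the product are compared: c³ ≤ (abd)² because each factor is at
  -- least √c, and abd ≤ cL³ by `h4`.
  have h5 : c ^ 2 * c ≤ c ^ 2 * L ^ 6 := by
    calc c ^ 2 * c = c * c * c := by ring
      _ ≤ (a * a) * (b * b) * (d * d) := by gcongr
      _ = (a * b * d) * (a * b * d) := by ring
      _ ≤ (c * (L * (L * L))) * (c * (L * (L * L))) := by gcongr
      _ = _ := by ring
  exact Nat.le_of_mul_le_mul_left h5 (by positivity)

/-- The lattice points of a hyperbola `xy = c` in a square of side `2L`. -/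
theorem exists_card_hyperbola_le {δ : ℝ} (hδ : 0 < δ) :
    ∃ C : ℝ, 0 ≤ C ∧ ∀ (c m m' : ℤ) (L : ℕ), c ≠ 0 → 1 ≤ L → ∀ S : Finset (ℤ × ℤ),
      (∀ z ∈ S, z.1 * z.2 = c ∧ |m - z.1| ≤ L ∧ |m' - z.2| ≤ L) →
        (S.card : ℝ) ≤ C * (L : ℝ) ^ δ := by
  obtain ⟨C, hC0, hC⟩ := exists_card_divisors_le (ε := δ / 6) (by positivity)
  refine ⟨2 * (C * 2 ^ δ) + 16, by positivity, fun c m m' L hc hL S hS => ?_⟩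
  have hL' : (1 : ℝ) ≤ L := by exact_mod_cast hL
  have hL1 : 1 ≤ (L : ℝ) ^ δ := Real.one_le_rpow hL' hδ.le
  have hne : ∀ z ∈ S, z.1 ≠ 0 ∧ z.2 ≠ 0 := fun z hz => by
    have := (hS z hz).1
    constructor <;> rintro h <;> simp [h] at this <;> exact hc this.symm
  -- For c at most (2L)^6 the divisor bound with exponent δ/6 is already O(L^δ); a divisor, with a
  -- choice of sign, determines the point.
  by_cases hcL : c.natAbs ≤ (2 * L) ^ 6
  · have h1 : S.card ≤ 2 * c.natAbs.divisors.card := by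
      apply Finset.card_le_mul_card_image_of_maps_to (f := fun z : ℤ × ℤ => z.1.natAbs)
      · intro z hz
        rw [Nat.mem_divisors]
        exact ⟨Int.natAbs_dvd_natAbs.mpr ⟨z.2, (hS z hz).1.symm⟩, by simpa using hc⟩
      · intro b _
        refine (Finset.card_le_card (t := {((b : ℤ), c / b), (-(b : ℤ), c / (-b))}) ?_).trans
          Finset.card_le_two
        intro z hz
        rw [Finset.mem_filter] at hz
        have h2 : z.2 = c / z.1 := by
          rw [← (hS z hz.1).1, Int.mul_ediv_cancel_left _ (hne z hz.1).1]
        have h3 : z.1 = b ∨ z.1 = -b := by omega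
        rcases h3 with h | h
        · simp [Prod.ext_iff, h, h2]
        · simp [Prod.ext_iff, h, h2]
    have h2 : (c.natAbs : ℝ) ^ (δ / 6) ≤ 2 ^ δ * (L : ℝ) ^ δ := by
      calc (c.natAbs : ℝ) ^ (δ / 6) ≤ (((2 * L : ℝ)) ^ 6) ^ (δ / 6) := by
            apply Real.rpow_le_rpow (by positivity) (by exact_mod_cast hcL) (by positivity)
        _ = (2 * L : ℝ) ^ δ := by
            rw [← Real.rpow_natCast, ← Real.rpow_mul (by positivity)]; congr 1; push_cast; ring
        _ = _ := Real.mul_rpow (by norm_num) (by positivity)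
    have h3 := hC c.natAbs (by simpa using hc)
    calc (S.card : ℝ) ≤ 2 * (c.natAbs.divisors.card : ℝ) := by exact_mod_cast h1
      _ ≤ 2 * (C * (2 ^ δ * (L : ℝ) ^ δ)) := by gcongr; exact h3.trans (by gcongr)
      _ ≤ _ := by nlinarith
  -- For larger c the points are sorted into eight classes, by the signs of the coordinates and by
  -- which coordinate is larger in modulus. Three points of one class would give three distinct
  -- divisors of |c|, each at least √|c| and within 2L of each other, so that |c| ≤ (2L)^6. Hence
  -- there are at most 16 points.
  · have h1 : S.card ≤ 2 * (Finset.univ : Finset (Bool × Bool × Bool)).card := by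
      apply Finset.card_le_mul_card_image_of_maps_to
        (f := fun z : ℤ × ℤ => (decide (0 < z.1), decide (0 < z.2), decide (|z.2| ≤ |z.1|)))
      · intro z _; simp
      · rintro ⟨b₁, b₂, b₃⟩ _
        by_contra hcard
        rw [not_le, Finset.two_lt_card] at hcard
        obtain ⟨x, hx, y, hy, z, hz, hxy, hxz, hyz⟩ := hcard
        simp only [Finset.mem_filter, Prod.mk.injEq] at hx hy hz
        obtain ⟨hx, hx1, hx2, hx3⟩ := hx
        obtain ⟨hy, hy1, hy2, hy3⟩ := hy
        obtain ⟨hz, hz1, hz2, hz3⟩ := hz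
        obtain ⟨ex, lx, lx'⟩ := hS x hx
        obtain ⟨ey, ly, ly'⟩ := hS y hy
        obtain ⟨ez, lz, lz'⟩ := hS z hz
        have nx := hne x hx
        have ny := hne y hy
        have nz := hne z hz
        have inj1 : ∀ u v : ℤ × ℤ, u.1 * u.2 = c → v.1 * v.2 = c → u ≠ v → v.1 ≠ 0 →
            u.1 ≠ v.1 := fun u v hu hv huv h0 h => huv (Prod.ext h (by
          rw [h] at hu; exact mul_left_cancel₀ h0 (hu.trans hv.symm)))
        have inj2 : ∀ u v : ℤ × ℤ, u.1 * u.2 = c → v.1 * v.2 = c → u ≠ v → v.2 ≠ 0 →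
            u.2 ≠ v.2 := fun u v hu hv huv h0 h => huv (Prod.ext (by
          rw [h] at hu; exact mul_right_cancel₀ h0 (hu.trans hv.symm)) h)
        have cx : ∀ u : ℤ × ℤ, u.1 * u.2 = c → c.natAbs = u.1.natAbs * u.2.natAbs :=
          fun u hu => by rw [← hu, Int.natAbs_mul]
        have sz : ∀ u v M : ℤ, (0 < u ↔ 0 < v) → u ≠ 0 → v ≠ 0 → |M - u| ≤ L → |M - v| ≤ L →
            |((u.natAbs : ℕ) : ℤ) - (v.natAbs : ℕ)| ≤ (2 * L : ℕ) := by
          intro u v M huv hu hv h1 h2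
          rw [abs_le] at h1 h2 ⊢
          omega
        have dn : ∀ u v : ℤ, (0 < u ↔ 0 < v) → u ≠ v → u.natAbs ≠ v.natAbs := by
          intro u v h1 h2; omega
        have pos : 0 < c.natAbs := Int.natAbs_pos.mpr hc
        apply hcL
        have exy1 : (0 < x.1 ↔ 0 < y.1) := decide_eq_decide.mp (hx1.trans hy1.symm)
        have exz1 : (0 < x.1 ↔ 0 < z.1) := decide_eq_decide.mp (hx1.trans hz1.symm)
        have exy2 : (0 < x.2 ↔ 0 < y.2) := decide_eq_decide.mp (hx2.trans hy2.symm)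
        have exz2 : (0 < x.2 ↔ 0 < z.2) := decide_eq_decide.mp (hx2.trans hz2.symm)
        have eyz1 := exy1.symm.trans exz1
        have eyz2 := exy2.symm.trans exz2
        have ab : ∀ u v : ℤ, |u| ≤ |v| → u.natAbs ≤ v.natAbs := by
          intro u v h; rw [Int.abs_eq_natAbs, Int.abs_eq_natAbs] at h; exact_mod_cast h
        cases b₃ with
        | true =>
          simp only [decide_eq_true_eq] at hx3 hy3 hz3
          exact le_pow_six_of_three_divisors pos ⟨_, cx x ex⟩ ⟨_, cx y ey⟩ ⟨_, cx z ez⟩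
            (dn _ _ exy1 (inj1 x y ex ey hxy ny.1)) (dn _ _ exz1 (inj1 x z ex ez hxz nz.1))
            (dn _ _ eyz1 (inj1 y z ey ez hyz nz.1))
            (sz _ _ m exy1 nx.1 ny.1 lx ly) (sz _ _ m exz1 nx.1 nz.1 lx lz)
            (sz _ _ m eyz1 ny.1 nz.1 ly lz)
            ((cx x ex).trans_le (Nat.mul_le_mul_left _ (ab _ _ hx3)))
            ((cx y ey).trans_le (Nat.mul_le_mul_left _ (ab _ _ hy3)))
            ((cx z ez).trans_le (Nat.mul_le_mul_left _ (ab _ _ hz3)))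
        | false =>
          simp only [decide_eq_false_iff_not, not_le] at hx3 hy3 hz3
          exact le_pow_six_of_three_divisors pos (Dvd.intro_left _ (cx x ex).symm)
            (Dvd.intro_left _ (cx y ey).symm) (Dvd.intro_left _ (cx z ez).symm)
            (dn _ _ exy2 (inj2 x y ex ey hxy ny.2)) (dn _ _ exz2 (inj2 x z ex ez hxz nz.2))
            (dn _ _ eyz2 (inj2 y z ey ez hyz nz.2))
            (sz _ _ m' exy2 nx.2 ny.2 lx' ly') (sz _ _ m' exz2 nx.2 nz.2 lx' lz')
            (sz _ _ m' eyz2 ny.2 nz.2 ly' lz')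
            ((cx x ex).trans_le (Nat.mul_le_mul_right _ (ab _ _ hx3.le)))
            ((cx y ey).trans_le (Nat.mul_le_mul_right _ (ab _ _ hy3.le)))
            ((cx z ez).trans_le (Nat.mul_le_mul_right _ (ab _ _ hz3.le)))
    have h2 : (S.card : ℝ) ≤ 16 := by
      have : S.card ≤ 16 := h1.trans (by simp [Fintype.card_prod])
      exact_mod_cast this
    have : 0 ≤ 2 * (C * 2 ^ δ) * (L : ℝ) ^ δ := by positivity
    nlinarith


/-! ### Weights -/

/-- The weight `(1 + |k|)^{-r}` on the integers. -/
noncomputable def hw (r : ℝ) (k : ℤ) : ℝ≥0∞ := ENNReal.ofReal ((1 + |(k : ℝ)|) ^ (-r))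

/-- The weight `⟨n⟩^{-a}` on the lattice. -/
noncomputable def wJ (a : ℝ) (n : Freq) : ℝ≥0∞ := ENNReal.ofReal (jap n ^ (-a))

theorem hw_le_one {r : ℝ} (hr : 0 ≤ r) (k : ℤ) : hw r k ≤ 1 := by
  rw [hw, ENNReal.ofReal_le_one]
  exact Real.rpow_le_one_of_one_le_of_nonpos (by linarith [abs_nonneg (k : ℝ)]) (by linarith)

theorem hw_neg (r : ℝ) (k : ℤ) : hw r (-k) = hw r k := by simp [hw]

theorem hw_add (r r' : ℝ) (k : ℤ) : hw (r + r') k = hw r k * hw r' k := by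
  rw [hw, hw, hw, ← ENNReal.ofReal_mul (by positivity), ← Real.rpow_add (by positivity)]
  congr 2; ring

/-- This is 1 + |v - u| ≤ (1 + |u|)(1 + |v|). It moves the centre of a weight. -/
theorem hw_mul_le {r : ℝ} (hr : 0 ≤ r) (u v : ℤ) : hw r u * hw r v ≤ hw r (v - u) := by
  rw [hw, hw, hw, ← ENNReal.ofReal_mul (by positivity),
    ← Real.mul_rpow (by positivity) (by positivity)]
  apply ENNReal.ofReal_le_ofReal
  apply Real.rpow_le_rpow_of_nonpos (by positivity) _ (by linarith)
  have h := abs_sub (v : ℝ) u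
  push_cast
  nlinarith [abs_nonneg (u : ℝ), abs_nonneg (v : ℝ)]

theorem tsum_hw_ne_top {r : ℝ} (hr : 1 < r) : ∑' k, hw r k ≠ ⊤ := by
  have h : Summable fun k : ℤ => (1 + |(k : ℝ)|) ^ (-r) := by
    have h1 : Summable fun k : ℕ => (1 + (k : ℝ)) ^ (-r) := by
      have := (summable_nat_add_iff 1).mpr (Real.summable_nat_rpow.mpr (neg_lt_neg hr))
      refine this.congr fun k => ?_
      push_cast; rw [add_comm]
    apply Summable.of_nat_of_neg
    · simpa using h1
    · simpa using h1
  rw [show (fun k => hw r k) = fun k => hw r k from rfl]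
  simp only [hw]
  exact h.tsum_ofReal_ne_top

theorem tsum_hw_sub (r : ℝ) (m : ℤ) : ∑' k, hw r (m - k) = ∑' k, hw r k :=
  (Equiv.subLeft m).tsum_eq (hw r)

theorem one_le_jap (n : Freq) : 1 ≤ jap n := by
  rw [jap, Real.one_le_sqrt]; nlinarith [sq_nonneg (n.1 : ℝ), sq_nonneg (n.2 : ℝ)]

theorem abs_fst_le_jap (n : Freq) : |(n.1 : ℝ)| ≤ jap n := by
  apply Real.le_sqrt_of_sq_le; rw [sq_abs]; nlinarith [sq_nonneg (n.2 : ℝ)]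

theorem abs_snd_le_jap (n : Freq) : |(n.2 : ℝ)| ≤ jap n := by
  apply Real.le_sqrt_of_sq_le; rw [sq_abs]; nlinarith [sq_nonneg (n.1 : ℝ)]

theorem jap_neg (n : Freq) : jap (-n) = jap n := by simp [jap]

theorem jap_add_le (x y : Freq) : jap (x + y) ≤ jap x + jap y := by
  have hx : jap x ^ 2 = 1 + (x.1 : ℝ) ^ 2 + (x.2 : ℝ) ^ 2 := Real.sq_sqrt (by positivity)
  have hy : jap y ^ 2 = 1 + (y.1 : ℝ) ^ 2 + (y.2 : ℝ) ^ 2 := Real.sq_sqrt (by positivity)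
  have h : (x.1 : ℝ) * y.1 + x.2 * y.2 ≤ jap x * jap y := by
    apply (abs_le_of_sq_le_sq' _ (mul_pos (jap_pos x) (jap_pos y)).le).2
    rw [mul_pow, hx, hy]
    nlinarith [sq_nonneg ((x.1 : ℝ) * y.2 - x.2 * y.1), sq_nonneg (x.1 : ℝ),
      sq_nonneg (x.2 : ℝ), sq_nonneg (y.1 : ℝ), sq_nonneg (y.2 : ℝ)]
  apply Real.sqrt_le_iff.mpr ⟨(add_pos (jap_pos x) (jap_pos y)).le, ?_⟩
  simp only [Prod.fst_add, Prod.snd_add, Int.cast_add]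
  nlinarith

theorem jap_sub_le (x y : Freq) : jap (x - y) ≤ jap x + jap y := by
  rw [sub_eq_add_neg, ← jap_neg y]; exact jap_add_le _ _

theorem wJ_aux {r x : ℝ} (hr : 0 ≤ r) (n : Freq) (hx : |x| ≤ jap n) :
    jap n ^ (-r) ≤ 2 ^ r * (1 + |x|) ^ (-r) := by
  have h : (1 + |x|) / 2 ≤ jap n := by linarith [one_le_jap n]
  calc jap n ^ (-r) ≤ ((1 + |x|) / 2) ^ (-r) :=
        Real.rpow_le_rpow_of_nonpos (by positivity) h (by linarith)
    _ = _ := by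
      rw [Real.div_rpow (by positivity) (by norm_num), Real.rpow_neg (by norm_num : (0:ℝ) ≤ 2),
        div_inv_eq_mul, mul_comm]

/-- The exponent 1 + 2δ is split as (1 + δ) + δ. One coordinate receives a weight that is summable
over the integers, and the other keeps a small power, which suffices on a hyperbola. Both
distributions are needed, according to which coordinate is summed freely. -/
theorem wJ_le {δ : ℝ} (hδ : 0 ≤ δ) (n : Freq) :
    wJ (1 + 2 * δ) n ≤ ENNReal.ofReal (2 ^ (1 + 2 * δ)) * (hw (1 + δ) n.1 * hw δ n.2) ∧
    wJ (1 + 2 * δ) n ≤ ENNReal.ofReal (2 ^ (1 + 2 * δ)) * (hw δ n.1 * hw (1 + δ) n.2) := by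
  have e : jap n ^ (-(1 + 2 * δ)) = jap n ^ (-(1 + δ)) * jap n ^ (-δ) := by
    rw [← Real.rpow_add (jap_pos n)]; congr 1; ring
  have e2 : (2 : ℝ) ^ (1 + 2 * δ) = 2 ^ (1 + δ) * 2 ^ δ := by
    rw [← Real.rpow_add two_pos]; congr 1; ring
  have pj := fun r => Real.rpow_nonneg (jap_pos n).le r
  constructor
  · rw [wJ, hw, hw, ← ENNReal.ofReal_mul (by positivity), ← ENNReal.ofReal_mul (by positivity)]
    apply ENNReal.ofReal_le_ofReal
    rw [e, e2]
    calc _ ≤ (2 ^ (1 + δ) * (1 + |(n.1 : ℝ)|) ^ (-(1 + δ))) * (2 ^ δ * (1 + |(n.2 : ℝ)|) ^ (-δ)) :=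
          mul_le_mul (wJ_aux (by linarith) n (abs_fst_le_jap n)) (wJ_aux hδ n (abs_snd_le_jap n))
            (pj _) (by positivity)
      _ = _ := by ring
  · rw [wJ, hw, hw, ← ENNReal.ofReal_mul (by positivity), ← ENNReal.ofReal_mul (by positivity)]
    apply ENNReal.ofReal_le_ofReal
    rw [e, e2]
    calc _ ≤ (2 ^ (1 + δ) * (1 + |(n.2 : ℝ)|) ^ (-(1 + δ))) * (2 ^ δ * (1 + |(n.1 : ℝ)|) ^ (-δ)) :=
          mul_le_mul (wJ_aux (by linarith) n (abs_snd_le_jap n)) (wJ_aux hδ n (abs_fst_le_jap n))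
            (pj _) (by positivity)
      _ = _ := by ring

/-- Weighted sums over the lattice points of a hyperbola are uniformly bounded. -/
theorem exists_tsum_hyperbola_le {δ : ℝ} (hδ : 0 < δ) :
    ∃ C : ℝ≥0∞, C ≠ ⊤ ∧ ∀ c m m' : ℤ, c ≠ 0 →
      ∑' z : ℤ × ℤ, (if z.1 * z.2 = c then hw δ (m - z.1) * hw δ (m' - z.2) else 0) ≤ C := by
  obtain ⟨B, hB0, hB⟩ := exists_card_hyperbola_le (δ := δ / 2) (by positivity)
  -- Dyadic shells around (m, m'): the points with 2^N ≤ 1 + distance < 2^{N+1} number at most B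
  -- (2^{N+1})^{δ/2}, and each has weight at most 2^{-Nδ}. `G N` is the product, a geometric
  -- sequence.
  set G : ℕ → ℝ := fun N => (B * 2 ^ (δ / 2)) * ((2 : ℝ) ^ (-(δ / 2))) ^ N with hG
  have hGs : Summable G := (summable_geometric_of_lt_one (by positivity)
    (Real.rpow_lt_one_of_one_lt_of_neg one_lt_two (by linarith))).mul_left _
  refine ⟨∑' N, ENNReal.ofReal (G N), hGs.tsum_ofReal_ne_top, fun c m m' hc => ?_⟩
  set f : ℤ × ℤ → ℕ := fun z => 1 + max (m - z.1).natAbs (m' - z.2).natAbs with hf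
  set g : ℤ × ℤ → ℝ≥0∞ := fun z =>
    if z.1 * z.2 = c then hw δ (m - z.1) * hw δ (m' - z.2) else 0 with hg
  have hgN : ∀ z N, Nat.log 2 (f z) = N → g z ≤ ENNReal.ofReal (((2 : ℝ) ^ N) ^ (-δ)) := by
    intro z N hN
    simp only [hg]
    split_ifs with h
    · have h2 : 2 ^ N ≤ f z := by rw [← hN]; exact Nat.pow_log_le_self 2 (by simp [hf])
      have h2' : (2 : ℝ) ^ N ≤ f z := by exact_mod_cast h2
      have h3 : ∀ k : ℤ, f z = 1 + k.natAbs → hw δ k ≤ ENNReal.ofReal (((2 : ℝ) ^ N) ^ (-δ)) := by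
        intro k hk
        apply ENNReal.ofReal_le_ofReal
        apply Real.rpow_le_rpow_of_nonpos (by positivity) _ (by linarith)
        rw [hk] at h2'
        push_cast at h2'
        simpa [Nat.cast_natAbs] using h2'
      rcases le_total (m - z.1).natAbs (m' - z.2).natAbs with h4 | h4
      · calc _ ≤ 1 * hw δ (m' - z.2) := by gcongr; exact hw_le_one hδ.le _
          _ ≤ _ := by rw [one_mul]; exact h3 _ (by simp only [hf]; omega)
      · calc _ ≤ hw δ (m - z.1) * 1 := by gcongr; exact hw_le_one hδ.le _
          _ ≤ _ := by rw [mul_one]; exact h3 _ (by simp only [hf]; omega)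
    · exact zero_le
  have h1 : ∑' z, g z = ∑' N, ∑' z, if Nat.log 2 (f z) = N then g z else 0 := by
    rw [ENNReal.tsum_comm]
    exact tsum_congr fun z => by rw [tsum_eq_single (Nat.log 2 (f z))] <;> simp +contextual [eq_comm]
  rw [h1]
  apply ENNReal.tsum_le_tsum
  intro N
  rw [ENNReal.tsum_eq_iSup_sum]
  apply iSup_le
  intro S
  set S' := S.filter fun z => z.1 * z.2 = c ∧ Nat.log 2 (f z) = N with hS'
  have h2 : ∑ z ∈ S, (if Nat.log 2 (f z) = N then g z else 0)
      ≤ S'.card • ENNReal.ofReal (((2 : ℝ) ^ N) ^ (-δ)) := by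
    calc _ = ∑ z ∈ S', (if Nat.log 2 (f z) = N then g z else 0) := by
          symm; apply Finset.sum_subset (Finset.filter_subset _ _)
          intro z hz hz'
          rw [Finset.mem_filter, not_and, not_and] at hz'
          split_ifs with h
          · simp only [hg]; rw [if_neg]; intro h'; exact hz' hz h' h
          · rfl
      _ ≤ _ := by
          apply Finset.sum_le_card_nsmul
          intro z hz
          simp only [hS', Finset.mem_filter] at hz
          rw [if_pos hz.2.2]
          exact hgN z N hz.2.2
  have h3 : (S'.card : ℝ) ≤ B * ((2 ^ (N + 1) : ℕ) : ℝ) ^ (δ / 2) := by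
    apply hB c m m' (2 ^ (N + 1)) hc Nat.one_le_two_pow
    intro z hz
    simp only [hS', Finset.mem_filter] at hz
    have h4 : f z < 2 ^ (N + 1) := by
      rw [← hz.2.2]; exact Nat.lt_pow_succ_log_self (by norm_num) _
    simp only [hf] at h4
    refine ⟨hz.2.1, ?_, ?_⟩
    · rw [Int.abs_eq_natAbs]; norm_cast; omega
    · rw [Int.abs_eq_natAbs]; norm_cast; omega
  refine h2.trans ?_
  rw [nsmul_eq_mul, ← ENNReal.ofReal_natCast, ← ENNReal.ofReal_mul (by positivity)]
  apply ENNReal.ofReal_le_ofReal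
  calc (S'.card : ℝ) * ((2 : ℝ) ^ N) ^ (-δ)
      ≤ (B * ((2 ^ (N + 1) : ℕ) : ℝ) ^ (δ / 2)) * ((2 : ℝ) ^ N) ^ (-δ) := by gcongr
    _ = G N := by
      simp only [hG]
      push_cast
      have e : ((2 : ℝ) ^ (N + 1)) ^ (δ / 2) * ((2 : ℝ) ^ N) ^ (-δ)
          = 2 ^ (δ / 2) * ((2 : ℝ) ^ (-(δ / 2))) ^ N := by
        simp only [← Real.rpow_natCast, ← Real.rpow_mul (zero_le_two : (0 : ℝ) ≤ 2),
          ← Real.rpow_add (two_pos : (0 : ℝ) < 2)]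
        congr 1; push_cast; ring
      rw [mul_assoc, e]; ring

/-- Sums over the lattice points of the quadric `x₁y₁ - x₂y₂ = τ` with `x, y ≠ 0`. -/
theorem tsum_quadric_le {W : Freq → Freq → ℝ≥0∞} {θ₁ θ₂ Θ₁ Θ₂ : ℤ → ℤ → ℝ≥0∞}
    {η₁ η₂ η₃ η₄ : ℤ → ℝ≥0∞} {D : ℝ≥0∞}
    (hW1 : ∀ x y, W x y ≤ θ₁ x.1 y.1 * Θ₂ x.2 y.2) (hW2 : ∀ x y, W x y ≤ Θ₁ x.1 y.1 * θ₂ x.2 y.2)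
    (hW3 : ∀ a b, W (a, 0) (0, b) ≤ η₁ a * η₂ b) (hW4 : ∀ a b, W (0, a) (b, 0) ≤ η₃ a * η₄ b)
    (hθ₁ : ∀ c, c ≠ 0 → ∑' z : ℤ × ℤ, (if z.1 * z.2 = c then θ₁ z.1 z.2 else 0) ≤ D)
    (hθ₂ : ∀ c, c ≠ 0 → ∑' z : ℤ × ℤ, (if z.1 * z.2 = c then θ₂ z.1 z.2 else 0) ≤ D)
    (hΘ₁ : ∑' z : ℤ × ℤ, Θ₁ z.1 z.2 ≤ D) (hΘ₂ : ∑' z : ℤ × ℤ, Θ₂ z.1 z.2 ≤ D)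
    (hη₁ : ∑' a, η₁ a ≤ D) (hη₂ : ∑' a, η₂ a ≤ D) (hη₃ : ∑' a, η₃ a ≤ D) (hη₄ : ∑' a, η₄ a ≤ D)
    (τ : ℤ) :
    ∑' z : Freq × Freq, (if z.1 ≠ 0 ∧ z.2 ≠ 0 ∧ z.1.1 * z.2.1 - z.1.2 * z.2.2 = τ
      then W z.1 z.2 else 0) ≤ 4 * D ^ 2 := by
  set A : Freq × Freq → ℝ≥0∞ := fun z => if z.1.1 * z.2.1 = τ + z.1.2 * z.2.2 ∧
    τ + z.1.2 * z.2.2 ≠ 0 then θ₁ z.1.1 z.2.1 * Θ₂ z.1.2 z.2.2 else 0 with hA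
  set B : Freq × Freq → ℝ≥0∞ := fun z => if z.1.2 * z.2.2 = z.1.1 * z.2.1 - τ ∧
    z.1.1 * z.2.1 - τ ≠ 0 then Θ₁ z.1.1 z.2.1 * θ₂ z.1.2 z.2.2 else 0 with hB
  set C₁ : Freq × Freq → ℝ≥0∞ := fun z => (if z.1.2 = 0 then η₁ z.1.1 else 0) *
    (if z.2.1 = 0 then η₂ z.2.2 else 0) with hC₁
  set C₂ : Freq × Freq → ℝ≥0∞ := fun z => (if z.1.1 = 0 then η₃ z.1.2 else 0) *
    (if z.2.2 = 0 then η₄ z.2.1 else 0) with hC₂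
  -- If x₁y₁ ≠ 0, the first coordinates lie on a nondegenerate hyperbola once the second ones are
  -- fixed (`A`). If x₁y₁ = 0 ≠ x₂y₂, the roles are exchanged (`B`). If both products vanish, then
  -- x, y ≠ 0 forces x and y onto different coordinate axes, which leaves two free integers (`C₁`,
  -- `C₂`).
  have hle : ∀ z : Freq × Freq, (if z.1 ≠ 0 ∧ z.2 ≠ 0 ∧ z.1.1 * z.2.1 - z.1.2 * z.2.2 = τ
      then W z.1 z.2 else 0) ≤ A z + B z + (C₁ z + C₂ z) := by
    rintro ⟨⟨x₁, x₂⟩, y₁, y₂⟩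
    split_ifs with h
    · obtain ⟨hx, hy, hτ⟩ := h
      by_cases h1 : x₁ * y₁ = 0
      · by_cases h2 : x₂ * y₂ = 0
        · refine le_add_left ?_
          simp only [ne_eq, Prod.mk_eq_zero, not_and] at hx hy
          rcases mul_eq_zero.mp h1 with h3 | h3 <;> rcases mul_eq_zero.mp h2 with h4 | h4
          · exact absurd h4 (hx h3)
          · subst h3 h4; refine le_add_left ?_; simpa [hC₂] using hW4 x₂ y₁
          · subst h3 h4; refine le_add_right ?_; simpa [hC₁] using hW3 x₁ y₂
          · exact absurd h4 (hy h3)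
        · refine le_add_right (le_add_left ?_)
          simp only [hB]
          rw [if_pos ⟨by linarith, by intro h; apply h2; linarith⟩]
          exact hW2 _ _
      · refine le_add_right (le_add_right ?_)
        simp only [hA]
        rw [if_pos ⟨by linarith, by intro h; apply h1; linarith⟩]
        exact hW1 _ _
    · exact zero_le
  have sA : ∑' z, A z ≤ D * D := by
    rw [← (Equiv.prodProdProdComm ℤ ℤ ℤ ℤ).tsum_eq A, ENNReal.tsum_prod', ENNReal.tsum_comm]
    calc _ ≤ ∑' u : ℤ × ℤ, D * Θ₂ u.1 u.2 := by
          apply ENNReal.tsum_le_tsum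
          intro u
          by_cases hu : τ + u.1 * u.2 = 0
          · simp [hA, Equiv.prodProdProdComm, hu]
          · refine le_trans (le_of_eq ?_) (mul_le_mul_left (hθ₁ _ hu) _)
            rw [← ENNReal.tsum_mul_right]
            refine tsum_congr fun v => ?_
            simp [hA, Equiv.prodProdProdComm, hu]
      _ ≤ _ := by rw [ENNReal.tsum_mul_left]; gcongr
  have sB : ∑' z, B z ≤ D * D := by
    rw [← (Equiv.prodProdProdComm ℤ ℤ ℤ ℤ).tsum_eq B, ENNReal.tsum_prod']
    calc _ ≤ ∑' u : ℤ × ℤ, Θ₁ u.1 u.2 * D := by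
          apply ENNReal.tsum_le_tsum
          intro u
          by_cases hu : u.1 * u.2 - τ = 0
          · simp [hB, Equiv.prodProdProdComm, hu]
          · refine le_trans (le_of_eq ?_) (mul_le_mul_right (hθ₂ _ hu) _)
            rw [← ENNReal.tsum_mul_left]
            refine tsum_congr fun v => ?_
            simp [hB, Equiv.prodProdProdComm, hu]
      _ ≤ _ := by rw [ENNReal.tsum_mul_right]; gcongr
  have e1 : ∀ η : ℤ → ℝ≥0∞, ∑' x : ℤ × ℤ, (if x.2 = 0 then η x.1 else 0) = ∑' a, η a := by
    intro η
    rw [ENNReal.tsum_prod']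
    exact tsum_congr fun a => by simp
  have e2 : ∀ η : ℤ → ℝ≥0∞, ∑' x : ℤ × ℤ, (if x.1 = 0 then η x.2 else 0) = ∑' a, η a := by
    intro η
    rw [ENNReal.tsum_prod', ENNReal.tsum_comm]
    exact tsum_congr fun a => by simp
  have sC₁ : ∑' z, C₁ z ≤ D * D := by
    rw [ENNReal.tsum_prod']
    simp only [hC₁, ENNReal.tsum_mul_left, ENNReal.tsum_mul_right]
    rw [e1, e2]; gcongr
  have sC₂ : ∑' z, C₂ z ≤ D * D := by
    rw [ENNReal.tsum_prod']
    simp only [hC₂, ENNReal.tsum_mul_left, ENNReal.tsum_mul_right]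
    rw [e2, e1]; gcongr
  calc _ ≤ ∑' z, (A z + B z + (C₁ z + C₂ z)) := ENNReal.tsum_le_tsum hle
    _ = ∑' z, A z + ∑' z, B z + (∑' z, C₁ z + ∑' z, C₂ z) := by
        rw [ENNReal.tsum_add, ENNReal.tsum_add, ENNReal.tsum_add]
    _ ≤ D * D + D * D + (D * D + D * D) := by gcongr
    _ = _ := by ring


/-! ### Sums over the triples that interact to a given frequency -/

/-- The triples of frequencies that the children of a node of frequency `n` can have. -/
def Trip (n : Freq) : Set (Freq × Freq × Freq) :=
  {y | n = y.1 - y.2.1 + y.2.2 ∧ Disjoint ({n, y.2.1} : Set Freq) {y.1, y.2.2}}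

/-- The modulation of a node of frequency `n` whose children have the frequencies `y`. -/
def tripMod (n : Freq) (y : Freq × Freq × Freq) : ℤ :=
  hsq n - hsq y.1 + hsq y.2.1 - hsq y.2.2

/-- In the variables x = n - n₁ and y = n - n₃ the modulation is 2(x₁y₁ - x₂y₂), and the
disjointness condition gives x, y ≠ 0. Summing level set by level set separates the factor φ from
the weights. -/
theorem tsum_trip_le {W : Freq → Freq → ℝ≥0∞} {D : ℝ≥0∞}
    (hW : ∀ τ : ℤ, ∑' z : Freq × Freq, (if z.1 ≠ 0 ∧ z.2 ≠ 0 ∧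
      z.1.1 * z.2.1 - z.1.2 * z.2.2 = τ then W z.1 z.2 else 0) ≤ D)
    (n : Freq) (τ₀ : ℤ) (ε : ℤ) (hε : ε = 1 ∨ ε = -1) (φ : ℤ → ℝ≥0∞) :
    ∑' y : Trip n, φ (τ₀ + ε * tripMod n y) * W (n - y.1.1) (n - y.1.2.2) ≤ D * ∑' τ, φ τ := by
  set B : Freq × Freq → ℤ := fun z => z.1.1 * z.2.1 - z.1.2 * z.2.2 with hB
  set g : Freq × Freq → ℝ≥0∞ := fun z =>
    if z.1 ≠ 0 ∧ z.2 ≠ 0 then φ (τ₀ + ε * (2 * B z)) * W z.1 z.2 else 0 with hg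
  have h1 : ∑' y : Trip n, φ (τ₀ + ε * tripMod n y) * W (n - y.1.1) (n - y.1.2.2)
      ≤ ∑' z, g z := by
    have hinj : Function.Injective fun y : Trip n => ((n - y.1.1, n - y.1.2.2) : Freq × Freq) := by
      rintro ⟨⟨a, b, c⟩, h, _⟩ ⟨⟨a', b', c'⟩, h', _⟩ he
      simp only [Prod.mk.injEq, sub_right_inj] at he h h'
      obtain ⟨rfl, rfl⟩ := he
      have : b = b' := by
        have e1 : b = a + c - n := by rw [h]; abel
        have e2 : b' = a + c - n := by rw [h']; abel
        rw [e1, e2]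
      subst this; rfl
    refine le_trans (le_of_eq ?_) (ENNReal.tsum_comp_le_tsum_of_injective hinj g)
    refine tsum_congr ?_
    rintro ⟨⟨a, b, c⟩, h, hd⟩
    simp only at h hd ⊢
    simp only [Set.disjoint_insert_left, Set.mem_insert_iff, Set.mem_singleton_iff, not_or] at hd
    have hx : n - a ≠ 0 := sub_ne_zero.mpr hd.1.1
    have hy : n - c ≠ 0 := sub_ne_zero.mpr hd.1.2
    simp only [hg]
    rw [if_pos ⟨hx, hy⟩]
    congr 3
    subst h
    simp only [tripMod, hB, hsq, Prod.fst_add, Prod.snd_add, Prod.fst_sub, Prod.snd_sub]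
    ring
  have h2 : ∑' z, g z = ∑' τ, φ (τ₀ + ε * (2 * τ)) * ∑' z : Freq × Freq,
      (if z.1 ≠ 0 ∧ z.2 ≠ 0 ∧ z.1.1 * z.2.1 - z.1.2 * z.2.2 = τ then W z.1 z.2 else 0) := by
    simp_rw [← ENNReal.tsum_mul_left]
    rw [ENNReal.tsum_comm]
    refine tsum_congr fun z => ?_
    rw [tsum_eq_single (B z)]
    · simp only [hg, hB]
      by_cases h : z.1 ≠ 0 ∧ z.2 ≠ 0
      · rw [if_pos h, if_pos ⟨h.1, h.2, trivial⟩]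
      · rw [if_neg h, if_neg fun h' => h ⟨h'.1, h'.2.1⟩, mul_zero]
    · intro τ hτ
      rw [if_neg fun h' => hτ h'.2.2.symm, mul_zero]
  have h3 : ∑' τ, φ (τ₀ + ε * (2 * τ)) ≤ ∑' τ, φ τ := by
    refine ENNReal.tsum_comp_le_tsum_of_injective (f := fun τ : ℤ => τ₀ + ε * (2 * τ)) ?_ φ
    intro a b h
    rcases hε with rfl | rfl <;> simp at h <;> exact h
  calc _ ≤ _ := h1
    _ = _ := h2
    _ ≤ ∑' τ, φ (τ₀ + ε * (2 * τ)) * D := by gcongr; exact hW _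
    _ ≤ _ := by rw [ENNReal.tsum_mul_right, mul_comm]; gcongr

/-- When the weighted children are the middle one and an outer one, the weights are centred in x + y
and y rather than in x and y. Half of the exponent is spent on recentring one of them. -/
theorem hw_half_mul_le {δ : ℝ} (hδ : 0 < δ) (u v : ℤ) :
    hw δ u * hw δ v ≤ hw (δ / 2) (v - u) * hw (δ / 2) v := by
  have h : δ = δ / 2 + δ / 2 := by ring
  have h2 : 0 ≤ δ / 2 := by positivity
  calc hw δ u * hw δ v = (hw (δ / 2) u * hw (δ / 2) v) * (hw (δ / 2) u * hw (δ / 2) v) := by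
        conv_lhs => rw [h, hw_add, hw_add]
        ring
    _ ≤ hw (δ / 2) (v - u) * (1 * hw (δ / 2) v) := by
        gcongr
        · exact hw_mul_le h2 _ _
        · exact hw_le_one h2 _
    _ = _ := by rw [one_mul]

/-- The children are n₁ = n - x, n₂ = n - x - y, n₃ = n - y. The first sum has its weights at n₁ and
n₃, the second at n₂ and n₃; the remaining pair follows by symmetry in x and y. -/
theorem exists_quadric_weights_le {δ : ℝ} (hδ : 0 < δ) :
    ∃ D : ℝ≥0∞, D ≠ ⊤ ∧ ∀ (n : Freq) (τ : ℤ),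
      (∑' z : Freq × Freq, (if z.1 ≠ 0 ∧ z.2 ≠ 0 ∧ z.1.1 * z.2.1 - z.1.2 * z.2.2 = τ
        then wJ (1 + 2 * δ) (n - z.1) * wJ (1 + 2 * δ) (n - z.2) else 0) ≤ D) ∧
      (∑' z : Freq × Freq, (if z.1 ≠ 0 ∧ z.2 ≠ 0 ∧ z.1.1 * z.2.1 - z.1.2 * z.2.2 = τ
        then wJ (1 + 2 * δ) (n - z.1 - z.2) * wJ (1 + 2 * δ) (n - z.2) else 0) ≤ D) := by
  obtain ⟨C₁, hC₁, h₁⟩ := exists_tsum_hyperbola_le hδ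
  obtain ⟨C₂, hC₂, h₂⟩ := exists_tsum_hyperbola_le (δ := δ / 2) (by positivity)
  set k : ℝ≥0∞ := ENNReal.ofReal (2 ^ (1 + 2 * δ)) with hk
  have hkt : k ≠ ⊤ := ENNReal.ofReal_ne_top
  set S : ℝ≥0∞ := ∑' j, hw (1 + δ) j with hS
  have hSt : S ≠ ⊤ := tsum_hw_ne_top (by linarith)
  set D : ℝ≥0∞ := C₁ + C₂ + k * k * (S * S) + k * S with hD
  have hDt : D ≠ ⊤ := by
    simp only [hD, ne_eq, ENNReal.add_eq_top, not_or]
    exact ⟨⟨⟨hC₁, hC₂⟩, ENNReal.mul_ne_top (ENNReal.mul_ne_top hkt hkt)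
      (ENNReal.mul_ne_top hSt hSt)⟩, ENNReal.mul_ne_top hkt hSt⟩
  have hD1 : C₁ ≤ D := le_add_right (le_add_right le_self_add)
  have hD2 : C₂ ≤ D := le_add_right (le_add_right le_add_self)
  have hD3 : k * k * (S * S) ≤ D := le_add_right le_add_self
  have hD4 : k * S ≤ D := le_add_self
  have w1 : ∀ n : Freq, wJ (1 + 2 * δ) n ≤ k * (hw δ n.1 * hw (1 + δ) n.2) :=
    fun n => (wJ_le hδ.le n).2
  have w2 : ∀ n : Freq, wJ (1 + 2 * δ) n ≤ k * (hw (1 + δ) n.1 * hw δ n.2) :=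
    fun n => (wJ_le hδ.le n).1
  have w3 : ∀ n : Freq, wJ (1 + 2 * δ) n ≤ k * hw (1 + δ) n.1 := fun n =>
    (w2 n).trans (by gcongr; exact mul_le_of_le_one_right' (hw_le_one hδ.le _))
  have w4 : ∀ n : Freq, wJ (1 + 2 * δ) n ≤ k * hw (1 + δ) n.2 := fun n =>
    (w1 n).trans (by gcongr; exact mul_le_of_le_one_left' (hw_le_one hδ.le _))
  have s1 : ∀ m : ℤ, ∑' a : ℤ, k * hw (1 + δ) (m - a) ≤ D := fun m => by
    rw [ENNReal.tsum_mul_left, tsum_hw_sub]; exact hD4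
  refine ⟨4 * D ^ 2, ENNReal.mul_ne_top (by norm_num) (ENNReal.pow_ne_top hDt), fun n τ => ⟨?_, ?_⟩⟩
  · have s2 : ∀ m : ℤ, ∑' z : ℤ × ℤ, k * k * (hw (1 + δ) (m - z.1) * hw (1 + δ) (m - z.2)) ≤ D := by
      intro m
      rw [ENNReal.tsum_mul_left, ENNReal.tsum_prod']
      simp only [ENNReal.tsum_mul_left, ENNReal.tsum_mul_right, tsum_hw_sub]
      exact hD3
    refine tsum_quadric_le (W := fun x y => wJ (1 + 2 * δ) (n - x) * wJ (1 + 2 * δ) (n - y))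
      (θ₁ := fun a b => hw δ (n.1 - a) * hw δ (n.1 - b))
      (θ₂ := fun a b => hw δ (n.2 - a) * hw δ (n.2 - b))
      (Θ₁ := fun a b => k * k * (hw (1 + δ) (n.1 - a) * hw (1 + δ) (n.1 - b)))
      (Θ₂ := fun a b => k * k * (hw (1 + δ) (n.2 - a) * hw (1 + δ) (n.2 - b)))
      (η₁ := fun a => k * hw (1 + δ) (n.1 - a)) (η₂ := fun a => k * hw (1 + δ) (n.2 - a))
      (η₃ := fun a => k * hw (1 + δ) (n.2 - a)) (η₄ := fun a => k * hw (1 + δ) (n.1 - a))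
      ?_ ?_ ?_ ?_ ?_ ?_ (s2 _) (s2 _) (s1 _) (s1 _) (s1 _) (s1 _) τ
    · intro x y
      calc _ ≤ (k * (hw δ (n - x).1 * hw (1 + δ) (n - x).2)) *
            (k * (hw δ (n - y).1 * hw (1 + δ) (n - y).2)) := by gcongr <;> exact w1 _
        _ = _ := by simp only [Prod.fst_sub, Prod.snd_sub]; ring
    · intro x y
      calc _ ≤ (k * (hw (1 + δ) (n - x).1 * hw δ (n - x).2)) *
            (k * (hw (1 + δ) (n - y).1 * hw δ (n - y).2)) := by gcongr <;> exact w2 _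
        _ = _ := by simp only [Prod.fst_sub, Prod.snd_sub]; ring
    · intro a b
      exact mul_le_mul' (w3 _) (w4 _)
    · intro a b
      exact mul_le_mul' (w4 _) (w3 _)
    · exact fun c hc => (h₁ c n.1 n.1 hc).trans hD1
    · exact fun c hc => (h₁ c n.2 n.2 hc).trans hD1
  · have s2 : ∀ m : ℤ, ∑' z : ℤ × ℤ, k * k * (hw (1 + δ) (m - z.1 - z.2) * hw (1 + δ) (m - z.2))
        ≤ D := by
      intro m
      rw [ENNReal.tsum_mul_left, ENNReal.tsum_prod', ENNReal.tsum_comm]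
      have : ∀ b, ∑' a, hw (1 + δ) (m - a - b) = S := fun b => by
        rw [hS, ← tsum_hw_sub _ (m - b)]; exact tsum_congr fun a => by congr 1; ring
      simp only [ENNReal.tsum_mul_right, this, ENNReal.tsum_mul_left, tsum_hw_sub]
      exact hD3
    have t : ∀ m c : ℤ, c ≠ 0 → ∑' z : ℤ × ℤ, (if z.1 * z.2 = c then
        hw δ (m - z.1 - z.2) * hw δ (m - z.2) else 0) ≤ D := by
      intro m c hc
      refine le_trans (ENNReal.tsum_le_tsum fun z => ?_) ((h₂ c 0 m hc).trans hD2)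
      split_ifs
      · refine (hw_half_mul_le hδ _ _).trans (le_of_eq ?_)
        rw [show m - z.2 - (m - z.1 - z.2) = -(0 - z.1) by ring, hw_neg]
      · exact le_rfl
    refine tsum_quadric_le (W := fun x y => wJ (1 + 2 * δ) (n - x - y) * wJ (1 + 2 * δ) (n - y))
      (θ₁ := fun a b => hw δ (n.1 - a - b) * hw δ (n.1 - b))
      (θ₂ := fun a b => hw δ (n.2 - a - b) * hw δ (n.2 - b))
      (Θ₁ := fun a b => k * k * (hw (1 + δ) (n.1 - a - b) * hw (1 + δ) (n.1 - b)))
      (Θ₂ := fun a b => k * k * (hw (1 + δ) (n.2 - a - b) * hw (1 + δ) (n.2 - b)))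
      (η₁ := fun a => k * hw (1 + δ) (n.1 - a)) (η₂ := fun a => k * hw (1 + δ) (n.2 - a))
      (η₃ := fun a => k * hw (1 + δ) (n.2 - a)) (η₄ := fun a => k * hw (1 + δ) (n.1 - a))
      ?_ ?_ ?_ ?_ (t _) (t _) (s2 _) (s2 _) (s1 _) (s1 _) (s1 _) (s1 _) τ
    · intro x y
      calc _ ≤ (k * (hw δ (n - x - y).1 * hw (1 + δ) (n - x - y).2)) *
            (k * (hw δ (n - y).1 * hw (1 + δ) (n - y).2)) := by gcongr <;> exact w1 _
        _ = _ := by simp only [Prod.fst_sub, Prod.snd_sub]; ring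
    · intro x y
      calc _ ≤ (k * (hw (1 + δ) (n - x - y).1 * hw δ (n - x - y).2)) *
            (k * (hw (1 + δ) (n - y).1 * hw δ (n - y).2)) := by gcongr <;> exact w2 _
        _ = _ := by simp only [Prod.fst_sub, Prod.snd_sub]; ring
    · intro a b
      exact mul_le_mul' ((w3 _).trans (by simp)) ((w4 _).trans (by simp))
    · intro a b
      exact mul_le_mul' ((w4 _).trans (by simp)) ((w3 _).trans (by simp))

/-- One of the three children carries the weight of the node. -/
theorem wJ_trip_le {a : ℝ} (ha : 0 ≤ a) {n : Freq} {y : Freq × Freq × Freq} (hy : y ∈ Trip n) :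
    wJ a y.1 * wJ a y.2.1 * wJ a y.2.2 ≤ ENNReal.ofReal (3 ^ a) * wJ a n *
      (wJ a y.2.1 * wJ a y.2.2 + wJ a y.1 * wJ a y.2.2 + wJ a y.1 * wJ a y.2.1) := by
  have h1 : jap n ≤ jap y.1 + jap y.2.1 + jap y.2.2 := by
    rw [hy.1]; exact (jap_add_le _ _).trans (by gcongr; exact jap_sub_le _ _)
  have h2 : ∀ x : Freq, jap n ≤ 3 * jap x → wJ a x ≤ ENNReal.ofReal (3 ^ a) * wJ a n := by
    intro x hx
    rw [wJ, wJ, ← ENNReal.ofReal_mul (by positivity)]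
    apply ENNReal.ofReal_le_ofReal
    calc jap x ^ (-a) ≤ (jap n / 3) ^ (-a) := by
          apply Real.rpow_le_rpow_of_nonpos _ _ (by linarith)
          · have := jap_pos n; positivity
          · linarith
      _ = _ := by
          rw [Real.div_rpow (jap_pos n).le (by norm_num), Real.rpow_neg (by norm_num : (0:ℝ) ≤ 3),
            div_inv_eq_mul, mul_comm]
  have h3 : jap n ≤ 3 * jap y.1 ∨ jap n ≤ 3 * jap y.2.1 ∨ jap n ≤ 3 * jap y.2.2 := by
    by_contra! h
    linarith [h.1, h.2.1, h.2.2]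
  rw [mul_add, mul_add]
  rcases h3 with h | h | h
  · refine le_add_right (le_add_right ?_)
    calc _ = wJ a y.1 * (wJ a y.2.1 * wJ a y.2.2) := by ring
      _ ≤ _ := by gcongr; exact h2 _ h
  · refine le_add_right (le_add_left ?_)
    calc _ = wJ a y.2.1 * (wJ a y.1 * wJ a y.2.2) := by ring
      _ ≤ _ := by gcongr; exact h2 _ h
  · refine le_add_left ?_
    calc _ = wJ a y.2.2 * (wJ a y.1 * wJ a y.2.1) := by ring
      _ ≤ _ := by gcongr; exact h2 _ h

/-- The weighted sums over triples that control one generation of a tree. -/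
theorem exists_tripleSum_le {a : ℝ} (ha : 1 < a) :
    ∃ C : ℝ≥0, ∀ (n : Freq) (τ₀ ε : ℤ), (ε = 1 ∨ ε = -1) → ∀ φ : ℤ → ℝ≥0∞,
      (∑' y : Trip n, φ (τ₀ + ε * tripMod n y) * (wJ a y.1.2.1 * wJ a y.1.2.2) ≤ C * ∑' τ, φ τ) ∧
      (∑' y : Trip n, φ (τ₀ + ε * tripMod n y) * (wJ a y.1.1 * wJ a y.1.2.2) ≤ C * ∑' τ, φ τ) ∧
      (∑' y : Trip n, φ (τ₀ + ε * tripMod n y) * (wJ a y.1.1 * wJ a y.1.2.1) ≤ C * ∑' τ, φ τ) ∧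
      (∑' y : Trip n, φ (τ₀ + ε * tripMod n y) * (wJ a y.1.1 * wJ a y.1.2.1 * wJ a y.1.2.2)
        ≤ C * (∑' τ, φ τ) * wJ a n) := by
  obtain ⟨δ, hδ, rfl⟩ : ∃ δ : ℝ, 0 < δ ∧ a = 1 + 2 * δ := ⟨(a - 1) / 2, by linarith, by ring⟩
  obtain ⟨D, hDt, hD⟩ := exists_quadric_weights_le hδ
  lift D to ℝ≥0 using hDt
  set a := 1 + 2 * δ with ha'
  set t : ℝ≥0 := Real.toNNReal (3 ^ a) with ht
  have key : ∀ (n : Freq) (τ₀ ε : ℤ), (ε = 1 ∨ ε = -1) → ∀ φ : ℤ → ℝ≥0∞,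
      (∑' y : Trip n, φ (τ₀ + ε * tripMod n y) * (wJ a y.1.2.1 * wJ a y.1.2.2) ≤ D * ∑' τ, φ τ) ∧
      (∑' y : Trip n, φ (τ₀ + ε * tripMod n y) * (wJ a y.1.1 * wJ a y.1.2.2) ≤ D * ∑' τ, φ τ) ∧
      (∑' y : Trip n, φ (τ₀ + ε * tripMod n y) * (wJ a y.1.1 * wJ a y.1.2.1)
        ≤ D * ∑' τ, φ τ) := by
    intro n τ₀ ε hε φ
    have e : ∀ y : Trip n, y.1.2.1 = n - (n - y.1.1) - (n - y.1.2.2) := fun y => by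
      have := y.2.1
      calc y.1.2.1 = y.1.1 + y.1.2.2 - (y.1.1 - y.1.2.1 + y.1.2.2) := by abel
        _ = y.1.1 + y.1.2.2 - n := by rw [← this]
        _ = _ := by abel
    refine ⟨?_, ?_, ?_⟩
    · refine le_trans (le_of_eq (tsum_congr fun y => ?_)) (tsum_trip_le
        (W := fun x y => wJ a (n - x - y) * wJ a (n - y)) (fun τ => (hD n τ).2) n τ₀ ε hε φ)
      rw [← e, sub_sub_cancel]
    · refine le_trans (le_of_eq (tsum_congr fun y => ?_)) (tsum_trip_le
        (W := fun x y => wJ a (n - x) * wJ a (n - y)) (fun τ => (hD n τ).1) n τ₀ ε hε φ)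
      simp only [sub_sub_cancel]
    -- The pair n₁, n₂ is the pair n₂, n₃ after interchanging x and y, which leaves the quadratic
    -- form unchanged.
    · refine le_trans (le_of_eq (tsum_congr fun y => ?_)) (tsum_trip_le
        (W := fun x y => wJ a (n - y - x) * wJ a (n - x)) (fun τ => ?_) n τ₀ ε hε φ)
      · rw [sub_right_comm n (n - y.1.2.2), ← e, sub_sub_cancel, mul_comm (wJ a _)]
      · refine le_trans (le_of_eq ?_) (hD n τ).2
        rw [← (Equiv.prodComm Freq Freq).tsum_eq]
        refine tsum_congr fun z => ?_
        simp only [Equiv.prodComm_apply, Prod.fst_swap, Prod.snd_swap]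
        congr 1
        rw [eq_iff_iff]
        constructor
        · rintro ⟨h1, h2, h3⟩; exact ⟨h2, h1, by linarith⟩
        · rintro ⟨h1, h2, h3⟩; exact ⟨h2, h1, by linarith⟩
  refine ⟨D + t * (D + D + D), fun n τ₀ ε hε φ => ?_⟩
  obtain ⟨k1, k2, k3⟩ := key n τ₀ ε hε φ
  have hle : ((D : ℝ≥0) : ℝ≥0∞) ≤ ((D + t * (D + D + D) : ℝ≥0) : ℝ≥0∞) := by
    exact_mod_cast le_self_add
  refine ⟨k1.trans (by gcongr), k2.trans (by gcongr), k3.trans (by gcongr), ?_⟩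
  -- With weights at all three children, one child satisfies ⟨n⟩ ≤ 3⟨nᵢ⟩ and its weight is at most
  -- 3^a times that of n. The other two are summed as before.
  calc _ ≤ ∑' y : Trip n, (t * wJ a n) * (φ (τ₀ + ε * tripMod n y) * (wJ a y.1.2.1 * wJ a y.1.2.2)
        + φ (τ₀ + ε * tripMod n y) * (wJ a y.1.1 * wJ a y.1.2.2)
        + φ (τ₀ + ε * tripMod n y) * (wJ a y.1.1 * wJ a y.1.2.1)) := by
        apply ENNReal.tsum_le_tsum
        intro y
        calc _ ≤ φ (τ₀ + ε * tripMod n y) * (ENNReal.ofReal (3 ^ a) * wJ a n *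
              (wJ a y.1.2.1 * wJ a y.1.2.2 + wJ a y.1.1 * wJ a y.1.2.2
                + wJ a y.1.1 * wJ a y.1.2.1)) := by
              exact mul_le_mul_right (wJ_trip_le (by linarith) y.2) _
          _ = _ := by rw [ht, ENNReal.ofReal]; ring
    _ = (t * wJ a n) * (∑' y : Trip n, φ (τ₀ + ε * tripMod n y) * (wJ a y.1.2.1 * wJ a y.1.2.2)
        + ∑' y : Trip n, φ (τ₀ + ε * tripMod n y) * (wJ a y.1.1 * wJ a y.1.2.2)
        + ∑' y : Trip n, φ (τ₀ + ε * tripMod n y) * (wJ a y.1.1 * wJ a y.1.2.1)) := by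
        rw [ENNReal.tsum_mul_left, ENNReal.tsum_add, ENNReal.tsum_add]
    _ ≤ (t * wJ a n) * (D * ∑' τ, φ τ + D * ∑' τ, φ τ + D * ∑' τ, φ τ) := by gcongr
    _ = ((t * (D + D + D) : ℝ≥0) : ℝ≥0∞) * (∑' τ, φ τ) * wJ a n := by push_cast; ring
    _ ≤ _ := by gcongr; exact le_add_self


/-! ### Removing the last generation of an ordered tree -/

namespace OrderedTree

/-- The tree of the previous generation. -/
def init {J : ℕ} (T : OrderedTree (J + 1)) : OrderedTree J where
  node k := T.node k.castSucc
  root_first k hk := T.root_first _ (by simpa using hk)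
  grows k hk := by
    obtain ⟨i, hi, c, h⟩ := T.grows k.castSucc (by simpa using hk)
    have hi' : (i : ℕ) < k := hi
    exact ⟨⟨i, hi'.trans k.2⟩, hi', c, h⟩
  injective := T.injective.comp (Fin.castSucc_injective J)

/-- The node that becomes non-terminal in the last step. -/
def lastNode {J : ℕ} (T : OrderedTree (J + 1)) : Node := T.node (Fin.last J)

theorem ext_node {J : ℕ} {T T' : OrderedTree J} (h : T.node = T'.node) : T = T' := by
  cases T; cases T'; cases h; rfl

theorem mem_nonterminal {J : ℕ} {T : OrderedTree J} {a : Node} :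
    a ∈ T.nonterminal ↔ ∃ k, T.node k = a := by
  simp [nonterminal]

theorem mem_nodes {J : ℕ} {T : OrderedTree J} {a : Node} :
    a ∈ T.nodes ↔ a = [] ∨ ∃ k c, a = c :: T.node k := by
  simp [nodes, nonterminal, eq_comm]

theorem cons_mem_nodes {J : ℕ} {T : OrderedTree J} {a : Node} {c : Fin 3} :
    c :: a ∈ T.nodes ↔ a ∈ T.nonterminal := by
  rw [mem_nodes, mem_nonterminal]
  constructor
  · rintro (h | ⟨k, c', h⟩)
    · simp at h
    · exact ⟨k, by simp at h; exact h.2.symm⟩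
  · rintro ⟨k, rfl⟩; exact Or.inr ⟨k, c, rfl⟩

theorem nil_mem_nodes {J : ℕ} (T : OrderedTree J) : [] ∈ T.nodes := mem_nodes.mpr (Or.inl rfl)

theorem nonterminal_subset_nodes {J : ℕ} (T : OrderedTree J) : T.nonterminal ⊆ T.nodes := by
  intro a ha
  obtain ⟨k, rfl⟩ := mem_nonterminal.mp ha
  by_cases h0 : (k : ℕ) = 0
  · rw [T.root_first k h0]; exact T.nil_mem_nodes
  · obtain ⟨i, _, c, h⟩ := T.grows k h0
    rw [h, cons_mem_nodes]; exact mem_nonterminal.mpr ⟨i, rfl⟩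

theorem sum_nodes {J : ℕ} (T : OrderedTree J) {M : Type*} [AddCommMonoid M] (φ : Node → M) :
    ∑ a ∈ T.nodes, φ a = φ [] + ∑ k, ∑ c : Fin 3, φ (c :: T.node k) := by
  rw [nodes, Finset.sum_insert, Finset.sum_biUnion, nonterminal,
    Finset.sum_image fun i _ j _ h => T.injective h]
  · refine congrArg (φ [] + ·) (Finset.sum_congr rfl fun k _ => ?_)
    rw [Finset.sum_image]
    intro c _ c' _ h
    exact (List.cons.inj h).1
  · intro a _ b _ hab
    rw [Function.onFun, Finset.disjoint_left]
    intro x hx hx'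
    simp only [Finset.mem_image, Finset.mem_univ, true_and] at hx hx'
    obtain ⟨c, rfl⟩ := hx
    obtain ⟨c', h⟩ := hx'
    exact hab (List.cons.inj h).2.symm
  · simp

/-- Every node except the root is a child of exactly one non-terminal node, so the sum over all
nodes can be taken in two ways. The number of leaves, the conservation of frequency and the
telescoping of the modulations are all instances. -/
theorem sum_terminal_add {J : ℕ} (T : OrderedTree J) {M : Type*} [AddCommMonoid M]
    (φ : Node → M) :
    ∑ a ∈ T.terminal, φ a + ∑ k, φ (T.node k) = φ [] + ∑ k, ∑ c : Fin 3, φ (c :: T.node k) := by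
  rw [← sum_nodes, terminal, ← Finset.sum_sdiff (nonterminal_subset_nodes T) (f := φ)]
  congr 1
  rw [nonterminal, Finset.sum_image fun i _ j _ h => T.injective h]

theorem card_terminal {J : ℕ} (T : OrderedTree J) : T.terminal.card = 2 * J + 1 := by
  have h := T.sum_terminal_add (fun _ => (1 : ℕ))
  simp at h
  omega

section Succ

variable {J : ℕ} (T : OrderedTree (J + 1))

theorem mem_nonterminal_succ {a : Node} :
    a ∈ T.nonterminal ↔ a ∈ T.init.nonterminal ∨ a = T.lastNode := by
  rw [mem_nonterminal, mem_nonterminal, Fin.exists_fin_succ']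
  simp [init, lastNode, eq_comm]

theorem lastNode_notMem : T.lastNode ∉ T.init.nonterminal := by
  rw [mem_nonterminal]
  rintro ⟨k, hk⟩
  exact absurd (T.injective hk) (Fin.castSucc_lt_last k).ne

theorem lastNode_mem_nodes : T.lastNode ∈ T.init.nodes := by
  rw [lastNode]
  by_cases h0 : J = 0
  · rw [T.root_first _ (by simpa using h0)]; exact nil_mem_nodes _
  · obtain ⟨i, hi, c, h⟩ := T.grows (Fin.last J) (by simpa using h0)
    rw [h, cons_mem_nodes, mem_nonterminal]
    exact ⟨⟨i, hi⟩, rfl⟩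

theorem lastNode_mem_terminal : T.lastNode ∈ T.init.terminal :=
  Finset.mem_sdiff.mpr ⟨T.lastNode_mem_nodes, T.lastNode_notMem⟩

theorem cons_lastNode_notMem (c : Fin 3) : c :: T.lastNode ∉ T.init.nodes := fun h =>
  T.lastNode_notMem (cons_mem_nodes.mp h)

theorem cons_lastNode_notMem_nonterminal (c : Fin 3) : c :: T.lastNode ∉ T.nonterminal := by
  rw [mem_nonterminal]
  rintro ⟨k, hk⟩
  by_cases h0 : (k : ℕ) = 0
  · rw [T.root_first k h0] at hk; simp at hk
  · obtain ⟨i, hi, c', h⟩ := T.grows k h0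
    rw [h] at hk
    have := T.injective (List.cons.inj hk).2
    rw [this] at hi
    exact absurd hi (Fin.le_last k).not_gt

theorem mem_nodes_succ {a : Node} :
    a ∈ T.nodes ↔ a ∈ T.init.nodes ∨ ∃ c : Fin 3, a = c :: T.lastNode := by
  rw [mem_nodes, mem_nodes, Fin.exists_fin_succ']
  simp [init, lastNode, or_assoc]

/-- The last step replaces one leaf by its three children. The inductions over the generation rest
on this. -/
theorem prod_terminal_succ {M : Type*} [CommMonoid M] (g : Node → M) :
    ∏ a ∈ T.terminal, g a = (∏ a ∈ T.init.terminal.erase T.lastNode, g a) *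
      (g (0 :: T.lastNode) * g (1 :: T.lastNode) * g (2 :: T.lastNode)) := by
  have h : T.terminal = T.init.terminal.erase T.lastNode ∪
      Finset.univ.image fun c : Fin 3 => c :: T.lastNode := by
    ext a
    simp only [terminal, Finset.mem_union, Finset.mem_erase, Finset.mem_sdiff, Finset.mem_image,
      Finset.mem_univ, true_and]
    rw [mem_nodes_succ, mem_nonterminal_succ]
    constructor
    · rintro ⟨h1 | ⟨c, rfl⟩, h2⟩
      · push Not at h2; exact Or.inl ⟨h2.2, h1, h2.1⟩
      · exact Or.inr ⟨c, rfl⟩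
    · rintro (⟨h1, h2, h3⟩ | ⟨c, rfl⟩)
      · exact ⟨Or.inl h2, by push Not; exact ⟨h3, h1⟩⟩
      · refine ⟨Or.inr ⟨c, rfl⟩, ?_⟩
        rw [← mem_nonterminal_succ]
        exact T.cons_lastNode_notMem_nonterminal c
  rw [h, Finset.prod_union, Finset.prod_image, Fin.prod_univ_three]
  · intro c _ c' _ h
    exact (List.cons.inj h).1
  · rw [Finset.disjoint_right]
    intro x hx
    simp only [Finset.mem_image, Finset.mem_univ, true_and] at hx
    obtain ⟨c, rfl⟩ := hx
    intro h
    exact T.cons_lastNode_notMem c (Finset.mem_sdiff.mp (Finset.mem_of_mem_erase h)).1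

/-- The restriction of an index function to the tree of the previous generation. -/
def res (n : Node → Freq) : Node → Freq := fun b => if b ∈ T.init.nodes then n b else 0

theorem res_apply {n : Node → Freq} {b : Node} (hb : b ∈ T.init.nodes) : T.res n b = n b :=
  if_pos hb

/-- The frequencies of the children of the last non-terminal node. -/
def lastTrip (n : Node → Freq) : Freq × Freq × Freq :=
  (n (0 :: T.lastNode), n (1 :: T.lastNode), n (2 :: T.lastNode))

theorem res_mem {n : Node → Freq} {m : Freq} (hn : n ∈ T.indexFn m) :
    T.res n ∈ T.init.indexFn m := by
  refine ⟨fun a ha => if_neg ha, ?_, fun a ha => ?_⟩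
  · rw [T.res_apply (nil_mem_nodes _)]; exact hn.2.1
  · have h := hn.2.2 a (T.mem_nonterminal_succ.mpr (Or.inl ha))
    rw [T.res_apply (nonterminal_subset_nodes _ ha), T.res_apply (cons_mem_nodes.mpr ha),
      T.res_apply (cons_mem_nodes.mpr ha), T.res_apply (cons_mem_nodes.mpr ha)]
    exact h

theorem lastTrip_mem {n : Node → Freq} {m : Freq} (hn : n ∈ T.indexFn m) :
    T.lastTrip n ∈ Trip (T.res n T.lastNode) := by
  have h := hn.2.2 T.lastNode (T.mem_nonterminal_succ.mpr (Or.inr rfl))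
  rw [T.res_apply T.lastNode_mem_nodes]
  exact h

theorem eq_of_res_eq {n n' : Node → Freq} {m : Freq} (hn : n ∈ T.indexFn m)
    (hn' : n' ∈ T.indexFn m) (h : T.res n = T.res n') (h' : T.lastTrip n = T.lastTrip n') :
    n = n' := by
  funext a
  by_cases ha : a ∈ T.nodes
  · rcases T.mem_nodes_succ.mp ha with h1 | ⟨c, rfl⟩
    · have := congrFun h a
      rwa [T.res_apply h1, T.res_apply h1] at this
    · simp only [lastTrip, Prod.mk.injEq] at h'
      fin_cases c
      · exact h'.1
      · exact h'.2.1
      · exact h'.2.2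
  · rw [hn.1 a ha, hn'.1 a ha]

/-- An index function is determined by its restriction to the previous tree and the triple at the
last three children. Only injectivity of this correspondence is needed, as all terms are
nonnegative. -/
theorem tsum_indexFn_succ_le (m : Freq) (H : (Node → Freq) → ℝ≥0∞)
    (H' : (Node → Freq) → Freq × Freq × Freq → ℝ≥0∞)
    (h : ∀ n ∈ T.indexFn m, H n ≤ H' (T.res n) (T.lastTrip n)) :
    ∑' n : T.indexFn m, H n ≤
      ∑' n : T.init.indexFn m, ∑' y : Trip (n.1 T.lastNode), H' n y := by
  rw [← ENNReal.tsum_sigma (fun (n : T.init.indexFn m) (y : Trip (n.1 T.lastNode)) => H' n y)]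
  let f : T.indexFn m → Σ n : T.init.indexFn m, Trip (n.1 T.lastNode) := fun n =>
    ⟨⟨T.res n, T.res_mem n.2⟩, ⟨T.lastTrip n, T.lastTrip_mem n.2⟩⟩
  have hf : Function.Injective f := by
    intro n n' hnn
    have h1 : T.res n = T.res n' := congrArg (fun z => z.1.1) hnn
    have h2 : T.lastTrip n = T.lastTrip n' := congrArg (fun z => z.2.1) hnn
    exact Subtype.ext (T.eq_of_res_eq n.2 n'.2 h1 h2)
  exact (ENNReal.tsum_le_tsum fun n : T.indexFn m => h n.1 n.2).trans
    (ENNReal.tsum_comp_le_tsum_of_injective hf fun z => H' z.1 z.2)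

theorem modulation_res {n : Node → Freq} (k : Fin J) :
    modulation (T.res n) (T.init.node k) = modulation n (T.node k.castSucc) := by
  have hk : T.init.node k ∈ T.init.nonterminal := mem_nonterminal.mpr ⟨k, rfl⟩
  rw [modulation, modulation, T.res_apply (nonterminal_subset_nodes _ hk),
    T.res_apply (cons_mem_nodes.mpr hk), T.res_apply (cons_mem_nodes.mpr hk),
    T.res_apply (cons_mem_nodes.mpr hk)]
  rfl

theorem modSum_eq_sum_ite {J : ℕ} (T : OrderedTree J) (n : Node → Freq) (k : Fin J) :
    T.modSum n k = ∑ l, if l ≤ k then (T.node l).sign * modulation n (T.node l) else 0 := by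
  rw [modSum, ← Finset.sum_filter]; congr 1; ext; simp

theorem modSum_castSucc (n : Node → Freq) (k : Fin J) :
    T.modSum n k.castSucc = T.init.modSum (T.res n) k := by
  rw [modSum_eq_sum_ite, modSum_eq_sum_ite, Fin.sum_univ_castSucc,
    if_neg (Fin.castSucc_lt_last k).not_ge, add_zero]
  refine Finset.sum_congr rfl fun l _ => ?_
  rw [modulation_res]; rfl

theorem modSum_last (n : Node → Freq) : T.modSum n (Fin.last J) =
    ∑ l, (T.node l).sign * modulation n (T.node l) := by
  rw [modSum_eq_sum_ite]
  exact Finset.sum_congr rfl fun l _ => if_pos (Fin.le_last l)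

/-- The first sum depends only on the restriction. It is a constant shift while the last triple
varies, which is why the estimates for triples are uniform in `τ₀`. -/
theorem modSum_last_eq {n : Node → Freq} : T.modSum n (Fin.last J) =
    ∑ l, (T.init.node l).sign * modulation (T.res n) (T.init.node l) +
      T.lastNode.sign * tripMod (T.res n T.lastNode) (T.lastTrip n) := by
  rw [modSum_last, Fin.sum_univ_castSucc]
  refine congrArg₂ (· + ·) ?_ ?_
  · refine Finset.sum_congr rfl fun l _ => ?_
    rw [modulation_res]; rfl
  · rw [T.res_apply T.lastNode_mem_nodes]; rfl

end Succ

/-- A tree is determined by its predecessor together with the parent and the position of the last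
non-terminal node, at most 3(J + 1) choices. -/
theorem card_le (J : ℕ) : Fintype.card (OrderedTree J) ≤ 3 ^ J * J.factorial := by
  induction J with
  | zero =>
    rw [pow_zero, Nat.factorial_zero, one_mul, Fintype.card_le_one_iff]
    exact fun T T' => ext_node (funext fun k => k.elim0)
  | succ J ih =>
    have h : ∀ T : OrderedTree (J + 1), ∃ z : Fin (J + 1) × Fin 3,
        (J = 0 ∧ T.lastNode = []) ∨ (J ≠ 0 ∧ T.lastNode = z.2 :: T.node z.1 ∧ (z.1 : ℕ) < J) := by
      intro T
      by_cases h0 : J = 0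
      · exact ⟨(0, 0), Or.inl ⟨h0, T.root_first _ (by simpa using h0)⟩⟩
      · obtain ⟨i, hi, c, hc⟩ := T.grows (Fin.last J) (by simpa using h0)
        exact ⟨(i, c), Or.inr ⟨h0, hc, hi⟩⟩
    choose z hz using h
    have hinj : Function.Injective fun T : OrderedTree (J + 1) => (T.init, z T) := by
      intro T T' hTT
      simp only [Prod.mk.injEq] at hTT
      have h1 : ∀ k : Fin J, T.node k.castSucc = T'.node k.castSucc := fun k =>
        congrFun (congrArg node hTT.1) k
      have h2 : T.lastNode = T'.lastNode := by
        rcases hz T with ⟨h0, h⟩ | ⟨h0, h, hlt⟩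
        · rcases hz T' with ⟨_, h'⟩ | ⟨h0', _⟩
          · rw [h, h']
          · exact absurd h0 h0'
        · rcases hz T' with ⟨h0', _⟩ | ⟨_, h', _⟩
          · exact absurd h0' h0
          · rw [h, h', ← hTT.2]
            congr 1
            exact h1 ⟨(z T).1, hlt⟩
      apply ext_node
      funext k
      refine Fin.lastCases ?_ (fun k => ?_) k
      · exact h2
      · exact h1 k
    have := Fintype.card_le_of_injective _ hinj
    rw [Fintype.card_prod, Fintype.card_prod, Fintype.card_fin, Fintype.card_fin] at this
    calc _ ≤ _ := this
      _ ≤ (3 ^ J * J.factorial) * ((J + 1) * 3) := by gcongr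
      _ = _ := by rw [Nat.factorial_succ]; ring

/-- Sums over the index functions of a tree of one factor per generation and weights at all but
one of the terminal nodes. -/
theorem tsum_weight_le {a : ℝ} {C : ℝ≥0}
    (hC : ∀ (n : Freq) (τ₀ ε : ℤ), (ε = 1 ∨ ε = -1) → ∀ φ : ℤ → ℝ≥0∞,
      (∑' y : Trip n, φ (τ₀ + ε * tripMod n y) * (wJ a y.1.2.1 * wJ a y.1.2.2) ≤ C * ∑' τ, φ τ) ∧
      (∑' y : Trip n, φ (τ₀ + ε * tripMod n y) * (wJ a y.1.1 * wJ a y.1.2.2) ≤ C * ∑' τ, φ τ) ∧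
      (∑' y : Trip n, φ (τ₀ + ε * tripMod n y) * (wJ a y.1.1 * wJ a y.1.2.1) ≤ C * ∑' τ, φ τ) ∧
      (∑' y : Trip n, φ (τ₀ + ε * tripMod n y) * (wJ a y.1.1 * wJ a y.1.2.1 * wJ a y.1.2.2)
        ≤ C * (∑' τ, φ τ) * wJ a n))
    (φ : ℕ → ℤ → ℝ≥0∞) (m : Freq) : ∀ {J : ℕ} (T : OrderedTree J) (b : Node), b ∈ T.terminal →
      ∑' n : T.indexFn m, (∏ k : Fin J, φ k (T.modSum n k)) *
        ∏ x ∈ T.terminal, (if x = b then 1 else wJ a (n.1 x)) ≤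
      ∏ k ∈ Finset.range J, (C * ∑' τ, φ k τ) := by
  intro J
  induction J with
  | zero =>
    intro T b hb
    have hnt : T.nonterminal = ∅ := by
      rw [nonterminal, Finset.univ_eq_empty, Finset.image_empty]
    have hnodes : T.nodes = {[]} := by rw [nodes, hnt]; rfl
    have hterm : T.terminal = {[]} := by rw [terminal, hnt, hnodes]; rfl
    have hb' : b = [] := by rwa [hterm, Finset.mem_singleton] at hb
    have hsub : Subsingleton (T.indexFn m) := by
      refine ⟨fun n n' => Subtype.ext (funext fun x => ?_)⟩
      by_cases hx : x = []
      · rw [hx, n.2.2.1, n'.2.2.1]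
      · have : x ∉ T.nodes := by rw [hnodes, Finset.mem_singleton]; exact hx
        rw [n.2.1 x this, n'.2.1 x this]
    have h1 : ∀ n : T.indexFn m, (∏ k : Fin 0, φ k (T.modSum n k)) *
        ∏ x ∈ T.terminal, (if x = b then 1 else wJ a (n.1 x)) = 1 := fun n => by
      rw [hterm, hb']; simp
    rw [tsum_congr h1]
    simp only [Finset.range_zero, Finset.prod_empty, ENNReal.tsum_one]
    have : ENat.card (T.indexFn m) ≤ 1 := ENat.card_le_one_iff_subsingleton _ |>.mpr hsub
    exact_mod_cast this
  | succ J ih =>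
    intro T b hb
    set A := T.lastNode with hA
    have hε : A.sign = 1 ∨ A.sign = -1 := neg_one_pow_eq_or ℤ _
    set τ₀ : (Node → Freq) → ℤ := fun n => ∑ l, (T.init.node l).sign *
      modulation n (T.init.node l) with hτ₀
    -- One generation is peeled off. `V` collects the weights of the last three children, `U` those
    -- of the other leaves, and `b'` is the leaf of the smaller tree that is exempt from a weight.
    have step : ∀ (V : Freq × Freq × Freq → ℝ≥0∞) (b' : Node) (U : (Node → Freq) → ℝ≥0∞),
        b' ∈ T.init.terminal →
        (∀ n, ∏ x ∈ T.terminal, (if x = b then 1 else wJ a (n x)) = U (T.res n) * V (T.lastTrip n)) →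
        (∀ n : Node → Freq, U n * ∑' y : Trip (n A), φ J (τ₀ n + A.sign * tripMod (n A) y) * V y ≤
          (C * ∑' τ, φ J τ) * ∏ x ∈ T.init.terminal, (if x = b' then 1 else wJ a (n x))) →
        ∑' n : T.indexFn m, (∏ k : Fin (J + 1), φ k (T.modSum n k)) *
          ∏ x ∈ T.terminal, (if x = b then 1 else wJ a (n.1 x)) ≤
        ∏ k ∈ Finset.range (J + 1), (C * ∑' τ, φ k τ) := by
      intro V b' U hb' hUV hU
      have h1 := T.tsum_indexFn_succ_le m
        (fun n => (∏ k : Fin (J + 1), φ k (T.modSum n k)) *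
          ∏ x ∈ T.terminal, (if x = b then 1 else wJ a (n x)))
        (fun n y => (∏ k : Fin J, φ k (T.init.modSum n k)) *
          (U n * (φ J (τ₀ n + A.sign * tripMod (n A) y) * V y))) (by
          intro n _
          rw [Fin.prod_univ_castSucc, hUV, modSum_last_eq]
          simp only [modSum_castSucc, Fin.val_castSucc, Fin.val_last]
          apply le_of_eq
          ring)
      refine h1.trans ?_
      simp only [ENNReal.tsum_mul_left]
      calc _ ≤ ∑' n : T.init.indexFn m, (C * ∑' τ, φ J τ) *
            ((∏ k : Fin J, φ k (T.init.modSum n k)) *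
              ∏ x ∈ T.init.terminal, (if x = b' then 1 else wJ a (n.1 x))) := by
            apply ENNReal.tsum_le_tsum
            intro n
            calc _ ≤ (∏ k : Fin J, φ k (T.init.modSum n k)) * ((C * ∑' τ, φ J τ) *
                  ∏ x ∈ T.init.terminal, (if x = b' then 1 else wJ a (n.1 x))) := by
                  exact mul_le_mul_right (hU n) _
              _ = _ := by ring
        _ ≤ _ := by
            rw [ENNReal.tsum_mul_left, Finset.prod_range_succ, mul_comm]
            gcongr
            exact ih T.init b' hb'
    have hres : ∀ (n : Node → Freq), ∀ x ∈ T.init.terminal, T.res n x = n x := fun n x hx =>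
      T.res_apply (Finset.mem_sdiff.mp hx).1
    -- If the exempt leaf is one of the last three children, the two other weights pay for the sum
    -- and the exemption passes to the parent `A`. Otherwise all three carry weights, and the sum
    -- returns a weight at `A`, so the exempt leaf stays `b`.
    by_cases hbc : ∃ c : Fin 3, b = c :: A
    · obtain ⟨c, rfl⟩ := hbc
      have hU1 : ∀ n : Node → Freq, ∏ x ∈ T.init.terminal, (if x = A then 1 else wJ a (n x)) =
          ∏ x ∈ T.init.terminal.erase A, wJ a (n x) := by
        intro n
        rw [← Finset.mul_prod_erase _ _ T.lastNode_mem_terminal, if_pos rfl, one_mul]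
        exact Finset.prod_congr rfl fun x hx => if_neg (Finset.ne_of_mem_erase hx)
      have hU2 : ∀ n : Node → Freq, ∏ x ∈ T.init.terminal.erase A,
          (if x = c :: A then 1 else wJ a (n x)) =
          ∏ x ∈ T.init.terminal.erase A, wJ a (T.res n x) := by
        intro n
        refine Finset.prod_congr rfl fun x hx => ?_
        have hx' := Finset.mem_of_mem_erase hx
        rw [if_neg, hres n x hx']
        rintro rfl
        exact T.cons_lastNode_notMem c (Finset.mem_sdiff.mp hx').1
      refine step (fun y => if c = 0 then wJ a y.2.1 * wJ a y.2.2 else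
        if c = 1 then wJ a y.1 * wJ a y.2.2 else wJ a y.1 * wJ a y.2.1) A
        (fun n => ∏ x ∈ T.init.terminal.erase A, wJ a (n x)) T.lastNode_mem_terminal ?_ ?_
      · intro n
        rw [prod_terminal_succ, hU2]
        congr 1
        fin_cases c <;> simp [lastTrip, hA]
      · intro n
        rw [hU1, mul_comm]
        gcongr
        obtain ⟨k1, k2, k3, _⟩ := hC (n A) (τ₀ n) A.sign hε (φ J)
        fin_cases c
        · exact k1
        · exact k2
        · exact k3
    · push Not at hbc
      have hbA : b ∈ T.init.terminal := by
        rw [terminal, Finset.mem_sdiff, mem_nodes_succ, mem_nonterminal_succ] at hb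
        rw [terminal, Finset.mem_sdiff]
        push Not at hb
        refine ⟨?_, hb.2.1⟩
        rcases hb.1 with h | ⟨c, h⟩
        · exact h
        · exact absurd h (hbc c)
      have hne : b ≠ A := by
        rintro rfl
        exact (Finset.mem_sdiff.mp hb).2 (T.mem_nonterminal_succ.mpr (Or.inr rfl))
      refine step (fun y => wJ a y.1 * wJ a y.2.1 * wJ a y.2.2) b
        (fun n => ∏ x ∈ T.init.terminal.erase A, (if x = b then 1 else wJ a (n x))) hbA ?_ ?_
      · intro n
        rw [prod_terminal_succ, if_neg (hbc 0).symm, if_neg (hbc 1).symm, if_neg (hbc 2).symm]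
        congr 1
        refine Finset.prod_congr rfl fun x hx => ?_
        rw [hres n x (Finset.mem_of_mem_erase hx)]
      · intro n
        obtain ⟨_, _, _, k4⟩ := hC (n A) (τ₀ n) A.sign hε (φ J)
        rw [← Finset.mul_prod_erase _ _ T.lastNode_mem_terminal, if_neg hne.symm]
        calc _ ≤ (∏ x ∈ T.init.terminal.erase A, (if x = b then 1 else wJ a (n x))) *
              (C * (∑' τ, φ J τ) * wJ a (n A)) := by gcongr
          _ = _ := by ring

/-- The frequencies at the leaves determine those at all other nodes, the root included. Summing
over the root and the index functions is therefore at most summing over the leaves independently. -/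
theorem tsum_prod_le : ∀ {J : ℕ} (T : OrderedTree J) (G : Node → Freq → ℝ≥0∞),
    ∑' m, ∑' n : T.indexFn m, ∏ x ∈ T.terminal, G x (n.1 x) ≤
      ∏ x ∈ T.terminal, ∑' k, G x k := by
  intro J
  induction J with
  | zero =>
    intro T G
    have hnt : T.nonterminal = ∅ := by
      rw [nonterminal, Finset.univ_eq_empty, Finset.image_empty]
    have hnodes : T.nodes = {[]} := by rw [nodes, hnt]; rfl
    have hterm : T.terminal = {[]} := by rw [terminal, hnt, hnodes]; rfl
    rw [hterm, Finset.prod_singleton]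
    apply ENNReal.tsum_le_tsum
    intro m
    have hsub : Subsingleton (T.indexFn m) := by
      refine ⟨fun n n' => Subtype.ext (funext fun x => ?_)⟩
      by_cases hx : x = []
      · rw [hx, n.2.2.1, n'.2.2.1]
      · have : x ∉ T.nodes := by rw [hnodes, Finset.mem_singleton]; exact hx
        rw [n.2.1 x this, n'.2.1 x this]
    have h1 : ∀ n : T.indexFn m, ∏ x ∈ ({[]} : Finset Node), G x (n.1 x) = G [] m := fun n => by
      rw [Finset.prod_singleton, n.2.2.1]
    rw [tsum_congr h1, ENNReal.tsum_const]
    have : ENat.card (T.indexFn m) ≤ 1 := ENat.card_le_one_iff_subsingleton _ |>.mpr hsub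
    have h2 : ((ENat.card (T.indexFn m) : ℕ∞) : ℝ≥0∞) ≤ 1 := by exact_mod_cast this
    exact mul_le_of_le_one_left' h2
  | succ J ih =>
    intro T G
    set A := T.lastNode with hA
    set GA : Freq → ℝ≥0∞ := fun k => ∑' y : Trip k,
      G (0 :: A) y.1.1 * G (1 :: A) y.1.2.1 * G (2 :: A) y.1.2.2 with hGA
    set G' : Node → Freq → ℝ≥0∞ := fun x k => if x = A then GA k else G x k with hG'
    have hsplit : ∀ (F : Node → ℝ≥0∞), ∏ x ∈ T.init.terminal, F x =
        (∏ x ∈ T.init.terminal.erase A, F x) * F A := fun F =>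
      (Finset.prod_erase_mul _ _ T.lastNode_mem_terminal).symm
    have h1 : ∀ m, ∑' n : T.indexFn m, ∏ x ∈ T.terminal, G x (n.1 x) ≤
        ∑' n : T.init.indexFn m, ∏ x ∈ T.init.terminal, G' x (n.1 x) := by
      intro m
      refine (T.tsum_indexFn_succ_le m (fun n => ∏ x ∈ T.terminal, G x (n x))
        (fun n y => (∏ x ∈ T.init.terminal.erase A, G x (n x)) *
          (G (0 :: A) y.1 * G (1 :: A) y.2.1 * G (2 :: A) y.2.2)) ?_).trans ?_
      · intro n _
        rw [prod_terminal_succ]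
        apply le_of_eq
        congr 1
        refine Finset.prod_congr rfl fun x hx => ?_
        rw [T.res_apply (Finset.mem_sdiff.mp (Finset.mem_of_mem_erase hx)).1]
      · apply ENNReal.tsum_le_tsum
        intro n
        rw [ENNReal.tsum_mul_left, hsplit]
        apply le_of_eq
        congr 1
        · exact Finset.prod_congr rfl fun x hx => by
            simp only [hG', if_neg (Finset.ne_of_mem_erase hx)]
        · simp only [hG', if_true]; rfl
    have h2 : ∑' k, GA k ≤ (∑' k, G (0 :: A) k) * (∑' k, G (1 :: A) k) * ∑' k, G (2 :: A) k := by
      have e : (∑' k, G (0 :: A) k) * (∑' k, G (1 :: A) k) * ∑' k, G (2 :: A) k =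
          ∑' y : Freq × Freq × Freq, G (0 :: A) y.1 * G (1 :: A) y.2.1 * G (2 :: A) y.2.2 := by
        rw [ENNReal.tsum_prod' (β := Freq × Freq), mul_assoc, ← ENNReal.tsum_mul_right]
        refine tsum_congr fun x => ?_
        rw [ENNReal.tsum_prod' (α := Freq), ← ENNReal.tsum_mul_right, ← ENNReal.tsum_mul_left]
        refine tsum_congr fun y => ?_
        rw [← mul_assoc, ← ENNReal.tsum_mul_left]
      rw [e, ← ENNReal.tsum_sigma (fun (k : Freq) (y : Trip k) =>
        G (0 :: A) y.1.1 * G (1 :: A) y.1.2.1 * G (2 :: A) y.1.2.2)]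
      refine ENNReal.tsum_comp_le_tsum_of_injective (f := fun z : Σ k : Freq, Trip k => z.2.1) ?_
        (fun y : Freq × Freq × Freq => G (0 :: A) y.1 * G (1 :: A) y.2.1 * G (2 :: A) y.2.2)
      rintro ⟨k, y, hy⟩ ⟨k', y', hy'⟩ h
      simp only at h
      subst h
      obtain rfl : k = k' := hy.1.trans hy'.1.symm
      rfl
    calc _ ≤ ∑' m, ∑' n : T.init.indexFn m, ∏ x ∈ T.init.terminal, G' x (n.1 x) :=
          ENNReal.tsum_le_tsum h1
      _ ≤ ∏ x ∈ T.init.terminal, ∑' k, G' x k := ih T.init G'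
      _ = (∏ x ∈ T.init.terminal.erase A, ∑' k, G x k) * ∑' k, GA k := by
          rw [hsplit]
          congr 1
          · exact Finset.prod_congr rfl fun x hx => by
              simp only [hG', if_neg (Finset.ne_of_mem_erase hx)]
          · simp only [hG', if_true]
      _ ≤ _ := by rw [prod_terminal_succ]; gcongr

end OrderedTree


/-! ### The multilinear estimate -/

namespace OrderedTree

theorem sign_cons (c : Fin 3) (a : Node) :
    Node.sign (c :: a) = if c = 1 then -Node.sign a else Node.sign a := by
  rw [Node.sign, Node.sign, List.count_cons]
  split_ifs with h1 h2 h2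
  · rw [pow_succ]; ring
  · simp_all
  · simp_all
  · simp

/-- Conservation of frequency: by the relation at each non-terminal node, its signed frequency is
the sum of those of its children, so the interior nodes cancel. -/
theorem sum_terminal_sign_smul {J : ℕ} (T : OrderedTree J) {n : Node → Freq} {m : Freq}
    (hn : n ∈ T.indexFn m) : ∑ x ∈ T.terminal, x.sign • n x = m := by
  have h := T.sum_terminal_add (fun x => x.sign • n x)
  have h2 : ∑ k, ∑ c : Fin 3, Node.sign (c :: T.node k) • n (c :: T.node k) =
      ∑ k, (T.node k).sign • n (T.node k) := by
    refine Finset.sum_congr rfl fun k _ => ?_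
    have hk := (hn.2.2 (T.node k) (mem_nonterminal.mpr ⟨k, rfl⟩)).1
    rw [Fin.sum_univ_three, hk]
    simp only [sign_cons]
    simp [smul_add, sub_eq_add_neg]
  rw [h2] at h
  have h3 := add_right_cancel h
  rw [h3, hn.2.1]
  simp [Node.sign]

/-- The signs make the modulations telescope, so that the total depends only on the root and the
leaves. This is what matches the phase to the propagators. -/
theorem sum_sign_mul_modulation {J : ℕ} (T : OrderedTree J) (n : Node → Freq) :
    ∑ k, (T.node k).sign * modulation n (T.node k) =
      hsq (n []) - ∑ x ∈ T.terminal, x.sign * hsq (n x) := by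
  have h := T.sum_terminal_add (fun x => x.sign * hsq (n x))
  have h2 : ∑ k, (T.node k).sign * modulation n (T.node k) =
      ∑ k, (T.node k).sign * hsq (n (T.node k)) -
        ∑ k, ∑ c : Fin 3, Node.sign (c :: T.node k) * hsq (n (c :: T.node k)) := by
    rw [← Finset.sum_sub_distrib]
    refine Finset.sum_congr rfl fun k _ => ?_
    rw [Fin.sum_univ_three]
    simp only [sign_cons, modulation]
    simp
    ring
  have h3 : Node.sign [] * hsq (n []) = hsq (n []) := by simp [Node.sign]
  rw [h2]
  linarith

theorem jap_root_le {J : ℕ} (T : OrderedTree J) {n : Node → Freq} {m : Freq}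
    (hn : n ∈ T.indexFn m) : jap m ≤ ∑ x ∈ T.terminal, jap (n x) := by
  have hne : T.terminal.Nonempty := by rw [← Finset.card_pos, card_terminal]; omega
  have h : jap (∑ x ∈ T.terminal, x.sign • n x) ≤ ∑ x ∈ T.terminal, jap (x.sign • n x) :=
    Finset.le_sum_nonempty_of_subadditive jap jap_add_le hne _
  rw [sum_terminal_sign_smul T hn] at h
  refine h.trans (le_of_eq (Finset.sum_congr rfl fun x _ => ?_))
  rcases neg_one_pow_eq_or ℤ (List.count 1 x) with h1 | h1 <;> simp [Node.sign, h1, jap_neg]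

/-- The largest of the 2J + 1 leaves carries the weight of the root, up to the factor (2J + 1)^s. -/
theorem jap_root_rpow_le {J : ℕ} (T : OrderedTree J) {n : Node → Freq} {m : Freq}
    (hn : n ∈ T.indexFn m) {s : ℝ} (hs : 0 ≤ s) :
    jap m ^ s ≤ (2 * J + 1 : ℝ) ^ s * ∑ x ∈ T.terminal, jap (n x) ^ s := by
  have hne : T.terminal.Nonempty := by rw [← Finset.card_pos, card_terminal]; omega
  obtain ⟨b, hb, hmax⟩ := Finset.exists_max_image T.terminal (fun x => jap (n x)) hne
  have h1 : jap m ≤ (2 * J + 1 : ℝ) * jap (n b) := by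
    refine (jap_root_le T hn).trans ((Finset.sum_le_card_nsmul _ _ _ hmax).trans ?_)
    rw [card_terminal, nsmul_eq_mul]; push_cast; rfl
  calc jap m ^ s ≤ ((2 * J + 1 : ℝ) * jap (n b)) ^ s :=
        Real.rpow_le_rpow (jap_pos m).le h1 hs
    _ = (2 * J + 1 : ℝ) ^ s * jap (n b) ^ s := Real.mul_rpow (by positivity) (jap_pos _).le
    _ ≤ _ := by
        gcongr
        exact Finset.single_le_sum (f := fun x => jap (n x) ^ s)
          (fun x _ => Real.rpow_nonneg (jap_pos _).le _) hb

end OrderedTree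

theorem tsum_mul_le_Lp_mul_Lq {ι : Type*} {p q : ℝ} (hpq : p.HolderConjugate q)
    (f g : ι → ℝ≥0∞) :
    ∑' i, f i * g i ≤ (∑' i, f i ^ p) ^ (1 / p) * (∑' i, g i ^ q) ^ (1 / q) := by
  let _ : MeasurableSpace ι := ⊤
  have h := ENNReal.lintegral_mul_le_Lp_mul_Lq (MeasureTheory.Measure.count (α := ι)) hpq
    (f := f) (g := g) measurable_from_top.aemeasurable measurable_from_top.aemeasurable
  simpa [MeasureTheory.lintegral_count] using h

/-- The multilinear estimate in weighted `ℓ^p` for one ordered tree. -/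
theorem exists_tree_bound {s p : ℝ} (hp : 1 < p) (hs : 1 - 1 / p < s) :
    ∃ C : ℝ≥0∞, C ≠ ⊤ ∧ ∀ {J : ℕ} (T : OrderedTree J) (ψ : ℕ → ℤ → ℝ≥0∞)
      (F : Node → Freq → ℝ≥0∞),
      ∑' m, (ENNReal.ofReal (jap m ^ s) * ∑' n : T.indexFn m,
        (∏ k : Fin J, ψ k (T.modSum n k)) * ∏ x ∈ T.terminal, F x (n.1 x)) ^ p ≤
      (C ^ J * ∏ k ∈ Finset.range J, (∑' τ, ψ k τ ^ p.conjExponent) ^ (1 / p.conjExponent)) ^ p *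
        ∏ x ∈ T.terminal, ∑' k, (ENNReal.ofReal (jap k ^ s) * F x k) ^ p := by
  have hpq : p.HolderConjugate p.conjExponent := Real.HolderConjugate.conjExponent hp
  set q := p.conjExponent with hq
  have hp0 : 0 < p := by linarith
  have hq0 : 0 < q := hpq.symm.pos
  have hinv : 1 / q = 1 - 1 / p := by
    have := hpq.inv_add_inv_eq_one; rw [one_div, one_div]; linarith
  have hs0 : 0 < s := lt_trans (by rw [← hinv]; positivity) hs
  -- The only place where the size of s enters beyond positivity: the q-th power of ⟨n⟩^{-s} is the
  -- weight `wJ (s * q)`, and the sums over triples need an exponent above 1.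
  have ha : 1 < s * q := by
    rw [← hinv] at hs
    calc 1 = 1 / q * q := by field_simp
      _ < s * q := by gcongr
  obtain ⟨C₀, hC₀⟩ := exists_tripleSum_le ha
  set w : Freq → ℝ≥0∞ := fun k => ENNReal.ofReal (jap k ^ s) with hw
  set w' : Freq → ℝ≥0∞ := fun k => ENNReal.ofReal (jap k ^ (-s)) with hw'
  have hww : ∀ k, w' k * w k = 1 := fun k => by
    rw [hw, hw', ← ENNReal.ofReal_mul (Real.rpow_nonneg (jap_pos k).le _),
      ← Real.rpow_add (jap_pos k)]; simp
  have hwq : ∀ k, w' k ^ q = wJ (s * q) k := fun k => by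
    rw [hw', wJ, ENNReal.ofReal_rpow_of_nonneg (Real.rpow_nonneg (jap_pos k).le _) hq0.le,
      ← Real.rpow_mul (jap_pos k).le]; congr 2; ring
  refine ⟨ENNReal.ofReal (3 ^ (s + 1)) * (C₀ : ℝ≥0∞) ^ (1 / q), ENNReal.mul_ne_top
    ENNReal.ofReal_ne_top (ENNReal.rpow_ne_top_of_nonneg (by positivity) ENNReal.coe_ne_top),
    fun {J} T ψ F => ?_⟩
  set Fh : Node → Freq → ℝ≥0∞ := fun x k => w k * F x k with hFh
  set B : ℝ≥0∞ := ∏ k ∈ Finset.range J, (∑' τ, ψ k τ ^ q) ^ (1 / q) with hB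
  set Q : ℝ≥0∞ := (∏ k ∈ Finset.range J, (C₀ * ∑' τ, ψ k τ ^ q)) ^ (1 / q) with hQ
  have hQB : Q = ((C₀ : ℝ≥0∞) ^ (1 / q)) ^ J * B := by
    rw [hQ, Finset.prod_mul_distrib, Finset.prod_const, Finset.card_range,
      ENNReal.mul_rpow_of_nonneg _ _ (by positivity), hB,
      ENNReal.prod_rpow_of_nonneg (by positivity)]
    congr 1
    rw [← ENNReal.rpow_natCast, ← ENNReal.rpow_natCast, ← ENNReal.rpow_mul, ← ENNReal.rpow_mul,
      mul_comm]
  set E : Freq → ℝ≥0∞ := fun m => ∑' n : T.indexFn m, ∏ x ∈ T.terminal, Fh x (n.1 x) ^ p with hE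
  -- The loss (2J + 1)^s from the root weight and the factor 2J + 1 from the choice of the leaf that
  -- carries it are absorbed into a J-th power, as 2J + 1 ≤ 3^J.
  have hJ : ENNReal.ofReal ((2 * J + 1 : ℝ) ^ s) * (2 * J + 1 : ℕ) ≤
      ENNReal.ofReal (3 ^ (s + 1)) ^ J := by
    rw [← ENNReal.ofReal_natCast, ← ENNReal.ofReal_mul (by positivity),
      ← ENNReal.ofReal_pow (by positivity)]
    apply ENNReal.ofReal_le_ofReal
    have h3 : (2 * J + 1 : ℝ) ≤ 3 ^ J := by
      have := one_add_mul_le_pow (a := (2 : ℝ)) (by norm_num) J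
      norm_num at this; linarith
    push_cast
    calc (2 * J + 1 : ℝ) ^ s * (2 * J + 1) = (2 * J + 1 : ℝ) ^ (s + 1) := by
          rw [Real.rpow_add_one (by positivity)]
      _ ≤ (3 ^ J) ^ (s + 1) := Real.rpow_le_rpow (by positivity) h3 (by linarith)
      _ = _ := by
          rw [← Real.rpow_natCast, ← Real.rpow_natCast, ← Real.rpow_mul (by norm_num),
            ← Real.rpow_mul (by norm_num), mul_comm]
  -- Once the root weight sits at a leaf b, every leaf is written as `Fh`, with a compensating w' at
  -- all leaves but b. Hölder over the index functions puts the `Fh` in ℓ^p and the generation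
  -- factors with the w' in ℓ^q, which is the situation of `tsum_weight_le`.
  have hm : ∀ m, w m * ∑' n : T.indexFn m, (∏ k : Fin J, ψ k (T.modSum n k)) *
      ∏ x ∈ T.terminal, F x (n.1 x) ≤
        (ENNReal.ofReal (3 ^ (s + 1)) ^ J * Q) * E m ^ (1 / p) := by
    intro m
    have h1 : ∀ n : T.indexFn m, w m * ((∏ k : Fin J, ψ k (T.modSum n k)) *
        ∏ x ∈ T.terminal, F x (n.1 x)) ≤ ENNReal.ofReal ((2 * J + 1 : ℝ) ^ s) *
          ∑ b ∈ T.terminal, ((∏ x ∈ T.terminal, Fh x (n.1 x)) *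
            ((∏ k : Fin J, ψ k (T.modSum n k)) *
              ∏ x ∈ T.terminal, (if x = b then 1 else w' (n.1 x)))) := by
      intro n
      have h2 : w m ≤ ENNReal.ofReal ((2 * J + 1 : ℝ) ^ s) * ∑ b ∈ T.terminal, w (n.1 b) := by
        simp only [hw]
        rw [← ENNReal.ofReal_sum_of_nonneg (fun x _ => Real.rpow_nonneg (jap_pos _).le _),
          ← ENNReal.ofReal_mul (by positivity)]
        exact ENNReal.ofReal_le_ofReal (T.jap_root_rpow_le n.2 hs0.le)
      have h3 : ∀ b ∈ T.terminal, w (n.1 b) * ∏ x ∈ T.terminal, F x (n.1 x) =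
          (∏ x ∈ T.terminal, Fh x (n.1 x)) *
            ∏ x ∈ T.terminal, (if x = b then 1 else w' (n.1 x)) := by
        intro b hb
        rw [← Finset.prod_mul_distrib, ← Finset.mul_prod_erase _ _ hb,
          ← Finset.mul_prod_erase _ (fun x => Fh x (n.1 x) * _) hb, if_pos rfl, mul_one, ← mul_assoc]
        congr 1
        refine Finset.prod_congr rfl fun x hx => ?_
        rw [if_neg (Finset.ne_of_mem_erase hx)]
        calc F x (n.1 x) = (w' (n.1 x) * w (n.1 x)) * F x (n.1 x) := by rw [hww, one_mul]
          _ = _ := by simp only [hFh]; ring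
      calc _ ≤ (ENNReal.ofReal ((2 * J + 1 : ℝ) ^ s) * ∑ b ∈ T.terminal, w (n.1 b)) *
            ((∏ k : Fin J, ψ k (T.modSum n k)) * ∏ x ∈ T.terminal, F x (n.1 x)) := by gcongr
        _ = _ := by
          rw [mul_assoc, Finset.sum_mul]
          congr 1
          refine Finset.sum_congr rfl fun b hb => ?_
          calc _ = (∏ k : Fin J, ψ k (T.modSum n k)) *
                (w (n.1 b) * ∏ x ∈ T.terminal, F x (n.1 x)) := by ring
            _ = _ := by rw [h3 b hb]; ring
    have h4 : ∀ b ∈ T.terminal, ∑' n : T.indexFn m, ((∏ x ∈ T.terminal, Fh x (n.1 x)) *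
        ((∏ k : Fin J, ψ k (T.modSum n k)) *
          ∏ x ∈ T.terminal, (if x = b then 1 else w' (n.1 x)))) ≤ E m ^ (1 / p) * Q := by
      intro b hb
      refine (tsum_mul_le_Lp_mul_Lq hpq _ _).trans ?_
      gcongr
      · simp only [hE]
        apply ENNReal.tsum_le_tsum
        intro n
        rw [ENNReal.prod_rpow_of_nonneg hp0.le]
      · rw [hQ]
        refine ENNReal.rpow_le_rpow ?_ (by positivity)
        refine le_trans (ENNReal.tsum_le_tsum fun n => ?_)
          (OrderedTree.tsum_weight_le hC₀ (fun k τ => ψ k τ ^ q) m T b hb)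
        rw [ENNReal.mul_rpow_of_nonneg _ _ hq0.le, ENNReal.prod_rpow_of_nonneg hq0.le,
          ← ENNReal.prod_rpow_of_nonneg (s := T.terminal) hq0.le]
        apply le_of_eq
        congr 1
        refine Finset.prod_congr rfl fun x _ => ?_
        split_ifs
        · simp
        · exact hwq _
    rw [← ENNReal.tsum_mul_left]
    calc _ ≤ ∑' n : T.indexFn m, ENNReal.ofReal ((2 * J + 1 : ℝ) ^ s) *
          ∑ b ∈ T.terminal, ((∏ x ∈ T.terminal, Fh x (n.1 x)) *
            ((∏ k : Fin J, ψ k (T.modSum n k)) *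
              ∏ x ∈ T.terminal, (if x = b then 1 else w' (n.1 x)))) := ENNReal.tsum_le_tsum h1
      _ = ENNReal.ofReal ((2 * J + 1 : ℝ) ^ s) * ∑ b ∈ T.terminal, ∑' n : T.indexFn m,
          ((∏ x ∈ T.terminal, Fh x (n.1 x)) * ((∏ k : Fin J, ψ k (T.modSum n k)) *
              ∏ x ∈ T.terminal, (if x = b then 1 else w' (n.1 x)))) := by
          rw [ENNReal.tsum_mul_left, Summable.tsum_finsetSum fun _ _ => ENNReal.summable]
      _ ≤ ENNReal.ofReal ((2 * J + 1 : ℝ) ^ s) * ∑ b ∈ T.terminal, E m ^ (1 / p) * Q := by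
          gcongr with b hb; exact h4 b hb
      _ = (ENNReal.ofReal ((2 * J + 1 : ℝ) ^ s) * (2 * J + 1 : ℕ)) * (E m ^ (1 / p) * Q) := by
          rw [Finset.sum_const, OrderedTree.card_terminal, nsmul_eq_mul, mul_assoc]
      _ ≤ ENNReal.ofReal (3 ^ (s + 1)) ^ J * (E m ^ (1 / p) * Q) := by gcongr
      _ = _ := by ring
  calc _ ≤ ∑' m, ((ENNReal.ofReal (3 ^ (s + 1)) ^ J * Q) * E m ^ (1 / p)) ^ p := by
        apply ENNReal.tsum_le_tsum
        intro m
        exact ENNReal.rpow_le_rpow (hm m) hp0.le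
    _ = (ENNReal.ofReal (3 ^ (s + 1)) ^ J * Q) ^ p * ∑' m, E m := by
        rw [← ENNReal.tsum_mul_left]
        refine tsum_congr fun m => ?_
        rw [ENNReal.mul_rpow_of_nonneg _ _ hp0.le, ← ENNReal.rpow_mul, one_div,
          inv_mul_cancel₀ hp0.ne', ENNReal.rpow_one]
    _ ≤ _ := by
        rw [hQB, mul_pow, ← mul_assoc]
        gcongr
        exact T.tsum_prod_le (fun x k => Fh x k ^ p)


/-! ### The factors of the single generations -/

/-- The bound `((2k+3)K)^{4p}` in the definition of the nearly resonant set. -/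
noncomputable def thr (K p : ℝ) (k : ℕ) : ℝ := ((2 * (k : ℝ) + 3) * K) ^ (4 * p)

open Classical in
/-- The factor of a generation off the nearly resonant set. -/
noncomputable def farFactor (K p : ℝ) (k : ℕ) (τ : ℤ) : ℝ≥0∞ :=
  if |(τ : ℝ)| ≤ thr K p k then 0 else ENNReal.ofReal |(τ : ℝ)|⁻¹

open Classical in
/-- The factor of a generation in the nearly resonant set. -/
noncomputable def nearFactor (K p : ℝ) (k : ℕ) (τ : ℤ) : ℝ≥0∞ :=
  if |(τ : ℝ)| ≤ thr K p k then 1 else 0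

theorem one_le_base {K : ℝ} (hK : 1 ≤ K) (k : ℕ) : 1 ≤ (2 * (k : ℝ) + 3) * K := by
  nlinarith [(Nat.cast_nonneg k : (0 : ℝ) ≤ k)]

theorem one_le_thr {K p : ℝ} (hp : 1 < p) (hK : 1 ≤ K) (k : ℕ) : 1 ≤ thr K p k :=
  Real.one_le_rpow (one_le_base hK k) (by linarith)

/-- Let M = b^{4p} with b = (2k+3)K, and q = 1 + 2η. Beyond M the function |τ|^{-q} is at most
M^{-η} times the summable |τ|^{-1-η}. Since p(q - 1) = q, one has 4pη/q = 2, so the ℓ^q norm is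
O(b^{-2}). -/
theorem exists_farFactor_le {p : ℝ} (hp : 1 < p) : ∃ C : ℝ, 0 ≤ C ∧ ∀ K : ℝ, 1 ≤ K → ∀ k : ℕ,
    (∑' τ, farFactor K p k τ ^ p.conjExponent) ^ (1 / p.conjExponent) ≤
      ENNReal.ofReal (C * (((2 * (k : ℝ) + 3) * K) ^ 2)⁻¹) := by
  have hpq : p.HolderConjugate p.conjExponent := Real.HolderConjugate.conjExponent hp
  set q := p.conjExponent with hq
  have hq1 : 1 < q := hpq.symm.lt
  have hq0 : 0 < q := by linarith
  obtain ⟨η, hη, hqη⟩ : ∃ η : ℝ, 0 < η ∧ q = 1 + 2 * η := ⟨(q - 1) / 2, by linarith, by ring⟩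
  set S : ℝ≥0∞ := ENNReal.ofReal (2 ^ (1 + η)) * ∑' τ, hw (1 + η) τ with hS
  have hSt : S ≠ ⊤ := ENNReal.mul_ne_top ENNReal.ofReal_ne_top (tsum_hw_ne_top (by linarith))
  refine ⟨(S ^ (1 / q)).toReal, ENNReal.toReal_nonneg, fun K hK k => ?_⟩
  set b : ℝ := (2 * (k : ℝ) + 3) * K with hb
  have hb1 : 1 ≤ b := one_le_base hK k
  have hM1 : 1 ≤ thr K p k := one_le_thr hp hK k
  have h1 : ∀ τ : ℤ, farFactor K p k τ ^ q ≤ ENNReal.ofReal (thr K p k ^ (-η)) *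
      (ENNReal.ofReal (2 ^ (1 + η)) * hw (1 + η) τ) := by
    intro τ
    rw [farFactor]
    split_ifs with h
    · rw [ENNReal.zero_rpow_of_pos hq0]; exact zero_le
    · push Not at h
      have h0 : 0 < |(τ : ℝ)| := by linarith
      rw [ENNReal.ofReal_rpow_of_nonneg (by positivity) hq0.le, hw,
        ← ENNReal.ofReal_mul (by positivity), ← ENNReal.ofReal_mul (by positivity)]
      apply ENNReal.ofReal_le_ofReal
      have e : (|(τ : ℝ)|⁻¹) ^ q = |(τ : ℝ)| ^ (-η) * |(τ : ℝ)| ^ (-(1 + η)) := by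
        rw [← Real.rpow_add h0, Real.inv_rpow h0.le, ← Real.rpow_neg h0.le, hqη]; congr 1; ring
      rw [e]
      gcongr ?_ * ?_
      · exact Real.rpow_le_rpow_of_nonpos (by linarith) h.le (by linarith)
      · calc |(τ : ℝ)| ^ (-(1 + η)) ≤ ((1 + |(τ : ℝ)|) / 2) ^ (-(1 + η)) := by
              apply Real.rpow_le_rpow_of_nonpos (by positivity) _ (by linarith)
              linarith
          _ = _ := by
              rw [Real.div_rpow (by positivity) (by norm_num),
                Real.rpow_neg (by norm_num : (0:ℝ) ≤ 2), div_inv_eq_mul, mul_comm]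
  have h2 : ∑' τ, farFactor K p k τ ^ q ≤ ENNReal.ofReal (thr K p k ^ (-η)) * S := by
    rw [hS, ← ENNReal.tsum_mul_left, ← ENNReal.tsum_mul_left]
    exact ENNReal.tsum_le_tsum h1
  have h3 : (thr K p k ^ (-η)) ^ (1 / q) = (b ^ 2)⁻¹ := by
    have e : 4 * p * (-η) * (1 / q) = -2 := by
      have h4 : p * (q - 1) = q := by
        have := hpq.mul_eq_add; linarith
      have h5 : q - 1 = 2 * η := by linarith
      rw [h5] at h4
      have hpη : p * η = q / 2 := by linarith
      calc 4 * p * (-η) * (1 / q) = -4 * (p * η) * (1 / q) := by ring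
        _ = -2 := by rw [hpη]; field_simp; norm_num
    have hb0 : 0 ≤ b := by linarith
    rw [thr, ← Real.rpow_mul hb0, ← Real.rpow_mul hb0, e, Real.rpow_neg hb0]
    norm_num
  calc _ ≤ (ENNReal.ofReal (thr K p k ^ (-η)) * S) ^ (1 / q) :=
        ENNReal.rpow_le_rpow h2 (by positivity)
    _ = ENNReal.ofReal ((b ^ 2)⁻¹) * S ^ (1 / q) := by
        rw [ENNReal.mul_rpow_of_nonneg _ _ (by positivity),
          ENNReal.ofReal_rpow_of_nonneg (by positivity) (by positivity), h3]
    _ = _ := by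
        rw [ENNReal.ofReal_mul ENNReal.toReal_nonneg, ENNReal.ofReal_toReal
          (ENNReal.rpow_ne_top_of_nonneg (by positivity) hSt), mul_comm]

/-- The indicator of |τ| ≤ M is at most 4M²(1 + |τ|)^{-2}. The bound is crude, but this factor
occurs only once in a tree. -/
theorem exists_nearFactor_le {p : ℝ} (hp : 1 < p) : ∃ C : ℝ, 0 ≤ C ∧ ∀ K : ℝ, 1 ≤ K → ∀ k : ℕ,
    (∑' τ, nearFactor K p k τ ^ p.conjExponent) ^ (1 / p.conjExponent) ≤
      ENNReal.ofReal (C * thr K p k ^ 2) := by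
  have hpq : p.HolderConjugate p.conjExponent := Real.HolderConjugate.conjExponent hp
  set q := p.conjExponent with hq
  have hq1 : 1 < q := hpq.symm.lt
  have hq0 : 0 < q := by linarith
  set S : ℝ≥0∞ := ∑' τ, hw 2 τ with hS
  have hSt : S ≠ ⊤ := tsum_hw_ne_top (by norm_num)
  refine ⟨1 + 4 * S.toReal, by positivity, fun K hK k => ?_⟩
  set M := thr K p k with hM
  have hM1 : 1 ≤ M := one_le_thr hp hK k
  have h1 : ∀ τ : ℤ, nearFactor K p k τ ^ q ≤ ENNReal.ofReal (4 * M ^ 2) * hw 2 τ := by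
    intro τ
    rw [nearFactor]
    split_ifs with h
    · rw [ENNReal.one_rpow, hw, ← ENNReal.ofReal_mul (by positivity), ENNReal.one_le_ofReal,
        Real.rpow_neg (by positivity), ← div_eq_mul_inv, one_le_div (by positivity)]
      norm_num
      have := abs_nonneg (τ : ℝ)
      nlinarith
    · rw [ENNReal.zero_rpow_of_pos hq0]; exact zero_le
  have h2 : ∑' τ, nearFactor K p k τ ^ q ≤ ENNReal.ofReal (4 * M ^ 2) * S := by
    rw [hS, ← ENNReal.tsum_mul_left]
    exact ENNReal.tsum_le_tsum h1
  calc _ ≤ (1 + ENNReal.ofReal (4 * M ^ 2) * S) ^ (1 / q) :=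
        ENNReal.rpow_le_rpow (h2.trans le_add_self) (by positivity)
    _ ≤ (1 + ENNReal.ofReal (4 * M ^ 2) * S) ^ (1 : ℝ) :=
        ENNReal.rpow_le_rpow_of_exponent_le le_self_add (by rw [div_le_one hq0]; exact hq1.le)
    _ = ENNReal.ofReal (1 + 4 * M ^ 2 * S.toReal) := by
        rw [ENNReal.rpow_one, ENNReal.ofReal_add (by norm_num) (by positivity),
          ENNReal.ofReal_mul (p := 4 * M ^ 2) (by positivity), ENNReal.ofReal_toReal hSt,
          ENNReal.ofReal_one]
    _ ≤ _ := by
        apply ENNReal.ofReal_le_ofReal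
        have : 0 ≤ S.toReal := ENNReal.toReal_nonneg
        nlinarith [one_le_pow₀ hM1 (n := 2)]

/-- From 2k + 3 ≥ k + 1 a squared factorial is gained. One factorial compensates for the number of
trees, and the other makes the series entire. -/
theorem prod_inv_sq_le {C K : ℝ} (hC : 0 ≤ C) (hK : 1 ≤ K) (J : ℕ) :
    ∏ k ∈ Finset.range J, (C * (((2 * (k : ℝ) + 3) * K) ^ 2)⁻¹) ≤
      (C * (K ^ 2)⁻¹) ^ J / (J.factorial : ℝ) ^ 2 := by
  have hK0 : 0 < K := by linarith
  induction J with
  | zero => simp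
  | succ J ih =>
    rw [Finset.prod_range_succ, Nat.factorial_succ]
    calc _ ≤ ((C * (K ^ 2)⁻¹) ^ J / (J.factorial : ℝ) ^ 2) *
          (C * (K ^ 2)⁻¹ * (((J : ℝ) + 1) ^ 2)⁻¹) := by
          refine mul_le_mul ih ?_ (by positivity) (by positivity)
          rw [mul_assoc, ← mul_inv]
          gcongr
          rw [mul_pow, mul_comm]
          gcongr
          · linarith [(Nat.cast_nonneg J : (0 : ℝ) ≤ J)]
          · norm_num
      _ = _ := by rw [pow_succ (C * (K ^ 2)⁻¹)]; push_cast; rw [mul_pow ((J : ℝ) + 1), div_eq_mul_inv,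
          div_eq_mul_inv, mul_inv (((J : ℝ) + 1) ^ 2)]; ring

/-- The constants of the operators whose generations are all off the nearly resonant sets. -/
theorem exists_far_bound {p : ℝ} (hp : 1 < p) {C : ℝ≥0∞} (hC : C ≠ ⊤) : ∃ D : ℝ, 0 ≤ D ∧
    ∀ K : ℝ, 1 ≤ K → ∀ J : ℕ, C ^ J * ∏ k ∈ Finset.range J,
      (∑' τ, farFactor K p k τ ^ p.conjExponent) ^ (1 / p.conjExponent) ≤
      ENNReal.ofReal ((D * (K ^ 2)⁻¹) ^ J / (J.factorial : ℝ) ^ 2) := by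
  obtain ⟨C₁, hC₁, h⟩ := exists_farFactor_le hp
  refine ⟨C.toReal * C₁, by positivity, fun K hK J => ?_⟩
  calc _ ≤ C ^ J * ∏ k ∈ Finset.range J, ENNReal.ofReal (C₁ * (((2 * (k : ℝ) + 3) * K) ^ 2)⁻¹) := by
        gcongr with k _; exact h K hK k
    _ = ENNReal.ofReal (C.toReal ^ J *
          ∏ k ∈ Finset.range J, (C₁ * (((2 * (k : ℝ) + 3) * K) ^ 2)⁻¹)) := by
        rw [ENNReal.ofReal_mul (by positivity), ENNReal.ofReal_pow ENNReal.toReal_nonneg,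
          ENNReal.ofReal_toReal hC, ENNReal.ofReal_prod_of_nonneg fun k _ => by positivity]
    _ ≤ _ := by
        apply ENNReal.ofReal_le_ofReal
        calc _ ≤ C.toReal ^ J * ((C₁ * (K ^ 2)⁻¹) ^ J / (J.factorial : ℝ) ^ 2) := by
              gcongr; exact prod_inv_sq_le hC₁ hK J
          _ = _ := by rw [mul_assoc C.toReal, mul_pow C.toReal]; ring

open Classical in
/-- The constants of the operators whose last generation is nearly resonant. -/
theorem exists_near_bound {p : ℝ} (hp : 1 < p) {C : ℝ≥0∞} (hC : C ≠ ⊤) {K : ℝ} (hK : 1 ≤ K) :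
    ∃ D : ℝ, 0 ≤ D ∧ ∀ j : ℕ, C ^ (j + 1) * ∏ k ∈ Finset.range (j + 1),
      (∑' τ, (if k < j then farFactor K p k τ else nearFactor K p k τ) ^ p.conjExponent) ^
        (1 / p.conjExponent) ≤
      ENNReal.ofReal (D ^ (j + 1) / (j.factorial : ℝ) ^ 2) := by
  obtain ⟨D₁, hD₁, h₁⟩ := exists_far_bound hp hC
  obtain ⟨C₂, hC₂, h₂⟩ := exists_nearFactor_le hp
  have hK0 : 0 < K := by linarith
  -- The squared threshold is K^{8p}(2j+3)^{8p}, at most `B` times a geometric factor in j. The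
  -- constant `D` thus depends on K and is not small; it is compensated later by the length of the
  -- time interval.
  set B : ℝ := K ^ (8 * p) with hB
  have hB1 : 1 ≤ B := Real.one_le_rpow hK (by linarith)
  set D : ℝ := (1 + D₁) * (1 + C.toReal) * (1 + C₂) * B * 3 ^ (8 * p) with hD
  refine ⟨D, by positivity, fun j => ?_⟩
  have hM : thr K p j ^ 2 ≤ B * (3 ^ (8 * p)) ^ (j + 1) := by
    have h3 : (2 * (j : ℝ) + 3) ≤ 3 ^ (j + 1) := by
      have := one_add_mul_le_pow (a := (2 : ℝ)) (by norm_num) (j + 1)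
      push_cast at this; norm_num at this; linarith
    have e : thr K p j ^ 2 = (2 * (j : ℝ) + 3) ^ (8 * p) * B := by
      rw [thr, ← Real.rpow_natCast, ← Real.rpow_mul (by positivity),
        Real.mul_rpow (by positivity) hK0.le]
      push_cast
      rw [show 4 * p * 2 = 8 * p by ring]
    rw [e, mul_comm]
    gcongr
    calc _ ≤ ((3 : ℝ) ^ (j + 1)) ^ (8 * p) :=
          Real.rpow_le_rpow (by positivity) h3 (by linarith)
      _ = _ := by
          rw [← Real.rpow_natCast, ← Real.rpow_natCast, ← Real.rpow_mul (by norm_num),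
            ← Real.rpow_mul (by norm_num), mul_comm]
  have hprod : ∏ k ∈ Finset.range (j + 1), (∑' τ, (if k < j then farFactor K p k τ
      else nearFactor K p k τ) ^ p.conjExponent) ^ (1 / p.conjExponent) =
      (∏ k ∈ Finset.range j, (∑' τ, farFactor K p k τ ^ p.conjExponent) ^ (1 / p.conjExponent)) *
        (∑' τ, nearFactor K p j τ ^ p.conjExponent) ^ (1 / p.conjExponent) := by
    rw [Finset.prod_range_succ]
    congr 1
    · refine Finset.prod_congr rfl fun k hk => ?_
      simp only [if_pos (Finset.mem_range.mp hk)]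
    · simp
  rw [hprod]
  calc _ = C * (C ^ j * ∏ k ∈ Finset.range j,
        (∑' τ, farFactor K p k τ ^ p.conjExponent) ^ (1 / p.conjExponent)) *
        (∑' τ, nearFactor K p j τ ^ p.conjExponent) ^ (1 / p.conjExponent) := by rw [pow_succ]; ring
    _ ≤ ENNReal.ofReal C.toReal * ENNReal.ofReal ((D₁ * (K ^ 2)⁻¹) ^ j / (j.factorial : ℝ) ^ 2) *
        ENNReal.ofReal (C₂ * thr K p j ^ 2) := by
        rw [ENNReal.ofReal_toReal hC]
        gcongr
        · exact h₁ K hK j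
        · exact h₂ K hK j
    _ = ENNReal.ofReal (C.toReal * ((D₁ * (K ^ 2)⁻¹) ^ j / (j.factorial : ℝ) ^ 2) *
        (C₂ * thr K p j ^ 2)) := by
        rw [← ENNReal.ofReal_mul ENNReal.toReal_nonneg, ← ENNReal.ofReal_mul (by positivity)]
    _ ≤ _ := by
        apply ENNReal.ofReal_le_ofReal
        have hK2 : (K ^ 2)⁻¹ ≤ 1 := inv_le_one_of_one_le₀ (one_le_pow₀ hK)
        have hc0 : 0 ≤ C.toReal := ENNReal.toReal_nonneg
        have k1 : (D₁ * (K ^ 2)⁻¹) ^ j ≤ (1 + D₁) ^ (j + 1) := by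
          calc _ ≤ (1 + D₁) ^ j := by
                gcongr
                nlinarith
            _ ≤ _ := pow_le_pow_right₀ (by linarith) (by omega)
        have k2 : C.toReal ≤ (1 + C.toReal) ^ (j + 1) := by
          calc C.toReal ≤ (1 + C.toReal) ^ 1 := by linarith [pow_one (1 + C.toReal)]
            _ ≤ _ := pow_le_pow_right₀ (by linarith) (by omega)
        have k3 : C₂ ≤ (1 + C₂) ^ (j + 1) := by
          calc C₂ ≤ (1 + C₂) ^ 1 := by linarith [pow_one (1 + C₂)]
            _ ≤ _ := pow_le_pow_right₀ (by linarith) (by omega)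
        have k4 : B ≤ B ^ (j + 1) := by
          calc B = B ^ 1 := (pow_one B).symm
            _ ≤ _ := pow_le_pow_right₀ hB1 (by omega)
        calc _ ≤ (1 + C.toReal) ^ (j + 1) * ((1 + D₁) ^ (j + 1) / (j.factorial : ℝ) ^ 2) *
              ((1 + C₂) ^ (j + 1) * (B ^ (j + 1) * (3 ^ (8 * p)) ^ (j + 1))) := by
              gcongr
              exact hM.trans (by gcongr)
          _ = _ := by rw [hD]; simp only [mul_pow]; ring


/-! ### Fourier--Lebesgue spaces -/

section FLspace

variable {s p : ℝ} [hp : Fact (1 < p)]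

theorem FL.coeff_injective : Function.Injective (FL.coeff : FL s p → Freq → ℂ) :=
  Subtype.val_injective

@[simp] theorem FL.coeff_add (f g : FL s p) (n : Freq) : (f + g).coeff n = f.coeff n + g.coeff n :=
  rfl

@[simp] theorem FL.coeff_zero (n : Freq) : (0 : FL s p).coeff n = 0 := rfl

@[simp] theorem FL.coeff_sub (f g : FL s p) (n : Freq) : (f - g).coeff n = f.coeff n - g.coeff n :=
  rfl

@[simp] theorem FL.coeff_neg (f : FL s p) (n : Freq) : (-f).coeff n = -f.coeff n := rfl

@[simp] theorem FL.coeff_smul (r : ℝ) (f : FL s p) (n : Freq) :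
    (r • f).coeff n = (r : ℂ) * f.coeff n := rfl

theorem toReal_ofReal_exponent : (ENNReal.ofReal p).toReal = p :=
  ENNReal.toReal_ofReal (by linarith [hp.out])

/-- The `p`-th power of the norm of `FL^{s,p}`. -/
noncomputable def flE (s p : ℝ) (g : Freq → ℂ) : ℝ≥0∞ :=
  ∑' n, (ENNReal.ofReal (jap n ^ s) * ‖g n‖ₑ) ^ p

theorem flE_term (g : Freq → ℂ) (n : Freq) : (ENNReal.ofReal (jap n ^ s) * ‖g n‖ₑ) ^ p =
    ENNReal.ofReal (‖((jap n ^ s : ℝ) : ℂ) * g n‖ ^ p) := by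
  have h0 : 0 ≤ jap n ^ s := Real.rpow_nonneg (jap_pos n).le _
  rw [← ofReal_norm, ← ENNReal.ofReal_mul h0, ENNReal.ofReal_rpow_of_nonneg
    (by positivity) (by linarith [hp.out]), norm_mul, Complex.norm_real, Real.norm_of_nonneg h0]

theorem flE_coeff (f : FL s p) : flE s p f.coeff = ‖f‖ₑ ^ p := by
  have hp0 : 0 < p := by linarith [hp.out]
  have h := lp.norm_rpow_eq_tsum (p := ENNReal.ofReal p)
    (by rw [toReal_ofReal_exponent]; exact hp0) (FL.toLp s p f)
  have hm := (memℓp_gen_iff (p := ENNReal.ofReal p)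
    (by rw [toReal_ofReal_exponent]; exact hp0)).mp (FL.toLp s p f).2
  rw [toReal_ofReal_exponent] at h hm
  rw [← ofReal_norm, ENNReal.ofReal_rpow_of_nonneg (norm_nonneg _) hp0.le]
  change _ = ENNReal.ofReal (‖FL.toLp s p f‖ ^ p)
  rw [h, ENNReal.ofReal_tsum_of_nonneg (fun n => by positivity) hm]
  exact tsum_congr fun n => flE_term _ _

theorem exists_coeff_eq {g : Freq → ℂ} (hg : flE s p g ≠ ⊤) : ∃ f : FL s p, f.coeff = g := by
  have hp0 : 0 < p := by linarith [hp.out]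
  have h : Memℓp (E := fun _ : Freq => ℂ)
      (fun n => ((jap n ^ s : ℝ) : ℂ) * g n) (ENNReal.ofReal p) := by
    rw [memℓp_gen_iff (by rw [toReal_ofReal_exponent]; exact hp0), toReal_ofReal_exponent]
    have := ENNReal.summable_toReal hg
    refine this.congr fun n => ?_
    rw [flE_term, ENNReal.toReal_ofReal (by positivity)]
  exact ⟨⟨g, h⟩, rfl⟩

theorem exists_coeff_eq_of_le {g : Freq → ℂ} {B : ℝ} (hB : 0 ≤ B)
    (hg : flE s p g ≤ ENNReal.ofReal B ^ p) : ∃ f : FL s p, f.coeff = g ∧ ‖f‖ ≤ B := by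
  have hp0 : 0 < p := by linarith [hp.out]
  obtain ⟨f, hf⟩ := exists_coeff_eq (s := s) (p := p)
    (hg.trans_lt (ENNReal.rpow_lt_top_of_nonneg hp0.le ENNReal.ofReal_ne_top)).ne
  refine ⟨f, hf, ?_⟩
  rw [← hf, flE_coeff, ENNReal.rpow_le_rpow_iff hp0, ← ofReal_norm,
    ENNReal.ofReal_le_ofReal_iff hB] at hg
  exact hg

theorem exists_coeff_eq_of_norm_le {g : Freq → ℂ} {c : ℝ} (hc : 0 ≤ c) (f : FL s p)
    (hg : ∀ n, ‖g n‖ ≤ c * ‖f.coeff n‖) : ∃ h : FL s p, h.coeff = g ∧ ‖h‖ ≤ c * ‖f‖ := by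
  have hp0 : 0 < p := by linarith [hp.out]
  apply exists_coeff_eq_of_le (by positivity)
  rw [ENNReal.ofReal_mul hc, ENNReal.mul_rpow_of_nonneg _ _ hp0.le, ofReal_norm,
    ← flE_coeff, flE, flE, ← ENNReal.tsum_mul_left]
  apply ENNReal.tsum_le_tsum
  intro n
  rw [← ENNReal.mul_rpow_of_nonneg _ _ hp0.le]
  apply ENNReal.rpow_le_rpow _ hp0.le
  calc ENNReal.ofReal (jap n ^ s) * ‖g n‖ₑ
      ≤ ENNReal.ofReal (jap n ^ s) * (ENNReal.ofReal c * ‖f.coeff n‖ₑ) := by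
        gcongr
        rw [← ofReal_norm, ← ofReal_norm, ← ENNReal.ofReal_mul hc]
        exact ENNReal.ofReal_le_ofReal (hg n)
    _ = _ := by ring

theorem norm_coeff_le (f : FL s p) (n : Freq) : ‖f.coeff n‖ ≤ jap n ^ (-s) * ‖f‖ := by
  have hp0 : 0 < p := by linarith [hp.out]
  have h : ‖((jap n ^ s : ℝ) : ℂ) * f.coeff n‖ ≤ ‖f‖ :=
    lp.norm_apply_le_norm (by simpa using hp0) (FL.toLp s p f) n
  have h0 : 0 < jap n ^ s := Real.rpow_pos_of_pos (jap_pos n) _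
  rw [norm_mul, Complex.norm_real, Real.norm_of_nonneg h0.le] at h
  rw [Real.rpow_neg (jap_pos n).le, inv_mul_eq_div, le_div_iff₀ h0]
  linarith

/-- A Fourier coefficient as a continuous linear functional. -/
noncomputable def coeffL (n : Freq) : FL s p →L[ℝ] ℂ :=
  LinearMap.mkContinuous
    { toFun := fun f => f.coeff n
      map_add' := fun _ _ => rfl
      map_smul' := fun r f => FL.coeff_smul r f n } (jap n ^ (-s)) fun f => norm_coeff_le f n

@[simp] theorem coeffL_apply (n : Freq) (f : FL s p) : coeffL n f = f.coeff n := rfl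

theorem FL.coeff_sum {ι : Type*} (S : Finset ι) (f : ι → FL s p) (n : Freq) :
    (∑ i ∈ S, f i).coeff n = ∑ i ∈ S, (f i).coeff n := map_sum (coeffL n) f S

/-- The weights vanish nowhere, so multiplication by them is an isometry onto ℓ^p. -/
instance : CompleteSpace (FL s p) := by
  have hi : Isometry (FL.toLp s p) := by
    apply AddMonoidHomClass.isometry_of_norm
    intro f; rfl
  rw [completeSpace_iff_isComplete_range hi.isUniformInducing]
  have hr : Set.range (FL.toLp s p) = Set.univ := by
    rw [Set.eq_univ_iff_forall]
    intro g
    have e : ∀ n, ((jap n ^ s : ℝ) : ℂ) * (((jap n ^ s : ℝ) : ℂ)⁻¹ * g n) = g n := fun n => by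
      have h2 : ((jap n ^ s : ℝ) : ℂ) ≠ 0 := by
        exact_mod_cast (Real.rpow_pos_of_pos (jap_pos n) s).ne'
      rw [mul_inv_cancel_left₀ h2]
    refine ⟨⟨fun n => ((jap n ^ s : ℝ) : ℂ)⁻¹ * g n, ?_⟩, ?_⟩
    · change Memℓp (E := fun _ : Freq => ℂ) _ _
      simp only [e]
      exact lp.memℓp g
    · ext n
      exact e n
  rw [hr]
  exact isComplete_univ

theorem exists_finite_support_coeff {g : Freq → ℂ} (hg : (Function.support g).Finite) :
    ∃ f : FL s p, f.coeff = g := by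
  have hp0 : 0 < p := by linarith [hp.out]
  apply exists_coeff_eq
  rw [flE, tsum_eq_sum (s := hg.toFinset)]
  · exact ENNReal.sum_ne_top.mpr fun n _ => ENNReal.rpow_ne_top_of_nonneg hp0.le
      (ENNReal.mul_ne_top ENNReal.ofReal_ne_top enorm_ne_top)
  · intro n hn
    have : g n = 0 := by simpa using hn
    rw [this, enorm_zero, mul_zero, ENNReal.zero_rpow_of_pos hp0]

instance : Nontrivial (FL s p) := by
  obtain ⟨f, hf⟩ := exists_finite_support_coeff (s := s) (p := p)
    (g := fun n => if n = 0 then 1 else 0) ((Set.finite_singleton (0 : Freq)).subset (by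
      intro n hn; by_contra h; simp at h; simp [h] at hn))
  refine ⟨f, 0, fun h => ?_⟩
  have := congrFun hf 0
  rw [h] at this
  simp at this

/-! ### The propagator -/

theorem norm_propagator (t : ℝ) (f : Freq → ℂ) (n : Freq) : ‖propagator t f n‖ = ‖f n‖ := by
  rw [propagator, norm_mul, show -(Complex.I * t * (hsq n : ℂ)) = ((-(t * hsq n) : ℝ) : ℂ) *
    Complex.I by push_cast; ring, Complex.norm_exp_ofReal_mul_I, one_mul]

theorem exists_propagator (t : ℝ) (f : FL s p) : ∃ g : FL s p, g.coeff = propagator t f.coeff :=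
  let ⟨g, hg, _⟩ := exists_coeff_eq_of_norm_le zero_le_one f (g := propagator t f.coeff)
    (fun n => by rw [norm_propagator, one_mul])
  ⟨g, hg⟩

theorem norm_eq_of_coeff {f g : FL s p} (h : ∀ n, ‖f.coeff n‖ = ‖g.coeff n‖) : ‖f‖ = ‖g‖ := by
  have hp0 : 0 < p := by linarith [hp.out]
  have h1 : flE s p f.coeff = flE s p g.coeff := by
    refine tsum_congr fun n => ?_
    rw [← ofReal_norm, h, ofReal_norm]
  rw [flE_coeff, flE_coeff] at h1
  have h2 := ENNReal.rpow_left_injective hp0.ne' h1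
  rwa [← ofReal_norm, ← ofReal_norm,
    ENNReal.ofReal_eq_ofReal_iff (norm_nonneg _) (norm_nonneg _)] at h2

/-- The propagator on `FL^{s,p}`. -/
noncomputable def propL (t : ℝ) : FL s p →L[ℝ] FL s p :=
  LinearMap.mkContinuous
    { toFun := fun f => (exists_propagator t f).choose
      map_add' := fun f g => FL.coeff_injective (funext fun n => by
        rw [FL.coeff_add, (exists_propagator t _).choose_spec, (exists_propagator t _).choose_spec,
          (exists_propagator t _).choose_spec, propagator, propagator, propagator, FL.coeff_add,
          mul_add])
      map_smul' := fun r f => FL.coeff_injective (funext fun n => by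
        rw [RingHom.id_apply, FL.coeff_smul, (exists_propagator t _).choose_spec,
          (exists_propagator t _).choose_spec, propagator, propagator, FL.coeff_smul]
        ring) } 1 fun f => by
      rw [one_mul]
      refine (norm_eq_of_coeff fun n => ?_).le
      change ‖(exists_propagator t f).choose.coeff n‖ = _
      rw [(exists_propagator t f).choose_spec, norm_propagator]

theorem propL_coeff (t : ℝ) (f : FL s p) : (propL t f).coeff = propagator t f.coeff :=
  (exists_propagator t f).choose_spec

theorem norm_propL (t : ℝ) (f : FL s p) : ‖propL t f‖ = ‖f‖ :=
  norm_eq_of_coeff fun n => by rw [propL_coeff, norm_propagator]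

theorem propagator_add (t t' : ℝ) (f : Freq → ℂ) :
    propagator t (propagator t' f) = propagator (t + t') f := by
  funext n
  rw [propagator, propagator, propagator, ← mul_assoc, ← Complex.exp_add]
  congr 2; push_cast; ring

theorem propagator_zero (f : Freq → ℂ) : propagator 0 f = f := by
  funext n; simp [propagator]

theorem propL_zero (f : FL s p) : propL 0 f = f :=
  FL.coeff_injective (by rw [propL_coeff, propagator_zero])

-- Dominated convergence for the p-th powers, with majorant 2^p times the terms of the norm of f.
-- The exponent p is finite, which is essential here.
open Filter Topology in
theorem continuous_propL_apply (f : FL s p) : Continuous fun t : ℝ => propL t f := by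
  have hp0 : 0 < p := by linarith [hp.out]
  rw [continuous_iff_continuousAt]
  intro t₀
  rw [ContinuousAt, tendsto_iff_norm_sub_tendsto_zero]
  have e : ∀ t, ‖propL t f - propL t₀ f‖ =
      (∑' n, ‖((jap n ^ s : ℝ) : ℂ) * (propagator t f.coeff n - propagator t₀ f.coeff n)‖ ^ p) ^
        (1 / p) := by
    intro t
    have h := lp.norm_eq_tsum_rpow (p := ENNReal.ofReal p)
      (by rw [toReal_ofReal_exponent]; exact hp0) (FL.toLp s p (propL t f - propL t₀ f))
    rw [toReal_ofReal_exponent] at h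
    refine h.trans ?_
    congr 1
    refine tsum_congr fun n => ?_
    change ‖((jap n ^ s : ℝ) : ℂ) * (propL t f - propL t₀ f).coeff n‖ ^ p = _
    rw [FL.coeff_sub, propL_coeff, propL_coeff]
  have hm := (memℓp_gen_iff (p := ENNReal.ofReal p)
    (by rw [toReal_ofReal_exponent]; exact hp0)).mp (FL.toLp s p f).2
  rw [toReal_ofReal_exponent] at hm
  have hlim : Tendsto (fun t => ∑' n, ‖((jap n ^ s : ℝ) : ℂ) *
      (propagator t f.coeff n - propagator t₀ f.coeff n)‖ ^ p) (𝓝 t₀) (𝓝 (∑' _ : Freq, (0 : ℝ))) := by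
    refine tendsto_tsum_of_dominated_convergence (hm.mul_left (2 ^ p)) ?_ ?_
    · intro n
      have hc : Continuous fun t : ℝ => ‖((jap n ^ s : ℝ) : ℂ) *
          (propagator t f.coeff n - propagator t₀ f.coeff n)‖ ^ p := by
        simp only [propagator]
        refine Continuous.rpow_const (by fun_prop) fun _ => Or.inr hp0.le
      have := hc.tendsto t₀
      simpa [Real.zero_rpow hp0.ne'] using this
    · refine Eventually.of_forall fun t n => ?_
      rw [Real.norm_of_nonneg (by positivity), ← Real.mul_rpow (by norm_num) (norm_nonneg _)]
      apply Real.rpow_le_rpow (norm_nonneg _) _ hp0.le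
      change _ ≤ 2 * ‖((jap n ^ s : ℝ) : ℂ) * f.coeff n‖
      rw [norm_mul, norm_mul]
      have := norm_sub_le (propagator t f.coeff n) (propagator t₀ f.coeff n)
      rw [norm_propagator, norm_propagator] at this
      nlinarith [norm_nonneg ((jap n ^ s : ℝ) : ℂ)]
  rw [tsum_zero] at hlim
  have := hlim.rpow_const (p := 1 / p) (Or.inr (by positivity))
  rw [Real.zero_rpow (by positivity)] at this
  exact this.congr fun t => (e t).symm

theorem continuous_propL : Continuous fun z : ℝ × FL s p => propL z.1 z.2 := by
  rw [Metric.continuous_iff]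
  rintro ⟨t₀, f₀⟩ ε hε
  obtain ⟨δ, hδ, h⟩ := Metric.continuous_iff.mp (continuous_propL_apply f₀) t₀ (ε / 2) (by positivity)
  refine ⟨min δ (ε / 2), by positivity, ?_⟩
  rintro ⟨t, f⟩ hz
  rw [Prod.dist_eq, max_lt_iff, lt_min_iff, lt_min_iff] at hz
  calc dist (propL t f) (propL t₀ f₀) ≤ dist (propL t f) (propL t f₀) +
        dist (propL t f₀) (propL t₀ f₀) := dist_triangle _ _ _
    _ < ε / 2 + ε / 2 := by
        gcongr
        · rw [dist_eq_norm, ← map_sub, norm_propL, ← dist_eq_norm]; exact hz.2.2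
        · exact h t hz.1.1
    _ = ε := by ring

/-! ### The embedding into `ℓ²` -/

/-- With F = ⟨n⟩^s |f(n)| one has |f|² = F · (F⟨n⟩^{-2s}). Hölder and F ≤ ‖f‖ leave the sum of
⟨n⟩^{-2sq}, which converges in two dimensions because sq > 1. The argument is the same for p below
and above 2. The mass in `calR1` is finite by this. -/
theorem exists_l2_bound (hs : 1 - 1 / p < s) : ∃ C : ℝ, 0 ≤ C ∧ ∀ f : FL s p,
    Summable (fun n => ‖f.coeff n‖ ^ 2) ∧ ∑' n, ‖f.coeff n‖ ^ 2 ≤ C * ‖f‖ ^ 2 := by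
  have hpq : p.HolderConjugate p.conjExponent := Real.HolderConjugate.conjExponent hp.out
  set q := p.conjExponent with hq
  have hp0 : 0 < p := by linarith [hp.out]
  have hq0 : 0 < q := hpq.symm.pos
  have hinv : 1 / q = 1 - 1 / p := by
    have := hpq.inv_add_inv_eq_one; rw [one_div, one_div]; linarith
  have ha : 1 < s * q := by
    rw [← hinv] at hs
    calc 1 = 1 / q * q := by field_simp
      _ < s * q := by gcongr
  set S : ℝ≥0∞ := ∑' n : Freq, wJ (s * q) n ^ 2 with hS
  have hSt : S ≠ ⊤ := by
    obtain ⟨δ, hδ, hδ'⟩ : ∃ δ : ℝ, 0 < δ ∧ s * q = 1 + 2 * δ := ⟨(s * q - 1) / 2, by linarith, by ring⟩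
    set k : ℝ≥0∞ := ENNReal.ofReal (2 ^ (1 + 2 * δ)) with hk
    refine ne_top_of_le_ne_top (b := k * k * ((∑' j, hw (1 + δ) j) * ∑' j, hw (1 + δ) j)) ?_ ?_
    · exact ENNReal.mul_ne_top (ENNReal.mul_ne_top ENNReal.ofReal_ne_top ENNReal.ofReal_ne_top)
        (ENNReal.mul_ne_top (tsum_hw_ne_top (by linarith)) (tsum_hw_ne_top (by linarith)))
    · rw [← ENNReal.tsum_mul_right, ← ENNReal.tsum_mul_left, hS, ENNReal.tsum_prod']
      apply ENNReal.tsum_le_tsum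
      intro a
      rw [← ENNReal.tsum_mul_left, ← ENNReal.tsum_mul_left]
      apply ENNReal.tsum_le_tsum
      intro b
      rw [hδ']
      calc wJ (1 + 2 * δ) (a, b) ^ 2 = wJ (1 + 2 * δ) (a, b) * wJ (1 + 2 * δ) (a, b) := sq _
        _ ≤ (k * (hw (1 + δ) a * hw δ b)) * (k * (hw δ a * hw (1 + δ) b)) :=
            mul_le_mul' (wJ_le hδ.le (a, b)).1 (wJ_le hδ.le (a, b)).2
        _ ≤ (k * (hw (1 + δ) a * 1)) * (k * (1 * hw (1 + δ) b)) := by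
            gcongr <;> exact hw_le_one hδ.le _
        _ = _ := by ring
  set C : ℝ≥0∞ := S ^ (1 / q) with hC
  have hCt : C ≠ ⊤ := ENNReal.rpow_ne_top_of_nonneg (by positivity) hSt
  have key : ∀ f : FL s p, ∑' n, ‖f.coeff n‖ₑ ^ 2 ≤ C * ‖f‖ₑ ^ 2 := by
    intro f
    set F : Freq → ℝ≥0∞ := fun n => ENNReal.ofReal (jap n ^ s) * ‖f.coeff n‖ₑ with hF
    have hFle : ∀ n, F n ≤ ‖f‖ₑ := fun n => by
      have h := ENNReal.le_tsum (f := fun n => F n ^ p) n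
      have e : ∑' n, F n ^ p = ‖f‖ₑ ^ p := flE_coeff f
      rw [e, ENNReal.rpow_le_rpow_iff hp0] at h
      exact h
    have hterm : ∀ n, ‖f.coeff n‖ₑ ^ 2 = F n * (F n * ENNReal.ofReal (jap n ^ (-(2 * s)))) := by
      intro n
      have h1 : ENNReal.ofReal (jap n ^ s) * (ENNReal.ofReal (jap n ^ s) *
          ENNReal.ofReal (jap n ^ (-(2 * s)))) = 1 := by
        have h0 := fun r => Real.rpow_nonneg (jap_pos n).le r
        rw [← ENNReal.ofReal_mul (h0 _), ← ENNReal.ofReal_mul (h0 _), ← Real.rpow_add (jap_pos n),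
          ← Real.rpow_add (jap_pos n)]
        ring_nf; simp
      calc ‖f.coeff n‖ₑ ^ 2 = (ENNReal.ofReal (jap n ^ s) * (ENNReal.ofReal (jap n ^ s) *
          ENNReal.ofReal (jap n ^ (-(2 * s))))) * ‖f.coeff n‖ₑ ^ 2 := by rw [h1, one_mul]
        _ = _ := by simp only [hF]; ring
    simp only [hterm]
    refine (tsum_mul_le_Lp_mul_Lq hpq _ _).trans ?_
    have e1 : (∑' n, F n ^ p) ^ (1 / p) = ‖f‖ₑ := by
      rw [show ∑' n, F n ^ p = ‖f‖ₑ ^ p from flE_coeff f, ← ENNReal.rpow_mul]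
      rw [mul_one_div_cancel hp0.ne', ENNReal.rpow_one]
    have e2 : (∑' n, (F n * ENNReal.ofReal (jap n ^ (-(2 * s)))) ^ q) ^ (1 / q) ≤ ‖f‖ₑ * C := by
      calc _ ≤ (‖f‖ₑ ^ q * S) ^ (1 / q) := by
            apply ENNReal.rpow_le_rpow _ (by positivity)
            rw [hS, ← ENNReal.tsum_mul_left]
            apply ENNReal.tsum_le_tsum
            intro n
            rw [ENNReal.mul_rpow_of_nonneg _ _ hq0.le]
            gcongr
            · exact hFle n
            · rw [wJ, ENNReal.ofReal_rpow_of_nonneg (Real.rpow_nonneg (jap_pos n).le _) hq0.le,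
                ← ENNReal.ofReal_pow (Real.rpow_nonneg (jap_pos n).le _), ← Real.rpow_natCast,
                ← Real.rpow_mul (jap_pos n).le, ← Real.rpow_mul (jap_pos n).le]
              apply le_of_eq; congr 2; push_cast; ring
        _ = _ := by
            rw [ENNReal.mul_rpow_of_nonneg _ _ (by positivity), ← ENNReal.rpow_mul,
              mul_one_div_cancel hq0.ne', ENNReal.rpow_one]
    rw [e1]
    calc ‖f‖ₑ * _ ≤ ‖f‖ₑ * (‖f‖ₑ * C) := by gcongr
      _ = _ := by ring
  refine ⟨C.toReal, ENNReal.toReal_nonneg, fun f => ?_⟩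
  have h := key f
  have hrhs : C * ‖f‖ₑ ^ 2 = ENNReal.ofReal (C.toReal * ‖f‖ ^ 2) := by
    rw [ENNReal.ofReal_mul ENNReal.toReal_nonneg, ENNReal.ofReal_toReal hCt,
      ENNReal.ofReal_pow (norm_nonneg _), ofReal_norm]
  have hlhs : ∀ n, ‖f.coeff n‖ₑ ^ 2 = ENNReal.ofReal (‖f.coeff n‖ ^ 2) := fun n => by
    rw [ENNReal.ofReal_pow (norm_nonneg _), ofReal_norm]
  rw [hrhs] at h
  simp only [hlhs] at h
  have hsum : Summable fun n => ‖f.coeff n‖ ^ 2 := by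
    refine (ENNReal.summable_toReal (h.trans_lt ENNReal.ofReal_lt_top).ne).congr fun n => ?_
    rw [ENNReal.toReal_ofReal (by positivity)]
  refine ⟨hsum, ?_⟩
  rwa [← ENNReal.ofReal_tsum_of_nonneg (fun n => by positivity) hsum,
    ENNReal.ofReal_le_ofReal_iff (by positivity)] at h

end FLspace


/-! ### Conjugation at a node -/

theorem Node.star_add (a : Node) (z w : ℂ) : a.star (z + w) = a.star z + a.star w := by
  unfold Node.star; split_ifs <;> simp

theorem Node.star_mul (a : Node) (z w : ℂ) : a.star (z * w) = a.star z * a.star w := by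
  unfold Node.star; split_ifs <;> simp

theorem Node.star_ofReal (a : Node) (r : ℝ) : a.star (r : ℂ) = r := by
  unfold Node.star; split_ifs <;> simp

theorem Node.norm_star (a : Node) (z : ℂ) : ‖a.star z‖ = ‖z‖ := by
  unfold Node.star; split_ifs <;> simp

theorem Node.star_exp (a : Node) (t : ℝ) (h : ℤ) :
    a.star (Complex.exp (-(Complex.I * ((-t : ℝ) : ℂ) * (h : ℂ)))) =
      Complex.exp (Complex.I * t * ((a.sign * h : ℤ) : ℂ)) := by
  unfold Node.star Node.sign
  split_ifs with he
  · rw [he.neg_one_pow]; congr 1; push_cast; ring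
  · rw [(Nat.not_even_iff_odd.mp he).neg_one_pow, ← Complex.exp_conj]
    congr 1
    simp

/-- Conjugation at a node as a real-linear map. -/
noncomputable def starL (a : Node) : ℂ →ₗ[ℝ] ℂ where
  toFun := a.star
  map_add' := a.star_add
  map_smul' r z := by
    rw [Complex.real_smul, a.star_mul, a.star_ofReal, RingHom.id_apply, Complex.real_smul]

/-! ### Multilinear operators of trees -/

section TreeOperators

variable {s p : ℝ} [hp : Fact (1 < p)] {J : ℕ} (T : OrderedTree J)

/-- The multilinear form `∏ f_a(n_a)^{*a}` over the terminal nodes. -/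
noncomputable def nodeProd (n : Node → Freq) :
    MultilinearMap ℝ (fun _ : {a // a ∈ T.terminal} => FL s p) ℂ :=
  (MultilinearMap.mkPiAlgebra ℝ {a // a ∈ T.terminal} ℂ).compLinearMap
    fun a => starL a.1 ∘ₗ (coeffL (n a.1)).toLinearMap

theorem nodeProd_apply (n : Node → Freq) (f : {a // a ∈ T.terminal} → FL s p) :
    nodeProd T n f = ∏ a : {a // a ∈ T.terminal}, a.1.star ((f a).coeff (n a.1)) := rfl

/-- The weighted `ℓ^p` bound for the operator of a tree with coefficients `c`. -/
def TreeBound (s p : ℝ) {J : ℕ} (T : OrderedTree J) (c : (Node → Freq) → ℂ) (B : ℝ) : Prop :=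
  ∀ F : Node → Freq → ℝ≥0∞, ∑' m, (ENNReal.ofReal (jap m ^ s) *
      ∑' n : T.indexFn m, ‖c n.1‖ₑ * ∏ x ∈ T.terminal, F x (n.1 x)) ^ p ≤
    ENNReal.ofReal B ^ p * ∏ x ∈ T.terminal, ∑' k, (ENNReal.ofReal (jap k ^ s) * F x k) ^ p

theorem enorm_prod_complex {ι : Type*} (S : Finset ι) (f : ι → ℂ) :
    ‖∏ i ∈ S, f i‖ₑ = ∏ i ∈ S, ‖f i‖ₑ := by
  rw [← ofReal_norm, norm_prod, ENNReal.ofReal_prod_of_nonneg fun _ _ => norm_nonneg _]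
  exact Finset.prod_congr rfl fun i _ => ofReal_norm _

variable {T} {c : (Node → Freq) → ℂ} {B : ℝ}

theorem TreeBound.tsum_le (hT : TreeBound s p T c B) (hB : 0 ≤ B)
    (f : {a // a ∈ T.terminal} → FL s p) :
    ∑' m, (ENNReal.ofReal (jap m ^ s) * ∑' n : T.indexFn m, ‖c n.1 * nodeProd T n.1 f‖ₑ) ^ p ≤
      ENNReal.ofReal (B * ∏ a, ‖f a‖) ^ p := by
  classical
  have hp0 : 0 < p := by linarith [hp.out]
  set F : Node → Freq → ℝ≥0∞ := fun x k =>
    if h : x ∈ T.terminal then ‖(f ⟨x, h⟩).coeff k‖ₑ else 0 with hF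
  have h := hT F
  have e1 : ∀ n : Node → Freq, ‖c n * nodeProd T n f‖ₑ =
      ‖c n‖ₑ * ∏ x ∈ T.terminal, F x (n x) := by
    intro n
    have e : ∏ x ∈ T.terminal, F x (n x) =
        ∏ a : {a // a ∈ T.terminal}, ‖a.1.star ((f a).coeff (n a.1))‖ₑ := by
      rw [← Finset.prod_coe_sort]
      refine Finset.prod_congr rfl fun a _ => ?_
      rw [← ofReal_norm, Node.norm_star, ofReal_norm, hF]
      exact dif_pos a.2
    rw [nodeProd_apply, enorm_mul, enorm_prod_complex, e]
  have e2 : ∏ x ∈ T.terminal, ∑' k, (ENNReal.ofReal (jap k ^ s) * F x k) ^ p =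
      ENNReal.ofReal (∏ a, ‖f a‖) ^ p := by
    rw [← Finset.prod_coe_sort, ENNReal.ofReal_prod_of_nonneg fun _ _ => norm_nonneg _,
      ← ENNReal.prod_rpow_of_nonneg hp0.le]
    refine Finset.prod_congr rfl fun a _ => ?_
    rw [ofReal_norm, ← flE_coeff, flE]
    refine tsum_congr fun k => ?_
    rw [show F a.1 k = ‖(f a).coeff k‖ₑ from dif_pos a.2]
  rw [e2, ← ENNReal.mul_rpow_of_nonneg _ _ hp0.le, ← ENNReal.ofReal_mul hB] at h
  simpa only [e1] using h

theorem TreeBound.summable (hT : TreeBound s p T c B) (hB : 0 ≤ B)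
    (f : {a // a ∈ T.terminal} → FL s p) (m : Freq) :
    Summable fun n : T.indexFn m => ‖c n.1 * nodeProd T n.1 f‖ := by
  have hp0 : 0 < p := by linarith [hp.out]
  have h := (ENNReal.le_tsum m).trans (hT.tsum_le hB f)
  have h1 : ENNReal.ofReal (jap m ^ s) *
      ∑' n : T.indexFn m, ‖c n.1 * nodeProd T n.1 f‖ₑ ≠ ⊤ := by
    intro h2
    rw [h2, ENNReal.top_rpow_of_pos hp0, top_le_iff] at h
    exact ENNReal.rpow_ne_top_of_nonneg hp0.le ENNReal.ofReal_ne_top h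
  have h2 : ∑' n : T.indexFn m, ‖c n.1 * nodeProd T n.1 f‖ₑ ≠ ⊤ := by
    intro h3
    rw [h3, ENNReal.mul_top (by simpa using Real.rpow_pos_of_pos (jap_pos m) s)] at h1
    exact h1 rfl
  refine (ENNReal.summable_toReal h2).congr fun n => ?_
  rw [toReal_enorm]

theorem TreeBound.exists_coeff (hT : TreeBound s p T c B) (hB : 0 ≤ B)
    (f : {a // a ∈ T.terminal} → FL s p) : ∃ g : FL s p,
      (g.coeff = fun m => ∑' n : T.indexFn m, c n.1 * nodeProd T n.1 f) ∧
        ‖g‖ ≤ B * ∏ a, ‖f a‖ := by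
  have hp0 : 0 < p := by linarith [hp.out]
  apply exists_coeff_eq_of_le (mul_nonneg hB (Finset.prod_nonneg fun _ _ => norm_nonneg _))
  refine le_trans ?_ (hT.tsum_le hB f)
  apply ENNReal.tsum_le_tsum
  intro m
  apply ENNReal.rpow_le_rpow _ hp0.le
  gcongr
  exact enorm_tsum_le_tsum_enorm

/-- The multilinear operator of a tree. -/
theorem TreeBound.exists_operator (hT : TreeBound s p T c B) (hB : 0 ≤ B) :
    ∃ M : ContinuousMultilinearMap ℝ (fun _ : {a // a ∈ T.terminal} => FL s p) (FL s p),
      ‖M‖ ≤ B ∧ ∀ f m, (M f).coeff m = ∑' n : T.indexFn m, c n.1 * nodeProd T n.1 f := by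
  choose g hg hgB using hT.exists_coeff hB
  have hs : ∀ f m, Summable fun n : T.indexFn m => c n.1 * nodeProd T n.1 f :=
    fun f m => (hT.summable hB f m).of_norm
  have hg' : ∀ f m, (g f).coeff m = ∑' n : T.indexFn m, c n.1 * nodeProd T n.1 f :=
    fun f m => congrFun (hg f) m
  let M : MultilinearMap ℝ (fun _ : {a // a ∈ T.terminal} => FL s p) (FL s p) :=
    { toFun := g
      map_update_add' := fun f i x y => by
        refine FL.coeff_injective (funext fun m => ?_)
        rw [FL.coeff_add, hg', hg', hg', ← (hs _ m).tsum_add (hs _ m)]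
        refine tsum_congr fun n => ?_
        rw [MultilinearMap.map_update_add, mul_add]
      map_update_smul' := fun f i r x => by
        refine FL.coeff_injective (funext fun m => ?_)
        rw [FL.coeff_smul, hg', hg', ← tsum_mul_left]
        refine tsum_congr fun n => ?_
        rw [MultilinearMap.map_update_smul, Complex.real_smul]
        ring }
  exact ⟨M.mkContinuous B hgB, MultilinearMap.mkContinuous_norm_le M hB hgB, hg'⟩

end TreeOperators

/-! ### Gauge invariance -/

/-- The leaf phases add up to the signed sum of |n_a|₋² over the leaves, and the accumulated
modulation is |m|₋² minus that sum. Only the phase of the root survives, and it is cancelled by the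
outer propagator: the operators in the original variable are independent of t. -/
theorem prod_star_propagator {j : ℕ} (T : OrderedTree (j + 1)) (t : ℝ) (v : Node → Freq → ℂ)
    {n : Node → Freq} {m : Freq} (hn : n ∈ T.indexFn m) :
    T.phase t n * ∏ a ∈ T.terminal, a.star (propagator (-t) (v a) (n a)) =
      Complex.exp (Complex.I * t * (hsq m : ℂ)) * ∏ a ∈ T.terminal, a.star (v a (n a)) := by
  have h1 : ∀ a : Node, a.star (propagator (-t) (v a) (n a)) =
      Complex.exp (Complex.I * t * ((a.sign * hsq (n a) : ℤ) : ℂ)) * a.star (v a (n a)) := by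
    intro a
    rw [propagator, Node.star_mul, Node.star_exp]
  simp only [h1]
  rw [Finset.prod_mul_distrib, ← Complex.exp_sum, ← mul_assoc, OrderedTree.phase, ← Complex.exp_add,
    OrderedTree.modSum_last, T.sum_sign_mul_modulation, hn.2.1, ← Finset.mul_sum, ← mul_add]
  congr 3
  push_cast
  ring

theorem calR1_propagator (t : ℝ) (f : Freq → ℂ) :
    calR1 (propagator t f) = propagator t (calR1 f) := by
  have h : ∀ m, propagator t f m * (starRingEnd ℂ) (propagator t f m) =
      f m * (starRingEnd ℂ) (f m) := fun m => by
    rw [Complex.mul_conj, Complex.mul_conj, Complex.normSq_eq_norm_sq, Complex.normSq_eq_norm_sq,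
      norm_propagator]
  funext n
  rw [propagator, calR1, calR1]
  simp only [h]
  rw [propagator]
  ring


/-! ### Coefficients of the multilinear operators -/

section Coefficients

variable {K p : ℝ} {j : ℕ} (T : OrderedTree (j + 1))

open Classical in
/-- The coefficient of `𝒩₀` without its phase. -/
noncomputable def coefN0 (K p : ℝ) {j : ℕ} (T : OrderedTree (j + 1)) (n : Node → Freq) : ℂ :=
  if ∀ k, ¬ T.Near K p n k then (T.sgn : ℂ) / ∏ k, (T.modSum n k : ℂ) else 0

open Classical in
/-- The coefficient of `𝒩₁` without its phase. -/
noncomputable def coefN1 (K p : ℝ) {j : ℕ} (T : OrderedTree (j + 1)) (n : Node → Freq) : ℂ :=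
  if (∀ k : Fin j, ¬ T.Near K p n k.castSucc) ∧ T.Near K p n (Fin.last j) then
    Complex.I * (T.sgn : ℂ) / ∏ k : Fin j, (T.modSum n k.castSucc : ℂ) else 0

theorem termN0_eq (t : ℝ) (v : Freq → ℂ) (n : Node → Freq) : termN0 K p T t v n =
    coefN0 K p T n * (T.phase t n * ∏ a ∈ T.terminal, a.star (v (n a))) := by
  unfold termN0 coefN0
  split_ifs
  · ring
  · simp

theorem termN1_eq (t : ℝ) (v : Freq → ℂ) (n : Node → Freq) : termN1 K p T t v n =
    coefN1 K p T n * (T.phase t n * ∏ a ∈ T.terminal, a.star (v (n a))) := by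
  unfold termN1 coefN1
  split_ifs
  · ring
  · simp

/-- The operators ℛ of higher generation are 𝒩₀ with ℛ⁽¹⁾ inserted at one leaf, so their estimates
need no separate work. -/
theorem termR_eq (t : ℝ) (v : Freq → ℂ) (n : Node → Freq) : termR K p T t v n =
    -∑ b ∈ T.terminal, coefN0 K p T n * (T.phase t n * ∏ a ∈ T.terminal,
      a.star (Function.update (fun _ : Node => v) b (calR1 v) a (n a))) := by
  have h : ∀ b ∈ T.terminal, ∏ a ∈ T.terminal,
      a.star (Function.update (fun _ : Node => v) b (calR1 v) a (n a)) =
      b.star (calR1 v (n b)) * ∏ a ∈ T.terminal.erase b, a.star (v (n a)) := by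
    intro b hb
    rw [← Finset.mul_prod_erase _ _ hb, Function.update_self]
    congr 1
    refine Finset.prod_congr rfl fun a ha => ?_
    rw [Function.update_of_ne (Finset.ne_of_mem_erase ha)]
  rw [Finset.sum_congr rfl fun b hb => by rw [h b hb]]
  unfold termR coefN0
  split_ifs
  · rw [Finset.mul_sum, neg_inj]
    refine Finset.sum_congr rfl fun b _ => ?_
    ring
  · simp

theorem norm_sgn : ‖(T.sgn : ℂ)‖ = 1 := by
  have h : ∀ a : Node, ‖(a.sign : ℂ)‖ = 1 := fun a => by simp [Node.sign]
  rw [OrderedTree.sgn]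
  push_cast
  rw [norm_mul, norm_prod, Finset.prod_congr rfl fun k _ => h _]
  simp

theorem farFactor_modSum {n : Node → Freq} {k : Fin (j + 1)} (h : ¬ T.Near K p n k) :
    farFactor K p k (T.modSum n k) = ENNReal.ofReal ‖(T.modSum n k : ℂ)‖⁻¹ := by
  have h' : ¬ |(T.modSum n k : ℝ)| ≤ thr K p k := h
  rw [farFactor, if_neg h', Complex.norm_intCast]

theorem enorm_coefN0_le (n : Node → Freq) :
    ‖coefN0 K p T n‖ₑ ≤ ∏ k : Fin (j + 1), farFactor K p k (T.modSum n k) := by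
  unfold coefN0
  split_ifs with h
  · rw [← ofReal_norm, norm_div, norm_sgn, norm_prod, one_div, ← Finset.prod_inv_distrib,
      ENNReal.ofReal_prod_of_nonneg fun _ _ => by positivity]
    exact (Finset.prod_congr rfl fun k _ => (farFactor_modSum T (h k)).symm).le
  · simp

theorem enorm_coefN1_le (n : Node → Freq) : ‖coefN1 K p T n‖ₑ ≤ ∏ k : Fin (j + 1),
    (if (k : ℕ) < j then farFactor K p k (T.modSum n k) else nearFactor K p k (T.modSum n k)) := by
  unfold coefN1
  split_ifs with h
  · rw [← ofReal_norm, norm_div, norm_mul, norm_sgn, Complex.norm_I, norm_prod, one_mul, one_div,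
      ← Finset.prod_inv_distrib, ENNReal.ofReal_prod_of_nonneg fun _ _ => by positivity,
      Fin.prod_univ_castSucc]
    have e : (if ((Fin.last j : Fin (j + 1)) : ℕ) < j then
        farFactor K p (Fin.last j : Fin (j + 1)) (T.modSum n (Fin.last j)) else
        nearFactor K p (Fin.last j : Fin (j + 1)) (T.modSum n (Fin.last j))) = 1 := by
      rw [if_neg (by simp), nearFactor, if_pos]
      exact h.2
    rw [e, mul_one]
    refine (Finset.prod_congr rfl fun k _ => ?_).le
    rw [if_pos (by simp), farFactor_modSum T (h.1 k)]
  · simp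

end Coefficients

/-! ### Sums over trees -/

section SumOperators

variable {s p : ℝ} [hp : Fact (1 < p)] {j : ℕ}

theorem nodeProd_ite {J : ℕ} (T : OrderedTree J) (n : Node → Freq) (v : Node → FL s p) :
    nodeProd T n (fun a => v a.1) = ∏ a ∈ T.terminal, a.star ((v a).coeff (n a)) := by
  rw [nodeProd_apply]
  exact Finset.prod_coe_sort T.terminal fun a => a.star ((v a).coeff (n a))

/-- All trees of generation j + 1 have 2j + 3 leaves. Enumerating these lets the trees be added as
one multilinear map; the enumeration is irrelevant on the diagonal and for the sum over all
insertions, which are the only values recorded. -/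
theorem exists_sum_operator {c : OrderedTree (j + 1) → (Node → Freq) → ℂ} {B : ℝ} (hB : 0 ≤ B)
    (hT : ∀ T, TreeBound s p T (c T) B) :
    ∃ A : ContinuousMultilinearMap ℝ (fun _ : Fin (2 * j + 3) => FL s p) (FL s p),
      ‖A‖ ≤ (3 ^ (j + 1) * (j + 1).factorial : ℝ) * B ∧
      (∀ f m, (A fun _ => f).coeff m = ∑ T, ∑' n : T.indexFn m,
        c T n.1 * ∏ a ∈ T.terminal, a.star (f.coeff (n.1 a))) ∧
      ∀ f g m, (∑ b, A (Function.update (fun _ => f) b g)).coeff m =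
        ∑ T : OrderedTree (j + 1), ∑ b ∈ T.terminal, ∑' n : T.indexFn m, c T n.1 *
          ∏ a ∈ T.terminal,
            a.star (Function.update (fun _ : Node => f.coeff) b g.coeff a (n.1 a)) := by
  choose M hM hMc using fun T => (hT T).exists_operator hB
  have hcard : ∀ T : OrderedTree (j + 1), T.terminal.card = 2 * j + 3 := fun T => by
    rw [T.card_terminal]; ring
  let e : ∀ T : OrderedTree (j + 1), {a // a ∈ T.terminal} ≃ Fin (2 * j + 3) :=
    fun T => Finset.equivFinOfCardEq (hcard T)
  have happ : ∀ v, (∑ T, (M T).domDomCongr (e T)) v = ∑ T, M T fun a => v (e T a) := by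
    intro v
    rw [sum_apply]
    rfl
  refine ⟨∑ T, (M T).domDomCongr (e T), ?_, fun f m => ?_, fun f g m => ?_⟩
  · refine (norm_sum_le _ _).trans ?_
    calc ∑ T, ‖(M T).domDomCongr (e T)‖ ≤ ∑ _T : OrderedTree (j + 1), B := by
          refine Finset.sum_le_sum fun T _ => ?_
          rw [ContinuousMultilinearMap.norm_domDomCongr]
          exact hM T
      _ ≤ _ := by
          rw [Finset.sum_const, nsmul_eq_mul]
          refine mul_le_mul_of_nonneg_right ?_ hB
          exact_mod_cast OrderedTree.card_le (j + 1)
  · rw [happ, FL.coeff_sum]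
    refine Finset.sum_congr rfl fun T _ => ?_
    rw [hMc]
    refine tsum_congr fun n => ?_
    rw [nodeProd_ite T n.1 (fun _ => f)]
  · simp only [happ]
    rw [Finset.sum_comm, FL.coeff_sum]
    refine Finset.sum_congr rfl fun T _ => ?_
    rw [← Finset.sum_coe_sort T.terminal, ← Equiv.sum_comp (e T)
      (fun b => M T fun a => Function.update (fun _ => f) b g (e T a)), FL.coeff_sum]
    refine Finset.sum_congr rfl fun b _ => ?_
    rw [hMc]
    refine tsum_congr fun n => ?_
    have h1 : (fun a : {a // a ∈ T.terminal} =>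
        Function.update (fun _ => f) ((e T) b) g ((e T) a)) =
        fun a => Function.update (fun _ : Node => f) b.1 g a.1 := by
      funext a
      by_cases hab : a = b
      · rw [hab, Function.update_self, Function.update_self]
      · rw [Function.update_of_ne ((e T).injective.ne hab),
          Function.update_of_ne (fun h => hab (Subtype.ext h))]
    rw [h1, nodeProd_ite T n.1 (Function.update (fun _ : Node => f) b.1 g)]
    congr 1
    refine Finset.prod_congr rfl fun a _ => ?_
    by_cases hab : a = b.1
    · rw [hab, Function.update_self, Function.update_self]
    · rw [Function.update_of_ne hab, Function.update_of_ne hab]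

theorem propagator_exp_cancel (t : ℝ) (m : Freq) (z : ℂ) :
    Complex.exp (-(Complex.I * t * (hsq m : ℂ))) * (Complex.exp (Complex.I * t * (hsq m : ℂ)) * z)
      = z := by
  rw [← mul_assoc, ← Complex.exp_add, neg_add_cancel, Complex.exp_zero, one_mul]

theorem propagator_sum_tsum {c : OrderedTree (j + 1) → (Node → Freq) → ℂ} (t : ℝ)
    (v : Node → Freq → ℂ) (m : Freq) (S : OrderedTree (j + 1) → ℂ)
    (hS : ∀ T, S T = ∑' n : T.indexFn m, c T n.1 * (T.phase t n.1 *
      ∏ a ∈ T.terminal, a.star (propagator (-t) (v a) (n.1 a)))) :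
    Complex.exp (-(Complex.I * t * (hsq m : ℂ))) * ∑ T, S T =
    ∑ T : OrderedTree (j + 1), ∑' n : T.indexFn m,
      c T n.1 * ∏ a ∈ T.terminal, a.star (v a (n.1 a)) := by
  rw [Finset.mul_sum]
  refine Finset.sum_congr rfl fun T _ => ?_
  rw [hS, ← tsum_mul_left]
  refine tsum_congr fun n => ?_
  rw [prod_star_propagator T t v n.2, mul_left_comm, propagator_exp_cancel]

end SumOperators


/-! ### ### The operators of the normal form equation as bounded multilinear maps -/

section NormalFormData

variable {s p : ℝ} [hp : Fact (1 < p)]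

/-- The trilinear operator behind `ℛ⁽¹⁾`. -/
noncomputable def resonantForm (f : Fin 3 → Freq → ℂ) (n : Freq) : ℂ :=
  Complex.I * (-(f 0 n * (starRingEnd ℂ) (f 1 n) * f 2 n)
    + 2 * (∑' m, f 0 m * (starRingEnd ℂ) (f 1 m)) * f 2 n)

/-- Cauchy–Schwarz and the embedding into ℓ² bound both the mass term and the pointwise cubic term
by a multiple of the last argument. Real multilinearity is all that the conjugation allows. -/
theorem exists_resonant (hs : 1 - 1 / p < s) :
    ∃ R : ContinuousMultilinearMap ℝ (fun _ : Fin 3 => FL s p) (FL s p),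
      ∀ f, (R fun _ => f).coeff = calR1 f.coeff := by
  obtain ⟨C, hC, h⟩ := exists_l2_bound (s := s) (p := p) hs
  have hsq : ∀ x : ℝ, 0 ≤ x → ∀ f : FL s p, x ≤ C * ‖f‖ ^ 2 → x ^ (1 / 2 : ℝ) ≤ √C * ‖f‖ := by
    intro x _ f hx
    rw [← Real.sqrt_eq_rpow]
    refine (Real.sqrt_le_sqrt hx).trans ?_
    rw [Real.sqrt_mul hC, Real.sqrt_sq (norm_nonneg _)]
  have hpt : ∀ (f : FL s p) n, ‖f.coeff n‖ ≤ √C * ‖f‖ := by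
    intro f n
    have h1 : ‖f.coeff n‖ ^ 2 ≤ C * ‖f‖ ^ 2 :=
      ((h f).1.le_tsum n fun _ _ => sq_nonneg _).trans (h f).2
    have h2 := hsq _ (sq_nonneg _) f h1
    rwa [← Real.sqrt_eq_rpow, Real.sqrt_sq (norm_nonneg _)] at h2
  have hconj : (2 : ℝ).HolderConjugate 2 := by
    rw [Real.holderConjugate_iff]; norm_num
  have hr : ∀ x : ℝ, x ^ (2 : ℝ) = x ^ 2 := fun x => by
    rw [← Real.rpow_natCast]; norm_num
  have hip : ∀ f g : FL s p, Summable (fun m => ‖f.coeff m * (starRingEnd ℂ) (g.coeff m)‖) ∧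
      ‖∑' m, f.coeff m * (starRingEnd ℂ) (g.coeff m)‖ ≤ C * ‖f‖ * ‖g‖ := by
    intro f g
    have h1 := Real.summable_and_inner_le_Lp_mul_Lq_tsum_of_nonneg hconj
      (f := fun m => ‖f.coeff m‖) (g := fun m => ‖g.coeff m‖) (fun _ => norm_nonneg _)
      (fun _ => norm_nonneg _) (by simpa only [hr] using (h f).1) (by simpa only [hr] using (h g).1)
    simp only [hr] at h1
    have h2 : Summable (fun m => ‖f.coeff m * (starRingEnd ℂ) (g.coeff m)‖) := by
      simpa only [norm_mul, RCLike.norm_conj] using h1.1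
    refine ⟨h2, (norm_tsum_le_tsum_norm h2).trans ?_⟩
    simp only [norm_mul, RCLike.norm_conj]
    refine h1.2.trans ?_
    calc _ ≤ (√C * ‖f‖) * (√C * ‖g‖) := by
          refine mul_le_mul (hsq _ (tsum_nonneg fun _ => sq_nonneg _) f (h f).2)
            (hsq _ (tsum_nonneg fun _ => sq_nonneg _) g (h g).2) ?_ (by positivity)
          exact Real.rpow_nonneg (tsum_nonneg fun _ => sq_nonneg _) _
      _ = (√C * √C) * ‖f‖ * ‖g‖ := by ring
      _ = _ := by rw [Real.mul_self_sqrt hC]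
  have hbound : ∀ f : Fin 3 → FL s p, ∃ g : FL s p,
      (g.coeff = resonantForm fun i => (f i).coeff) ∧ ‖g‖ ≤ 3 * C * ∏ i, ‖f i‖ := by
    intro f
    have h1 := exists_coeff_eq_of_norm_le (s := s) (p := p)
      (g := resonantForm fun i => (f i).coeff) (c := 3 * C * ‖f 0‖ * ‖f 1‖) (by positivity) (f 2)
      (fun n => by
        rw [resonantForm, norm_mul, Complex.norm_I, one_mul]
        have h2 : ‖(f 0).coeff n * (starRingEnd ℂ) ((f 1).coeff n) * (f 2).coeff n‖ ≤
            C * ‖f 0‖ * ‖f 1‖ * ‖(f 2).coeff n‖ := by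
          rw [norm_mul, norm_mul, RCLike.norm_conj]
          refine mul_le_mul_of_nonneg_right ?_ (norm_nonneg _)
          calc _ ≤ (√C * ‖f 0‖) * (√C * ‖f 1‖) :=
                mul_le_mul (hpt _ n) (hpt _ n) (norm_nonneg _) (by positivity)
            _ = (√C * √C) * ‖f 0‖ * ‖f 1‖ := by ring
            _ = _ := by rw [Real.mul_self_sqrt hC]
        have h3 : ‖2 * (∑' m, (f 0).coeff m * (starRingEnd ℂ) ((f 1).coeff m)) *
            (f 2).coeff n‖ ≤ 2 * (C * ‖f 0‖ * ‖f 1‖) * ‖(f 2).coeff n‖ := by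
          rw [norm_mul, norm_mul, Complex.norm_ofNat]
          have := (hip (f 0) (f 1)).2
          gcongr
        refine (norm_add_le _ _).trans ?_
        rw [norm_neg]
        linarith)
    obtain ⟨g, hg, hgn⟩ := h1
    refine ⟨g, hg, hgn.trans (le_of_eq ?_)⟩
    rw [Fin.prod_univ_three]; ring
  choose g hg hgB using hbound
  have hgc : ∀ f n, (g f).coeff n = resonantForm (fun i => (f i).coeff) n :=
    fun f n => congrFun (hg f) n
  have hsum : ∀ f g : FL s p, Summable (fun m => f.coeff m * (starRingEnd ℂ) (g.coeff m)) :=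
    fun f g => (hip f g).1.of_norm
  let M : MultilinearMap ℝ (fun _ : Fin 3 => FL s p) (FL s p) := MultilinearMap.mk' g
    (fun f i x y => by
      refine FL.coeff_injective (funext fun n => ?_)
      rw [FL.coeff_add, hgc, hgc, hgc]
      fin_cases i
      · simp only [resonantForm, Fin.zero_eta, Function.update_self, ne_eq, one_ne_zero,
          not_false_eq_true, Function.update_of_ne, Fin.reduceEq, FL.coeff_add, add_mul]
        rw [(hsum _ _).tsum_add (hsum _ _)]
        ring
      · simp only [resonantForm, Fin.mk_one, Function.update_self, ne_eq, zero_ne_one,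
          not_false_eq_true, Function.update_of_ne, Fin.reduceEq, FL.coeff_add, map_add, mul_add]
        rw [(hsum _ _).tsum_add (hsum _ _)]
        ring
      · simp only [resonantForm, Fin.reduceFinMk, Function.update_self, ne_eq,
          not_false_eq_true, Function.update_of_ne, Fin.reduceEq, FL.coeff_add]
        ring)
    (fun f i r x => by
      refine FL.coeff_injective (funext fun n => ?_)
      rw [FL.coeff_smul, hgc, hgc]
      fin_cases i
      · simp only [resonantForm, Fin.zero_eta, Function.update_self, ne_eq, one_ne_zero,
          not_false_eq_true, Function.update_of_ne, Fin.reduceEq, FL.coeff_smul, mul_assoc,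
          tsum_mul_left]
        ring
      · simp only [resonantForm, Fin.mk_one, Function.update_self, ne_eq, zero_ne_one,
          not_false_eq_true, Function.update_of_ne, Fin.reduceEq, FL.coeff_smul, map_mul,
          Complex.conj_ofReal, mul_left_comm _ (r : ℂ), tsum_mul_left]
        ring
      · simp only [resonantForm, Fin.reduceFinMk, Function.update_self, ne_eq,
          not_false_eq_true, Function.update_of_ne, Fin.reduceEq, FL.coeff_smul]
        ring)
  exact ⟨M.mkContinuous (3 * C) hgB, fun f => hg _⟩

/-- The multilinear operators of the normal form equation in `FL^{s,p}`, with bounds. -/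
structure NormalFormData (s p K D D' : ℝ) [Fact (1 < p)] where
  N0 : ∀ j : ℕ, ContinuousMultilinearMap ℝ (fun _ : Fin (2 * j + 3) => FL s p) (FL s p)
  N1 : ∀ j : ℕ, ContinuousMultilinearMap ℝ (fun _ : Fin (2 * j + 3) => FL s p) (FL s p)
  R1 : ContinuousMultilinearMap ℝ (fun _ : Fin 3 => FL s p) (FL s p)
  norm_N0 : ∀ j, ‖N0 j‖ ≤ D ^ (j + 1) / ((j + 1).factorial : ℝ)
  norm_N1 : ∀ j, ‖N1 j‖ ≤ D' ^ (j + 1) / ((j + 1).factorial : ℝ)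
  coeff_R1 : ∀ f, (R1 fun _ => f).coeff = calR1 f.coeff
  coeff_N0 : ∀ j t f, (N0 j fun _ => f).coeff = frakN0 K p j t f.coeff
  coeff_N1 : ∀ j t f, (N1 j fun _ => f).coeff = frakN1 K p j t f.coeff
  coeff_R : ∀ j t f, (-∑ b, N0 j (Function.update (fun _ => f) b (R1 fun _ => f))).coeff =
    frakR K p (j + 1) t f.coeff
  summable_N0 : ∀ {j} (T : OrderedTree (j + 1)) m t (f : FL s p),
    Summable fun n : T.indexFn m => ‖termN0 K p T t (propagator (-t) f.coeff) n‖
  summable_N1 : ∀ {j} (T : OrderedTree (j + 1)) m t (f : FL s p),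
    Summable fun n : T.indexFn m => ‖termN1 K p T t (propagator (-t) f.coeff) n‖
  summable_R : ∀ {j} (T : OrderedTree (j + 1)) m t (f : FL s p),
    Summable fun n : T.indexFn m => ‖termR K p T t (propagator (-t) f.coeff) n‖

theorem TreeBound.of_prod_le {C : ℝ≥0∞} (hC : ∀ {J : ℕ} (T : OrderedTree J) (ψ : ℕ → ℤ → ℝ≥0∞)
      (F : Node → Freq → ℝ≥0∞),
      ∑' m, (ENNReal.ofReal (jap m ^ s) * ∑' n : T.indexFn m,
        (∏ k : Fin J, ψ k (T.modSum n k)) * ∏ x ∈ T.terminal, F x (n.1 x)) ^ p ≤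
      (C ^ J * ∏ k ∈ Finset.range J, (∑' τ, ψ k τ ^ p.conjExponent) ^ (1 / p.conjExponent)) ^ p *
        ∏ x ∈ T.terminal, ∑' k, (ENNReal.ofReal (jap k ^ s) * F x k) ^ p)
    {J : ℕ} {T : OrderedTree J} {c : (Node → Freq) → ℂ} {B : ℝ} (ψ : ℕ → ℤ → ℝ≥0∞)
    (hc : ∀ n, ‖c n‖ₑ ≤ ∏ k : Fin J, ψ k (T.modSum n k))
    (hB : C ^ J * ∏ k ∈ Finset.range J, (∑' τ, ψ k τ ^ p.conjExponent) ^ (1 / p.conjExponent) ≤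
      ENNReal.ofReal B) : TreeBound s p T c B := by
  have hp0 : 0 < p := by linarith [hp.out]
  intro F
  refine le_trans ?_ ((hC T ψ F).trans (mul_le_mul' (ENNReal.rpow_le_rpow hB hp0.le) le_rfl))
  refine ENNReal.tsum_le_tsum fun m => ENNReal.rpow_le_rpow ?_ hp0.le
  refine mul_le_mul' le_rfl (ENNReal.tsum_le_tsum fun n => ?_)
  exact mul_le_mul' (hc n) le_rfl

theorem norm_term_propagator {j : ℕ} (T : OrderedTree (j + 1)) (c : ℂ) (t : ℝ)
    (v : Node → FL s p) {m : Freq} {n : Node → Freq} (hn : n ∈ T.indexFn m) :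
    ‖c * (T.phase t n * ∏ a ∈ T.terminal, a.star (propagator (-t) (v a).coeff (n a)))‖ =
      ‖c * nodeProd T n fun a => v a.1‖ := by
  rw [prod_star_propagator T t (fun a => (v a).coeff) hn, nodeProd_ite, norm_mul, norm_mul, norm_mul,
    show Complex.I * t * (hsq m : ℂ) = ((t * hsq m : ℝ) : ℂ) * Complex.I by push_cast; ring,
    Complex.norm_exp_ofReal_mul_I, one_mul]

/-- The order of the quantifiers matters: `D` does not depend on K, so the bound for 𝔑₀ becomes
small as K grows, whereas `D'` for 𝔑₁ may depend on K. A tree bound X^{j+1}/((j+1)!)² times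
3^{j+1}(j+1)! trees gives (3X)^{j+1}/(j+1)!. -/
theorem exists_normalFormData (hs : 1 - 1 / p < s) : ∃ D : ℝ, 0 ≤ D ∧ ∀ K : ℝ, 1 ≤ K →
    ∃ D' : ℝ, 0 ≤ D' ∧ Nonempty (NormalFormData s p K (D * (K ^ 2)⁻¹) D') := by
  obtain ⟨C, hCt, hC⟩ := exists_tree_bound hp.out hs
  obtain ⟨D, hD, hfar⟩ := exists_far_bound hp.out hCt
  obtain ⟨R, hR⟩ := exists_resonant (s := s) (p := p) hs
  refine ⟨3 * D, by positivity, fun K hK => ?_⟩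
  obtain ⟨E, hE, hnear⟩ := exists_near_bound hp.out hCt hK
  refine ⟨12 * E, by positivity, ?_⟩
  have hK0 : 0 < K := by linarith
  have hB0 : ∀ j : ℕ, 0 ≤ (D * (K ^ 2)⁻¹) ^ (j + 1) / ((j + 1).factorial : ℝ) ^ 2 :=
    fun j => by positivity
  have hB1 : ∀ j : ℕ, 0 ≤ E ^ (j + 1) / (j.factorial : ℝ) ^ 2 := fun j => by positivity
  have hT0 : ∀ {j : ℕ} (T : OrderedTree (j + 1)), TreeBound s p T (coefN0 K p T)
      ((D * (K ^ 2)⁻¹) ^ (j + 1) / ((j + 1).factorial : ℝ) ^ 2) := fun {j} T =>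
    TreeBound.of_prod_le hC (farFactor K p) (enorm_coefN0_le T) (hfar K hK (j + 1))
  have hT1 : ∀ {j : ℕ} (T : OrderedTree (j + 1)), TreeBound s p T (coefN1 K p T)
      (E ^ (j + 1) / (j.factorial : ℝ) ^ 2) := fun {j} T =>
    TreeBound.of_prod_le hC (fun k τ => if k < j then farFactor K p k τ else nearFactor K p k τ)
      (enorm_coefN1_le T) (hnear j)
  choose A hA hAc hAu using fun j => exists_sum_operator (hB0 j) (fun T => hT0 T)
  choose B hB hBc _ using fun j => exists_sum_operator (hB1 j) (fun T => hT1 T)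
  have hupd : ∀ (f : FL s p) (b : Node) (t : ℝ),
      Function.update (fun _ : Node => propagator (-t) f.coeff) b
        (calR1 (propagator (-t) f.coeff)) = fun a => propagator (-t)
          (Function.update (fun _ : Node => f) b (R fun _ => f) a).coeff := by
    intro f b t
    funext a
    by_cases hab : a = b
    · rw [hab, Function.update_self, Function.update_self, calR1_propagator, hR]
    · rw [Function.update_of_ne hab, Function.update_of_ne hab]
  refine ⟨⟨A, B, R, fun j => (hA j).trans (le_of_eq ?_), fun j => (hB j).trans ?_, hR,
    fun j t f => ?_, fun j t f => ?_, fun j t f => ?_, fun T m t f => ?_, fun T m t f => ?_,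
    fun T m t f => ?_⟩⟩
  · have : ((j + 1).factorial : ℝ) ≠ 0 := by positivity
    field_simp
    ring
  · rw [Nat.factorial_succ]
    have h0 : (0 : ℝ) < j.factorial := by positivity
    -- The far generations give only 1/(j!)² here, as the last generation is near. The missing
    -- factor (j+1)² is absorbed by 4^{j+1}, whence 12 = 3 · 4.
    have h1 : ((j : ℝ) + 1) ^ 2 ≤ 4 ^ (j + 1) := by
      have h2 : ((j : ℝ) + 1) ≤ 2 ^ (j + 1) := by exact_mod_cast Nat.lt_two_pow_self.le
      calc ((j : ℝ) + 1) ^ 2 ≤ (2 ^ (j + 1)) ^ 2 := by gcongr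
        _ = 4 ^ (j + 1) := by rw [← pow_mul, mul_comm, pow_mul]; norm_num
    rw [le_div_iff₀ (by positivity)]
    push_cast
    calc _ = (3 * E) ^ (j + 1) * ((j : ℝ) + 1) ^ 2 := by field_simp; ring
      _ ≤ (3 * E) ^ (j + 1) * 4 ^ (j + 1) := by gcongr
      _ = _ := by rw [← mul_pow]; ring
  · funext m
    rw [hAc, frakN0, propagator, calN0]
    exact (propagator_sum_tsum t (fun _ => f.coeff) m _
      fun T => tsum_congr fun n => termN0_eq T t _ _).symm
  · funext m
    rw [hBc, frakN1, propagator, calN1]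
    exact (propagator_sum_tsum t (fun _ => f.coeff) m _
      fun T => tsum_congr fun n => termN1_eq T t _ _).symm
  · funext m
    rw [FL.coeff_neg, hAu, frakR, propagator, calR]
    have hsm : ∀ (T : OrderedTree (j + 1)) (b : Node), Summable fun n : T.indexFn m =>
        coefN0 K p T n.1 * (T.phase t n.1 * ∏ a ∈ T.terminal,
          a.star (propagator (-t) (Function.update (fun _ : Node => f) b (R fun _ => f) a).coeff
            (n.1 a))) := by
      intro T b
      refine Summable.of_norm (((hT0 T).summable (hB0 j) (fun a =>
        Function.update (fun _ : Node => f) b (R fun _ => f) a.1) m).congr fun n => ?_)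
      rw [norm_term_propagator T _ t _ n.2]
    have h1 : ∀ T : OrderedTree (j + 1), ∑' n : T.indexFn m,
        termR K p T t (propagator (-t) f.coeff) n.1 = -∑ b ∈ T.terminal, ∑' n : T.indexFn m,
        coefN0 K p T n.1 * (T.phase t n.1 * ∏ a ∈ T.terminal,
          a.star (propagator (-t) (Function.update (fun _ : Node => f) b (R fun _ => f) a).coeff
            (n.1 a))) := by
      intro T
      rw [← Summable.tsum_finsetSum fun b _ => hsm T b, ← tsum_neg]
      refine tsum_congr fun n => ?_
      rw [termR_eq]
      simp only [hupd]
    simp only [h1]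
    rw [Finset.sum_neg_distrib, mul_neg, neg_inj, Finset.mul_sum]
    refine Finset.sum_congr rfl fun T _ => ?_
    rw [Finset.mul_sum]
    refine Finset.sum_congr rfl fun b _ => ?_
    rw [← tsum_mul_left]
    refine tsum_congr fun n => ?_
    rw [prod_star_propagator T t _ n.2, mul_left_comm, propagator_exp_cancel]
    congr 1
    refine Finset.prod_congr rfl fun a _ => ?_
    by_cases hab : a = b
    · rw [hab, Function.update_self, Function.update_self]
    · rw [Function.update_of_ne hab, Function.update_of_ne hab]
  · refine ((hT0 T).summable (hB0 _) (fun _ => f) m).congr fun n => ?_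
    rw [termN0_eq, norm_term_propagator T _ t (fun _ => f) n.2]
  · refine ((hT1 T).summable (hB1 _) (fun _ => f) m).congr fun n => ?_
    rw [termN1_eq, norm_term_propagator T _ t (fun _ => f) n.2]
  · refine Summable.of_nonneg_of_le (fun _ => norm_nonneg _) (fun n => ?_)
      (summable_sum (s := T.terminal) fun b _ => (hT0 T).summable (hB0 _) (fun a =>
        Function.update (fun _ : Node => f) b (R fun _ => f) a.1) m)
    rw [termR_eq, norm_neg]
    refine (norm_sum_le _ _).trans (le_of_eq ?_)
    refine Finset.sum_congr rfl fun b _ => ?_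
    rw [hupd, norm_term_propagator T _ t _ n.2]

end NormalFormData


/-! ### Series of multilinear maps of odd degree -/

section OddSeries

variable {Y Z : Type*} [NormedAddCommGroup Y] [NormedSpace ℝ Y] [NormedAddCommGroup Z]
  [NormedSpace ℝ Z]

/-- A family of multilinear maps of the degrees `3, 5, 7, …`. -/
abbrev OddFamily (Y Z : Type*) [NormedAddCommGroup Y] [NormedSpace ℝ Y] [NormedAddCommGroup Z]
    [NormedSpace ℝ Z] : Type _ :=
  ∀ j : ℕ, ContinuousMultilinearMap ℝ (fun _ : Fin (2 * j + 3) => Y) Z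

/-- Factorial decay of an odd family. -/
def OddFamily.BoundedBy (A : OddFamily Y Z) (D : ℝ) : Prop :=
  ∀ j, ‖A j‖ ≤ D ^ (j + 1) / ((j + 1).factorial : ℝ)

/-- The sum of an odd family on the diagonal. -/
noncomputable def oddSum (A : OddFamily Y Z) (x : Y) : Z := ∑' j, A j fun _ => x

theorem hasSum_exp_sub_one (z : ℝ) :
    HasSum (fun j : ℕ => z ^ (j + 1) / ((j + 1).factorial : ℝ)) (Real.exp z - 1) := by
  have h := NormedSpace.expSeries_div_hasSum_exp z
  rw [← Real.exp_eq_exp_ℝ] at h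
  simpa using (hasSum_nat_add_iff' 1).mpr h

theorem OddFamily.BoundedBy.norm_apply_le {A : OddFamily Y Z} {D : ℝ} (hA : A.BoundedBy D) (j : ℕ)
    (x : Y) : ‖A j fun _ => x‖ ≤
      ‖x‖ * ((D * ‖x‖ ^ 2) ^ (j + 1) / ((j + 1).factorial : ℝ)) := by
  refine ((A j).le_opNorm _).trans ?_
  rw [Finset.prod_const, Finset.card_univ, Fintype.card_fin]
  calc _ ≤ D ^ (j + 1) / ((j + 1).factorial : ℝ) * ‖x‖ ^ (2 * j + 3) := by
        gcongr; exact hA j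
    _ = _ := by rw [mul_pow, ← pow_mul]; ring

theorem OddFamily.BoundedBy.summable {A : OddFamily Y Z} {D : ℝ} (hA : A.BoundedBy D) (x : Y) :
    Summable fun j => ‖A j fun _ => x‖ :=
  Summable.of_nonneg_of_le (fun _ => norm_nonneg _) (fun j => hA.norm_apply_le j x)
    ((hasSum_exp_sub_one _).summable.mul_left _)

theorem two_mul_add_three_le (j : ℕ) : (2 * (j : ℝ) + 3) ≤ 3 ^ (j + 1) := by
  induction j with
  | zero => norm_num
  | succ k ih =>
    rw [pow_succ]; push_cast
    have : (0 : ℝ) ≤ k := Nat.cast_nonneg k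
    linarith

/-- On the ball of radius r the diagonal of `A j` has Lipschitz constant (2j+3)‖A j‖r^{2j+2}. From
2j + 3 ≤ 3^{j+1} the sum is an exponential series without its constant term, hence small when Dr²
is. -/
theorem OddFamily.BoundedBy.norm_oddSum_sub_le [CompleteSpace Z] {A : OddFamily Y Z} {D : ℝ}
    (hA : A.BoundedBy D) (hD : 0 ≤ D) {r : ℝ} {x y : Y} (hx : ‖x‖ ≤ r) (hy : ‖y‖ ≤ r) :
    ‖oddSum A x - oddSum A y‖ ≤ (Real.exp (3 * D * r ^ 2) - 1) * ‖x - y‖ := by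
  have hr : 0 ≤ r := (norm_nonneg x).trans hx
  rw [oddSum, oddSum, ← (hA.summable x).of_norm.tsum_sub (hA.summable y).of_norm]
  refine tsum_of_norm_bounded ((hasSum_exp_sub_one (3 * D * r ^ 2)).mul_right ‖x - y‖) fun j => ?_
  refine ((A j).norm_image_sub_le _ _).trans ?_
  have e : ∀ z : Y, ‖fun _ : Fin (2 * j + 3) => z‖ = ‖z‖ := fun z => pi_norm_const z
  have e1 : ‖(fun _ : Fin (2 * j + 3) => x) - fun _ => y‖ = ‖x - y‖ := e (x - y)
  rw [e1, e, e, Fintype.card_fin]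
  refine mul_le_mul_of_nonneg_right ?_ (norm_nonneg _)
  have hm : max ‖x‖ ‖y‖ ≤ r := max_le hx hy
  have h0 : 0 ≤ max ‖x‖ ‖y‖ := (norm_nonneg x).trans (le_max_left _ _)
  calc ‖A j‖ * ((2 * j + 3 : ℕ) : ℝ) * max ‖x‖ ‖y‖ ^ (2 * j + 3 - 1)
      ≤ (D ^ (j + 1) / ((j + 1).factorial : ℝ)) * 3 ^ (j + 1) * r ^ (2 * j + 3 - 1) := by
        have h2 := two_mul_add_three_le j
        gcongr
        · exact hA j
        · push_cast; exact h2
    _ = _ := by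
        rw [show 2 * j + 3 - 1 = 2 * (j + 1) by omega, pow_mul, mul_pow, mul_pow]
        ring

theorem oddSum_zero (A : OddFamily Y Z) : oddSum A 0 = 0 := by
  have : ∀ j, (A j fun _ => (0 : Y)) = 0 := fun j => (A j).map_coord_zero 0 rfl
  simp [oddSum, this]

/-- The remainder after the cubic term is of fifth order, by e^z - 1 - z ≤ z² for 0 ≤ z ≤ 1. -/
theorem OddFamily.BoundedBy.norm_oddSum_sub_zero_le [CompleteSpace Z] {A : OddFamily Y Z} {D : ℝ}
    (hA : A.BoundedBy D) (hD : 0 ≤ D) {x : Y} (hx : D * ‖x‖ ^ 2 ≤ 1) :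
    ‖oddSum A x - A 0 fun _ => x‖ ≤ ‖x‖ * (D * ‖x‖ ^ 2) ^ 2 := by
  set z := D * ‖x‖ ^ 2 with hz
  have hz0 : 0 ≤ z := by positivity
  rw [oddSum, (hA.summable x).of_norm.tsum_eq_zero_add, add_sub_cancel_left]
  have h1 := (hasSum_nat_add_iff' 1).mpr (hasSum_exp_sub_one z)
  simp only [Finset.range_one, Finset.sum_singleton, zero_add, Nat.factorial_one, Nat.cast_one,
    div_one, pow_one] at h1
  have h2 : ‖∑' j, A (j + 1) fun _ => x‖ ≤ ‖x‖ * (Real.exp z - 1 - z) :=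
    tsum_of_norm_bounded (h1.mul_left ‖x‖) fun j => hA.norm_apply_le (j + 1) x
  refine h2.trans (mul_le_mul_of_nonneg_left ?_ (norm_nonneg _))
  have h3 := Real.norm_exp_sub_one_sub_id_le (x := z) (by rwa [Real.norm_of_nonneg hz0])
  rw [Real.norm_of_nonneg hz0] at h3
  exact (le_abs_self _).trans h3

/-- Filled up with zeros in the remaining degrees, the family is a power series of infinite radius
of convergence, so its sum is analytic. -/
theorem OddFamily.BoundedBy.contDiff_oddSum [CompleteSpace Z] {A : OddFamily Y Z} {D : ℝ}
    (hA : A.BoundedBy D) : ContDiff ℝ ∞ (oddSum A) := by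
  classical
  let q : FormalMultilinearSeries ℝ Y Z := fun n =>
    if h : ∃ j, 2 * j + 3 = n then (A h.choose).domDomCongr (finCongr h.choose_spec) else 0
  have hinj : Function.Injective fun j : ℕ => 2 * j + 3 := fun i j h => by
    simp only at h; omega
  have hq : ∀ j, ∃ e : Fin (2 * j + 3) ≃ Fin (2 * j + 3), q (2 * j + 3) = (A j).domDomCongr e := by
    intro j
    have h : ∃ i, 2 * i + 3 = 2 * j + 3 := ⟨j, rfl⟩
    have hc : h.choose = j := by have := h.choose_spec; omega
    have h1 : q (2 * j + 3) = (A h.choose).domDomCongr (finCongr h.choose_spec) := dif_pos h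
    rw [h1]
    generalize_proofs at *
    revert hc
    generalize h.choose = i at *
    intro hc
    subst hc
    exact ⟨_, rfl⟩
  have hqn : ∀ j, ‖q (2 * j + 3)‖ = ‖A j‖ := fun j => by
    obtain ⟨e, he⟩ := hq j
    rw [he, ContinuousMultilinearMap.norm_domDomCongr]
  have hqx : ∀ j x, (q (2 * j + 3) fun _ => x) = A j fun _ => x := fun j x => by
    obtain ⟨e, he⟩ := hq j
    rw [he]; rfl
  have hq0 : ∀ n, n ∉ Set.range (fun j : ℕ => 2 * j + 3) → q n = 0 := fun n hn =>
    dif_neg fun ⟨j, hj⟩ => hn ⟨j, hj⟩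
  have hrad : q.radius = ⊤ := by
    refine q.radius_eq_top_of_summable_norm fun r => ?_
    rw [← hinj.summable_iff (fun n hn => by rw [hq0 n hn, norm_zero, zero_mul])]
    refine Summable.of_nonneg_of_le (fun _ => mul_nonneg (norm_nonneg _) (pow_nonneg r.2 _))
      (fun j => ?_) ((hasSum_exp_sub_one (D * r ^ 2)).summable.mul_left (r : ℝ))
    simp only [Function.comp_apply, hqn]
    calc ‖A j‖ * (r : ℝ) ^ (2 * j + 3) ≤ D ^ (j + 1) / ((j + 1).factorial : ℝ) *
          (r : ℝ) ^ (2 * j + 3) := by gcongr; exact hA j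
      _ = _ := by rw [mul_pow, ← pow_mul]; ring
  have hball := q.hasFPowerSeriesOnBall (by rw [hrad]; exact ENNReal.zero_lt_top)
  have hsum : q.sum = oddSum A := by
    funext x
    rw [FormalMultilinearSeries.sum, oddSum, ← hinj.tsum_eq]
    · exact tsum_congr fun j => hqx j x
    · intro n hn
      by_contra hn'
      refine hn ?_
      change q n (fun _ => x) = 0
      rw [hq0 n hn']; rfl
  have han := hball.analyticOnNhd
  rw [hrad, Metric.eball_top, hsum] at han
  exact han.contDiff

/-- The derivative-type family `(x, y) ↦ ∑_b A(x, …, y, …, x)`, with `y` in the place `b`. -/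
noncomputable def OddFamily.insertion (A : OddFamily Y Z) : OddFamily (Y × Y) Z := fun j =>
  ∑ b : Fin (2 * j + 3), (A j).compContinuousLinearMap fun i =>
    if i = b then ContinuousLinearMap.snd ℝ Y Y else ContinuousLinearMap.fst ℝ Y Y

theorem OddFamily.insertion_apply (A : OddFamily Y Z) (j : ℕ) (x y : Y) :
    (A.insertion j fun _ => (x, y)) = ∑ b, A j (Function.update (fun _ => x) b y) := by
  rw [OddFamily.insertion, sum_apply]
  refine Finset.sum_congr rfl fun b _ => ?_
  rw [ContinuousMultilinearMap.compContinuousLinearMap_apply]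
  congr 1
  funext i
  by_cases h : i = b
  · rw [h, if_pos rfl, Function.update_self]; rfl
  · rw [if_neg h, Function.update_of_ne h]; rfl

theorem OddFamily.BoundedBy.insertion {A : OddFamily Y Z} {D : ℝ} (hA : A.BoundedBy D) :
    A.insertion.BoundedBy (3 * D) := by
  intro j
  rw [OddFamily.insertion]
  refine (norm_sum_le _ _).trans ?_
  have h : ∀ b : Fin (2 * j + 3), ‖(A j).compContinuousLinearMap fun i =>
      if i = b then ContinuousLinearMap.snd ℝ Y Y else ContinuousLinearMap.fst ℝ Y Y‖ ≤ ‖A j‖ := by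
    intro b
    refine ((A j).norm_compContinuousLinearMap_le _).trans ?_
    refine mul_le_of_le_one_right (norm_nonneg _) (Finset.prod_le_one (fun _ _ => norm_nonneg _) ?_)
    intro i _
    split_ifs
    · exact ContinuousLinearMap.norm_snd_le ℝ Y Y
    · exact ContinuousLinearMap.norm_fst_le ℝ Y Y
  refine (Finset.sum_le_sum fun b _ => h b).trans ?_
  rw [Finset.sum_const, Finset.card_univ, Fintype.card_fin, nsmul_eq_mul]
  have h2 := two_mul_add_three_le j
  calc ((2 * j + 3 : ℕ) : ℝ) * ‖A j‖ ≤ 3 ^ (j + 1) * (D ^ (j + 1) / ((j + 1).factorial : ℝ)) := by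
        gcongr
        · push_cast; exact h2
        · exact hA j
    _ = _ := by rw [mul_pow]; ring

/-- Linearity in y is kept, unlike in the bound for the pair. With y cubic in x, this makes the
inserted terms of fifth order. -/
theorem OddFamily.BoundedBy.norm_insertion_le {A : OddFamily Y Z} {D : ℝ} (hA : A.BoundedBy D)
    (j : ℕ) (x y : Y) : ‖A.insertion j fun _ => (x, y)‖ ≤
      (3 * D * ‖x‖ ^ 2) ^ (j + 1) / ((j + 1).factorial : ℝ) * ‖y‖ := by
  rw [OddFamily.insertion_apply]
  refine (norm_sum_le _ _).trans ?_
  have h : ∀ b : Fin (2 * j + 3), ‖A j (Function.update (fun _ => x) b y)‖ ≤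
      ‖A j‖ * (‖x‖ ^ (2 * j + 2) * ‖y‖) := by
    intro b
    refine ((A j).le_opNorm _).trans (le_of_eq ?_)
    rw [← Finset.prod_erase_mul _ _ (Finset.mem_univ b), Function.update_self,
      Finset.prod_congr rfl fun i hi => by rw [Function.update_of_ne (Finset.ne_of_mem_erase hi)],
      Finset.prod_const, Finset.card_erase_of_mem (Finset.mem_univ b), Finset.card_univ,
      Fintype.card_fin]
    rfl
  refine (Finset.sum_le_sum fun b _ => h b).trans ?_
  rw [Finset.sum_const, Finset.card_univ, Fintype.card_fin, nsmul_eq_mul]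
  have h2 := two_mul_add_three_le j
  calc ((2 * j + 3 : ℕ) : ℝ) * (‖A j‖ * (‖x‖ ^ (2 * j + 2) * ‖y‖)) ≤
      3 ^ (j + 1) * ((D ^ (j + 1) / ((j + 1).factorial : ℝ)) * (‖x‖ ^ (2 * j + 2) * ‖y‖)) := by
        gcongr
        · push_cast; exact h2
        · exact hA j
    _ = _ := by rw [mul_pow, mul_pow, ← pow_mul]; ring

theorem OddFamily.BoundedBy.norm_oddSum_insertion_le {A : OddFamily Y Z} {D : ℝ}
    (hA : A.BoundedBy D) (x y : Y) :
    ‖oddSum A.insertion (x, y)‖ ≤ (Real.exp (3 * D * ‖x‖ ^ 2) - 1) * ‖y‖ :=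
  tsum_of_norm_bounded ((hasSum_exp_sub_one _).mul_right ‖y‖) fun j => hA.norm_insertion_le j x y

end OddSeries

/-! ### The integrand nonlinearity -/

section Drift

variable {Y : Type*} [NormedAddCommGroup Y] [NormedSpace ℝ Y]

/-- The cubic map `x ↦ R(x, x, x)`. -/
def diag3 (R : ContinuousMultilinearMap ℝ (fun _ : Fin 3 => Y) Y) (x : Y) : Y := R fun _ => x

/-- The nonlinearity under the time integral. -/
noncomputable def drift (A B : OddFamily Y Y)
    (R : ContinuousMultilinearMap ℝ (fun _ : Fin 3 => Y) Y) (x : Y) : Y :=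
  oddSum B x + diag3 R x - oddSum A.insertion (x, diag3 R x)

variable {A B : OddFamily Y Y} {R : ContinuousMultilinearMap ℝ (fun _ : Fin 3 => Y) Y}
  {D D' κ r : ℝ}

theorem norm_diag3_le (hR : ‖R‖ ≤ κ) (x : Y) : ‖diag3 R x‖ ≤ κ * ‖x‖ ^ 3 := by
  refine (R.le_opNorm _).trans ?_
  rw [Finset.prod_const, Finset.card_univ, Fintype.card_fin]
  gcongr

theorem norm_diag3_sub_le (hR : ‖R‖ ≤ κ) {x y : Y} (hx : ‖x‖ ≤ r) (hy : ‖y‖ ≤ r) :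
    ‖diag3 R x - diag3 R y‖ ≤ 3 * κ * r ^ 2 * ‖x - y‖ := by
  have hr : 0 ≤ r := (norm_nonneg x).trans hx
  refine (R.norm_image_sub_le _ _).trans ?_
  have e : ∀ z : Y, ‖fun _ : Fin 3 => z‖ = ‖z‖ := fun z => pi_norm_const z
  have e1 : ‖(fun _ : Fin 3 => x) - fun _ => y‖ = ‖x - y‖ := e (x - y)
  rw [e1, e, e, Fintype.card_fin]
  have hm : max ‖x‖ ‖y‖ ≤ r := max_le hx hy
  have h0 : 0 ≤ max ‖x‖ ‖y‖ := (norm_nonneg x).trans (le_max_left _ _)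
  have hκ : 0 ≤ κ := (norm_nonneg R).trans hR
  calc ‖R‖ * ((3 : ℕ) : ℝ) * max ‖x‖ ‖y‖ ^ (3 - 1) * ‖x - y‖ ≤
      κ * 3 * r ^ 2 * ‖x - y‖ := by
        push_cast; gcongr
    _ = _ := by ring

/-- A Lipschitz constant of the integrand nonlinearity on the ball of radius `r`. -/
noncomputable def driftLip (D D' κ r : ℝ) : ℝ :=
  (Real.exp (3 * D' * r ^ 2) - 1) + 3 * κ * r ^ 2 +
    (Real.exp (3 * (3 * D) * (max r (κ * r ^ 3)) ^ 2) - 1) * max 1 (3 * κ * r ^ 2)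

theorem driftLip_nonneg (hD : 0 ≤ D) (hD' : 0 ≤ D') (hκ : 0 ≤ κ) : 0 ≤ driftLip D D' κ r := by
  have h : ∀ z : ℝ, 0 ≤ z → 0 ≤ Real.exp z - 1 := fun z hz => by
    linarith [Real.one_le_exp hz]
  have h1 := h (3 * D' * r ^ 2) (by positivity)
  have h2 := h (3 * (3 * D) * (max r (κ * r ^ 3)) ^ 2) (by positivity)
  unfold driftLip
  positivity

theorem norm_drift_sub_le [CompleteSpace Y] (hA : A.BoundedBy D) (hB : B.BoundedBy D')
    (hR : ‖R‖ ≤ κ) (hD : 0 ≤ D) (hD' : 0 ≤ D') {x y : Y} (hx : ‖x‖ ≤ r) (hy : ‖y‖ ≤ r) :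
    ‖drift A B R x - drift A B R y‖ ≤ driftLip D D' κ r * ‖x - y‖ := by
  have hκ : 0 ≤ κ := (norm_nonneg R).trans hR
  have h1 := hB.norm_oddSum_sub_le hD' hx hy
  have h2 := norm_diag3_sub_le hR hx hy
  have hb : ∀ z : Y, ‖z‖ ≤ r → ‖(z, diag3 R z)‖ ≤ max r (κ * r ^ 3) := by
    intro z hz
    rw [Prod.norm_mk]
    refine max_le_max hz ((norm_diag3_le hR z).trans ?_)
    gcongr
  have h3 := hA.insertion.norm_oddSum_sub_le (by positivity) (hb x hx) (hb y hy)
  have h4 : ‖(x, diag3 R x) - (y, diag3 R y)‖ ≤ max 1 (3 * κ * r ^ 2) * ‖x - y‖ := by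
    rw [Prod.mk_sub_mk, Prod.norm_mk]
    refine max_le ?_ (h2.trans ?_)
    · exact le_mul_of_one_le_left (norm_nonneg _) (le_max_left _ _)
    · gcongr; exact le_max_right _ _
  have h5 : 0 ≤ Real.exp (3 * (3 * D) * (max r (κ * r ^ 3)) ^ 2) - 1 := by
    linarith [Real.one_le_exp (show 0 ≤ 3 * (3 * D) * (max r (κ * r ^ 3)) ^ 2 by positivity)]
  have h6 := h3.trans (mul_le_mul_of_nonneg_left h4 h5)
  have e : drift A B R x - drift A B R y = (oddSum B x - oddSum B y) + (diag3 R x - diag3 R y) -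
      (oddSum A.insertion (x, diag3 R x) - oddSum A.insertion (y, diag3 R y)) := by
    unfold drift; abel
  rw [e, driftLip]
  refine (norm_sub_le _ _).trans ?_
  have := norm_add_le (oddSum B x - oddSum B y) (diag3 R x - diag3 R y)
  linarith

theorem drift_zero : drift A B R 0 = 0 := by
  have h : diag3 R (0 : Y) = 0 := R.map_coord_zero 0 rfl
  rw [drift, h, oddSum_zero, ← Prod.zero_eq_mk, oddSum_zero]
  simp

theorem contDiff_drift [CompleteSpace Y] (hA : A.BoundedBy D) (hB : B.BoundedBy D') :
    ContDiff ℝ ∞ (drift A B R) := by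
  have hR : ContDiff ℝ ∞ (diag3 R) :=
    R.contDiff.comp (contDiff_pi.mpr fun _ => contDiff_id)
  exact (hB.contDiff_oddSum.add hR).sub
    (hA.insertion.contDiff_oddSum.comp (contDiff_id.prodMk hR))

/-- Both contributions are of fifth order: the tail of the series of `B`, and the insertion of a
cubic term into maps that are at least quadratic in the other entries. -/
theorem norm_drift_sub_cubic_le [CompleteSpace Y] (hA : A.BoundedBy D) (hB : B.BoundedBy D')
    (hR : ‖R‖ ≤ κ) (hD' : 0 ≤ D') (hD : 0 ≤ D) {x : Y} (hx : D' * ‖x‖ ^ 2 ≤ 1) :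
    ‖drift A B R x - (diag3 (B 0) x + diag3 R x)‖ ≤
      ‖x‖ * (D' * ‖x‖ ^ 2) ^ 2 + (Real.exp (3 * D * ‖x‖ ^ 2) - 1) * (κ * ‖x‖ ^ 3) := by
  have h1 := hB.norm_oddSum_sub_zero_le hD' hx
  have h2 := hA.norm_oddSum_insertion_le x (diag3 R x)
  have h3 : 0 ≤ Real.exp (3 * D * ‖x‖ ^ 2) - 1 := by
    linarith [Real.one_le_exp (show 0 ≤ 3 * D * ‖x‖ ^ 2 by positivity)]
  have h4 := h2.trans (mul_le_mul_of_nonneg_left (norm_diag3_le hR x) h3)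
  have e : drift A B R x - (diag3 (B 0) x + diag3 R x) =
      (oddSum B x - diag3 (B 0) x) - oddSum A.insertion (x, diag3 R x) := by
    unfold drift; abel
  rw [e]
  exact (norm_sub_le _ _).trans (add_le_add h1 h4)

end Drift

/-! ### Pointwise action on continuous functions -/

section Pointwise

variable {Y Z : Type*} [NormedAddCommGroup Y] [NormedSpace ℝ Y] [NormedAddCommGroup Z]
  [NormedSpace ℝ Z] {k : Type*} [TopologicalSpace k] [CompactSpace k]

/-- The pointwise action of a multilinear map on continuous functions. -/
noncomputable def pointwise {n : ℕ} (M : ContinuousMultilinearMap ℝ (fun _ : Fin n => Y) Z) :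
    ContinuousMultilinearMap ℝ (fun _ : Fin n => C(k, Y)) C(k, Z) :=
  MultilinearMap.mkContinuous
    (MultilinearMap.mk' (fun u => ⟨fun t => M fun i => u i t,
        M.cont.comp (continuous_pi fun i => (u i).continuous)⟩)
      (fun u i v w => by
        ext t
        have h : ∀ z : C(k, Y), (fun l => Function.update u i z l t) =
            Function.update (fun l => u l t) i (z t) := fun z => by
          funext l
          by_cases hl : l = i
          · subst hl; simp
          · simp [Function.update_of_ne hl]
        change M _ = M _ + M _
        rw [h, h, h, ContinuousMap.add_apply, M.map_update_add])
      (fun u i c v => by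
        ext t
        have h : ∀ z : C(k, Y), (fun l => Function.update u i z l t) =
            Function.update (fun l => u l t) i (z t) := fun z => by
          funext l
          by_cases hl : l = i
          · subst hl; simp
          · simp [Function.update_of_ne hl]
        change M _ = c • M _
        rw [h, h, ContinuousMap.smul_apply, M.map_update_smul]))
    ‖M‖ fun u => by
      rw [ContinuousMap.norm_le _ (by positivity)]
      intro t
      refine (M.le_opNorm _).trans ?_
      gcongr with i
      exact (u i).norm_coe_le_norm t

theorem norm_pointwise_le {n : ℕ} (M : ContinuousMultilinearMap ℝ (fun _ : Fin n => Y) Z) :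
    ‖(pointwise M : ContinuousMultilinearMap ℝ (fun _ : Fin n => C(k, Y)) C(k, Z))‖ ≤ ‖M‖ :=
  MultilinearMap.mkContinuous_norm_le _ (norm_nonneg _) _

/-- The pointwise action of an odd family. -/
noncomputable def OddFamily.pw (k : Type*) [TopologicalSpace k] [CompactSpace k]
    (A : OddFamily Y Z) : OddFamily C(k, Y) C(k, Z) := fun j => pointwise (A j)

theorem OddFamily.BoundedBy.pw {A : OddFamily Y Z} {D : ℝ} (hA : A.BoundedBy D) :
    (A.pw k).BoundedBy D := fun j => (norm_pointwise_le _).trans (hA j)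

theorem OddFamily.BoundedBy.oddSum_pw [CompleteSpace Z] {A : OddFamily Y Z} {D : ℝ}
    (hA : A.BoundedBy D) (u : C(k, Y)) (t : k) : oddSum (A.pw k) u t = oddSum A (u t) :=
  (ContinuousMap.evalCLM ℝ t).map_tsum (hA.pw.summable u).of_norm

/-- Evaluation at a point is linear and continuous and passes through the series. The smoothness and
Lipschitz bounds on C([0,T]; FL^{s,p}) are then the abstract ones, applied to the pointwise
families. -/
theorem drift_pw [CompleteSpace Y] {A B : OddFamily Y Y}
    {R : ContinuousMultilinearMap ℝ (fun _ : Fin 3 => Y) Y} {D D' : ℝ} (hA : A.BoundedBy D)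
    (hB : B.BoundedBy D') (u : C(k, Y)) (t : k) :
    drift (A.pw k) (B.pw k) (pointwise R) u t = drift A B R (u t) := by
  have h : oddSum (A.pw k).insertion (u, diag3 (pointwise R) u) t =
      oddSum A.insertion (u t, diag3 R (u t)) := by
    refine ((ContinuousMap.evalCLM ℝ t).map_tsum
      (hA.pw.insertion.summable (u, diag3 (pointwise R) u)).of_norm).trans (tsum_congr fun j => ?_)
    rw [OddFamily.insertion_apply, OddFamily.insertion_apply, map_sum]
    refine Finset.sum_congr rfl fun b _ => ?_
    change A j _ = _
    congr 1
    funext i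
    by_cases hi : i = b
    · subst hi; simp [diag3]; rfl
    · simp [Function.update_of_ne hi]
  rw [drift, drift, ContinuousMap.sub_apply, ContinuousMap.add_apply, hB.oddSum_pw, h]
  rfl

end Pointwise


/-! ### Smooth dependence of fixed points -/

section FixedPoint

variable {E X : Type*} [NormedAddCommGroup E] [NormedSpace ℝ E] [NormedAddCommGroup X]
  [NormedSpace ℝ X] [CompleteSpace X] [Nontrivial X]

/-- The fixed point equation is H(u) = Le with H = id - Q. On the ball of radius 2M, H approximates
the identity with constant θ < 1, so it is a homeomorphism onto an open image, and the image of the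
closed ball of radius M covers that of radius (1 - θ)M. The factor 2 keeps the solutions, of norm at
most M, in the interior. -/
theorem exists_contDiff_fixedPoint (L : E →L[ℝ] X) (hL : ∀ e, ‖L e‖ ≤ ‖e‖) {Q : X → X}
    (hQ : ContDiff ℝ ∞ Q) (hQ0 : Q 0 = 0) {M R θ : ℝ} (hθ0 : 0 ≤ θ) (hθ1 : θ < 1) (hM : 0 < M)
    (hQL : ∀ u v, ‖u‖ ≤ 2 * M → ‖v‖ ≤ 2 * M → ‖Q u - Q v‖ ≤ θ * ‖u - v‖)
    (hR : R ≤ (1 - θ) * M) :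
    ∃ Ψ : E → X, ContDiffOn ℝ ∞ Ψ (Metric.ball 0 R) ∧ ∀ e, ‖e‖ < R →
      ‖Ψ e‖ ≤ M ∧ Ψ e = L e + Q (Ψ e) ∧ ∀ u, ‖u‖ < 2 * M → u = L e + Q u → u = Ψ e := by
  set H : X → X := fun u => u - Q u with hH
  have hsmooth : ContDiff ℝ ∞ H := contDiff_id.sub hQ
  have happ : ∀ ρ ≤ 2 * M, ApproximatesLinearOn H
      ((ContinuousLinearEquiv.refl ℝ X : X ≃L[ℝ] X) : X →L[ℝ] X) (Metric.ball 0 ρ)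
      ⟨θ, hθ0⟩ := by
    intro ρ hρ u hu v hv
    rw [mem_ball_zero_iff] at hu hv
    have e : H u - H v - ((ContinuousLinearEquiv.refl ℝ X : X ≃L[ℝ] X) : X →L[ℝ] X) (u - v) =
        -(Q u - Q v) := by
      simp [hH]; abel
    rw [e, norm_neg]
    exact hQL u v (by linarith) (by linarith)
  have hN : ‖(((ContinuousLinearEquiv.refl ℝ X).symm : X ≃L[ℝ] X) : X →L[ℝ] X)‖₊⁻¹ = 1 := by
    have : ‖(ContinuousLinearMap.id ℝ X)‖₊ = 1 := nnnorm_one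
    rw [ContinuousLinearEquiv.refl_symm, ContinuousLinearEquiv.coe_refl, this, inv_one]
  have hc : Subsingleton X ∨ (⟨θ, hθ0⟩ : ℝ≥0) <
      ‖(((ContinuousLinearEquiv.refl ℝ X).symm : X ≃L[ℝ] X) : X →L[ℝ] X)‖₊⁻¹ := by
    right
    rw [hN]
    exact hθ1
  have hA := happ (2 * M) le_rfl
  let P := hA.toOpenPartialHomeomorph H _ hc Metric.isOpen_ball
  have hP : ∀ u, P u = H u := fun u => rfl
  have hPs : P.source = Metric.ball 0 (2 * M) := rfl
  have hH0 : H 0 = 0 := by simp [hH, hQ0]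
  have hsurj : ∀ y : X, ‖y‖ < R → ∃ u, ‖u‖ ≤ M ∧ H u = y := by
    intro y hy
    have h := hA.surjOn_closedBall_of_nonlinearRightInverse
      (ContinuousLinearEquiv.refl ℝ X).toNonlinearRightInverse (b := 0) (ε := M) hM.le
      (Metric.closedBall_subset_ball (by linarith))
    have hy' : y ∈ Metric.closedBall (H 0) ((((ContinuousLinearEquiv.refl ℝ
        X).toNonlinearRightInverse.nnnorm : ℝ)⁻¹ - ((⟨θ, hθ0⟩ : ℝ≥0) : ℝ)) * M) := by
      rw [hH0, mem_closedBall_zero_iff]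
      have h2 : ((ContinuousLinearEquiv.refl ℝ X).toNonlinearRightInverse.nnnorm : ℝ)⁻¹ = 1 := by
        exact_mod_cast congrArg NNReal.toReal hN
      rw [h2]
      exact hy.le.trans hR
    obtain ⟨u, hu, hu'⟩ := h hy'
    exact ⟨u, mem_closedBall_zero_iff.mp hu, hu'⟩
  have hinv : ∀ u, ‖u‖ < 2 * M → P.symm (H u) = u := fun u hu =>
    P.left_inv (by rw [hPs, mem_ball_zero_iff]; exact hu)
  have hLR : ∀ e : E, ‖e‖ < R → ‖L e‖ < R := fun e he => (hL e).trans_lt he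
  have hkey : ∀ e : E, ‖e‖ < R → ‖P.symm (L e)‖ ≤ M ∧ H (P.symm (L e)) = L e := by
    intro e he
    obtain ⟨u, hu, hu'⟩ := hsurj (L e) (hLR e he)
    have h1 : P.symm (L e) = u := by rw [← hu']; exact hinv u (by linarith)
    rw [h1]
    exact ⟨hu, hu'⟩
  refine ⟨fun e => P.symm (L e), ?_, fun e he => ⟨(hkey e he).1, ?_, fun u hu hue => ?_⟩⟩
  · intro e he
    rw [mem_ball_zero_iff] at he
    obtain ⟨h1, h2⟩ := hkey e he
    set a := P.symm (L e) with ha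
    -- The Lipschitz constant bounds the derivative at an interior point, so 1 - Q'(a) is invertible
    -- by a Neumann series and the local inverse of H is smooth.
    have hlip : ‖fderiv ℝ Q a‖ ≤ θ := by
      refine norm_fderiv_le_of_lip' ℝ hθ0 ?_
      filter_upwards [Metric.isOpen_ball.mem_nhds
        (show a ∈ Metric.ball (0 : X) (2 * M) by rw [mem_ball_zero_iff]; linarith)] with v hv
      rw [mem_ball_zero_iff] at hv
      exact hQL v a hv.le (by linarith)
    have hder : HasFDerivAt P ((ContinuousLinearEquiv.ofUnit
        (Units.oneSub (fderiv ℝ Q a) (hlip.trans_lt hθ1)) : X ≃L[ℝ] X) : X →L[ℝ] X) a := by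
      have := (hasFDerivAt_id a).sub (hQ.differentiable (by simp) a).hasFDerivAt
      exact this
    have hmem : L e ∈ P.target := by
      rw [← h2, ← hP]
      exact P.map_source (by rw [hPs, mem_ball_zero_iff]; linarith)
    have hs := P.contDiffAt_symm (n := ∞) hmem hder hsmooth.contDiffAt
    exact (hs.comp e L.contDiff.contDiffAt).contDiffWithinAt
  · have := (hkey e he).2
    simp only [hH] at this
    rw [← this]; abel
  · have h1 : H u = L e := by
      simp only [hH]; nth_rewrite 1 [hue]; abel
    change u = P.symm (L e)
    rw [← h1, hinv u hu]

end FixedPoint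

/-! ### The Duhamel formula for an isometric flow -/

/-- A jointly continuous family of linear isometries. -/
structure IsometricFlow (E : Type*) [NormedAddCommGroup E] [NormedSpace ℝ E] where
  map : ℝ → E →L[ℝ] E
  norm_map : ∀ t x, ‖map t x‖ = ‖x‖
  continuous_map : Continuous fun z : ℝ × E => map z.1 z.2

section Duhamel

variable {E : Type*} [NormedAddCommGroup E] [NormedSpace ℝ E] (S : IsometricFlow E) {T : ℝ}

/-- The free evolution. -/
noncomputable def flow (T : ℝ) : E →L[ℝ] C(Set.Icc (0 : ℝ) T, E) :=
  LinearMap.mkContinuous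
    { toFun := fun f => ⟨fun t => S.map t f,
        S.continuous_map.comp (continuous_subtype_val.prodMk continuous_const)⟩
      map_add' := fun f g => by ext t; exact map_add (S.map (t : ℝ)) f g
      map_smul' := fun r f => by ext t; exact map_smul (S.map (t : ℝ)) r f } 1 fun f => by
    rw [one_mul, ContinuousMap.norm_le _ (norm_nonneg _)]
    exact fun t => (S.norm_map _ f).le

theorem flow_apply (f : E) (t : Set.Icc (0 : ℝ) T) : flow S T f t = S.map t f := rfl

theorem norm_flow_le (f : E) : ‖flow S T f‖ ≤ ‖f‖ := by
  rw [ContinuousMap.norm_le _ (norm_nonneg _)]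
  exact fun t => (S.norm_map _ f).le

/-- The integrand of the Duhamel operator, on the real line. -/
noncomputable def duhamelFn (hT : 0 ≤ T) (g : C(Set.Icc (0 : ℝ) T, E)) (t : ℝ) : E :=
  S.map (-t) (g (Set.projIcc 0 T hT t))

theorem continuous_duhamelFn (hT : 0 ≤ T) (g : C(Set.Icc (0 : ℝ) T, E)) :
    Continuous (duhamelFn S hT g) :=
  S.continuous_map.comp (continuous_neg.prodMk (g.continuous.comp continuous_projIcc))

theorem norm_duhamelFn (hT : 0 ≤ T) (g : C(Set.Icc (0 : ℝ) T, E)) (t : ℝ) :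
    ‖duhamelFn S hT g t‖ = ‖g (Set.projIcc 0 T hT t)‖ := S.norm_map _ _

/-- Only the values of g up to the time t are used. The continuity argument depends on this
causality. -/
theorem norm_integral_duhamelFn_le (hT : 0 ≤ T) (g : C(Set.Icc (0 : ℝ) T, E))
    (t : Set.Icc (0 : ℝ) T) {c : ℝ} (hc0 : 0 ≤ c) (hc : ∀ t' ≤ t, ‖g t'‖ ≤ c) :
    ‖S.map t (∫ t' in (0 : ℝ)..t, duhamelFn S hT g t')‖ ≤ T * c := by
  rw [S.norm_map]
  have h : ∀ x ∈ Set.uIoc 0 (t : ℝ), ‖duhamelFn S hT g x‖ ≤ c := by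
    intro x hx
    rw [Set.uIoc_of_le t.2.1] at hx
    rw [norm_duhamelFn]
    refine hc _ ?_
    rw [Set.projIcc_of_mem hT ⟨hx.1.le, hx.2.trans t.2.2⟩]
    exact hx.2
  refine (intervalIntegral.norm_integral_le_of_norm_le_const h).trans ?_
  rw [sub_zero, abs_of_nonneg t.2.1, mul_comm]
  exact mul_le_mul_of_nonneg_right t.2.2 hc0

variable [CompleteSpace E]

/-- The Duhamel operator. -/
noncomputable def duhamel (hT : 0 ≤ T) :
    C(Set.Icc (0 : ℝ) T, E) →L[ℝ] C(Set.Icc (0 : ℝ) T, E) :=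
  LinearMap.mkContinuous
    { toFun := fun g => ⟨fun t => S.map t (∫ t' in (0 : ℝ)..t, duhamelFn S hT g t'),
        S.continuous_map.comp (continuous_subtype_val.prodMk
          ((intervalIntegral.continuous_primitive
            (fun a b => (continuous_duhamelFn S hT g).intervalIntegrable a b) 0).comp
              continuous_subtype_val))⟩
      map_add' := fun f g => by
        ext t
        change S.map t _ = S.map t _ + S.map t _
        rw [← map_add, ← intervalIntegral.integral_add
          ((continuous_duhamelFn S hT f).intervalIntegrable _ _)
          ((continuous_duhamelFn S hT g).intervalIntegrable _ _)]
        congr 1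
        refine intervalIntegral.integral_congr fun x _ => ?_
        exact map_add (S.map (-x)) _ _
      map_smul' := fun r g => by
        ext t
        change S.map t _ = r • S.map t _
        rw [← map_smul, ← intervalIntegral.integral_smul]
        congr 1
        refine intervalIntegral.integral_congr fun x _ => ?_
        exact map_smul (S.map (-x)) r _ } T fun g => by
    rw [ContinuousMap.norm_le _ (by positivity)]
    exact fun t => norm_integral_duhamelFn_le S hT g t (norm_nonneg _)
      fun t' _ => g.norm_coe_le_norm t'

theorem duhamel_apply (hT : 0 ≤ T) (g : C(Set.Icc (0 : ℝ) T, E)) (t : Set.Icc (0 : ℝ) T) :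
    duhamel S hT g t = S.map t (∫ t' in (0 : ℝ)..t, duhamelFn S hT g t') := rfl

theorem norm_duhamel_le (hT : 0 ≤ T) (g : C(Set.Icc (0 : ℝ) T, E)) :
    ‖duhamel S hT g‖ ≤ T * ‖g‖ := by
  rw [ContinuousMap.norm_le _ (by positivity)]
  exact fun t => norm_integral_duhamelFn_le S hT g t (norm_nonneg _)
    fun t' _ => g.norm_coe_le_norm t'

/-! ### The right-hand side of the normal form equation -/

variable {A B : OddFamily E E} {R : ContinuousMultilinearMap ℝ (fun _ : Fin 3 => E) E} {D D' : ℝ}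

/-- The nonlinear part of the right-hand side of the normal form equation. -/
noncomputable def nonlinearPart (A B : OddFamily E E)
    (R : ContinuousMultilinearMap ℝ (fun _ : Fin 3 => E) E) (hT : 0 ≤ T)
    (u : C(Set.Icc (0 : ℝ) T, E)) : C(Set.Icc (0 : ℝ) T, E) :=
  oddSum (A.pw _) u - flow S T (oddSum (A.pw _) u ⟨0, le_rfl, hT⟩) +
    duhamel S hT (drift (A.pw _) (B.pw _) (pointwise R) u)

theorem contDiff_nonlinearPart (hA : A.BoundedBy D) (hB : B.BoundedBy D') (hT : 0 ≤ T) :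
    ContDiff ℝ ∞ (nonlinearPart S A B R hT) := by
  have h1 : ContDiff ℝ ∞ (oddSum (A.pw (Set.Icc (0 : ℝ) T))) := hA.pw.contDiff_oddSum
  have h2 := (flow S T).contDiff.comp ((ContinuousMap.evalCLM ℝ
    (⟨0, le_rfl, hT⟩ : Set.Icc (0 : ℝ) T) : C(Set.Icc (0 : ℝ) T, E) →L[ℝ] E).contDiff.comp h1)
  have h3 := (duhamel S hT).contDiff.comp
    (contDiff_drift (R := pointwise R) (hA.pw (k := Set.Icc (0 : ℝ) T)) (hB.pw))
  exact (h1.sub h2).add h3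

theorem nonlinearPart_zero (hT : 0 ≤ T) : nonlinearPart S A B R hT 0 = 0 := by
  rw [nonlinearPart, oddSum_zero, drift_zero, ContinuousMap.zero_apply, map_zero, map_zero]
  simp

/-- The boundary terms at times t and 0 give the factor 2 and become small through D, that is, for K
large; the Duhamel term becomes small through T. -/
theorem norm_nonlinearPart_sub_le (hA : A.BoundedBy D) (hB : B.BoundedBy D') (hD : 0 ≤ D)
    (hD' : 0 ≤ D') (hT : 0 ≤ T) {r : ℝ} {u v : C(Set.Icc (0 : ℝ) T, E)} (hu : ‖u‖ ≤ r)
    (hv : ‖v‖ ≤ r) : ‖nonlinearPart S A B R hT u - nonlinearPart S A B R hT v‖ ≤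
      (2 * (Real.exp (3 * D * r ^ 2) - 1) + T * driftLip D D' ‖R‖ r) * ‖u - v‖ := by
  have h1 := hA.pw.norm_oddSum_sub_le hD hu hv
  have h2 := norm_drift_sub_le (hA.pw (k := Set.Icc (0 : ℝ) T)) hB.pw (norm_pointwise_le R)
    hD hD' hu hv
  set N := oddSum (A.pw (Set.Icc (0 : ℝ) T))
  set G := drift (A.pw (Set.Icc (0 : ℝ) T)) (B.pw _) (pointwise R)
  have h3 : ‖flow S T (N u ⟨0, le_rfl, hT⟩) - flow S T (N v ⟨0, le_rfl, hT⟩)‖ ≤ ‖N u - N v‖ := by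
    rw [← map_sub]
    exact (norm_flow_le S _).trans ((N u - N v).norm_coe_le_norm ⟨0, le_rfl, hT⟩)
  have h4 : ‖duhamel S hT (G u) - duhamel S hT (G v)‖ ≤ T * ‖G u - G v‖ := by
    rw [← map_sub]
    exact norm_duhamel_le S hT _
  have e : nonlinearPart S A B R hT u - nonlinearPart S A B R hT v = (N u - N v) -
      (flow S T (N u ⟨0, le_rfl, hT⟩) - flow S T (N v ⟨0, le_rfl, hT⟩)) +
      (duhamel S hT (G u) - duhamel S hT (G v)) := by
    unfold nonlinearPart; abel
  rw [e]
  have h5 := norm_add_le ((N u - N v) -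
      (flow S T (N u ⟨0, le_rfl, hT⟩) - flow S T (N v ⟨0, le_rfl, hT⟩)))
      (duhamel S hT (G u) - duhamel S hT (G v))
  have h6 := norm_sub_le (N u - N v)
      (flow S T (N u ⟨0, le_rfl, hT⟩) - flow S T (N v ⟨0, le_rfl, hT⟩))
  have h7 := h4.trans (mul_le_mul_of_nonneg_left h2 hT)
  linarith

theorem nonlinearPart_apply_zero (hT : 0 ≤ T) (hS : ∀ x, S.map 0 x = x)
    (u : C(Set.Icc (0 : ℝ) T, E)) : nonlinearPart S A B R hT u ⟨0, le_rfl, hT⟩ = 0 := by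
  rw [nonlinearPart, ContinuousMap.add_apply, ContinuousMap.sub_apply, flow_apply, duhamel_apply]
  simp [hS]

/-- A priori bound: a solution with small data cannot leave the ball on which the nonlinearity
is small. -/
theorem norm_lt_of_eq_flow_add (hA : A.BoundedBy D) (hB : B.BoundedBy D') (hD : 0 ≤ D)
    (hD' : 0 ≤ D') (hT : 0 ≤ T) (hS : ∀ x, S.map 0 x = x) {r : ℝ} (hr : 0 < r)
    (hN : Real.exp (3 * D * r ^ 2) - 1 ≤ 1 / 8) (hG : T * driftLip D D' ‖R‖ r ≤ 1 / 8)
    {u₀ : E} (hu₀ : ‖u₀‖ < r / 2) {u : C(Set.Icc (0 : ℝ) T, E)}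
    (hu : u = flow S T u₀ + nonlinearPart S A B R hT u) : ‖u‖ < r := by
  have h0 : u ⟨0, le_rfl, hT⟩ = u₀ := by
    rw [hu, ContinuousMap.add_apply, nonlinearPart_apply_zero S hT hS, flow_apply, add_zero]
    exact hS u₀
  by_contra hcon
  have hex : ∃ t, r ≤ ‖u t‖ := by
    by_contra hne
    push Not at hne
    have : Nonempty (Set.Icc (0 : ℝ) T) := ⟨⟨0, le_rfl, hT⟩⟩
    exact hcon ((ContinuousMap.norm_lt_iff _ hr).mpr hne)
  have hcont : Continuous fun t => ‖u t‖ := u.continuous.norm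
  have hcl : IsCompact {t : Set.Icc (0 : ℝ) T | r ≤ ‖u t‖} :=
    (isClosed_le continuous_const hcont).isCompact
  -- The first time at which the norm reaches r. By the intermediate value theorem the norm equals r
  -- there.
  obtain ⟨t₀, ht₀, hleast⟩ := hcl.exists_isLeast hex
  have hlt : ∀ t, t < t₀ → ‖u t‖ < r := fun t ht => by
    by_contra hne
    exact absurd (hleast (not_lt.mp hne)) (not_le.mpr ht)
  have ht₀' : ‖u t₀‖ ≤ r := by
    have hne0 : (⟨0, le_rfl, hT⟩ : Set.Icc (0 : ℝ) T) < t₀ := by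
      rcases (show (⟨0, le_rfl, hT⟩ : Set.Icc (0 : ℝ) T) ≤ t₀ from t₀.2.1).eq_or_lt with h | h
      · have h1 : r ≤ ‖u t₀‖ := ht₀
        rw [← h, h0] at h1
        linarith
      · exact h
    by_contra hgt
    push Not at hgt
    have hle : t₀.1 ≤ T := t₀.2.2
    let v : ℝ → ℝ := fun x => ‖u (Set.projIcc 0 T hT x)‖
    have hv : ContinuousOn v (Set.Icc 0 t₀.1) :=
      (hcont.comp continuous_projIcc).continuousOn
    have hv0 : v 0 = ‖u₀‖ := by
      simp only [v]
      rw [Set.projIcc_of_mem hT (⟨le_rfl, hT⟩ : (0 : ℝ) ∈ Set.Icc 0 T), h0]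
    have hvt : v t₀.1 = ‖u t₀‖ := by
      simp only [v]
      rw [Set.projIcc_of_mem hT t₀.2]
    obtain ⟨x, hx, hxr⟩ := intermediate_value_Icc t₀.2.1 hv
      (show r ∈ Set.Icc (v 0) (v t₀.1) from ⟨by rw [hv0]; linarith, by rw [hvt]; exact hgt.le⟩)
    have hxm : x ∈ Set.Icc (0 : ℝ) T := ⟨hx.1, hx.2.trans hle⟩
    simp only [v] at hxr
    rw [Set.projIcc_of_mem hT hxm] at hxr
    rcases hx.2.eq_or_lt with h | h
    · have : (⟨x, hxm⟩ : Set.Icc (0 : ℝ) T) = t₀ := Subtype.ext h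
      rw [this] at hxr
      linarith
    · exact absurd hxr (hlt ⟨x, hxm⟩ h).ne
  have hle : ∀ t ≤ t₀, ‖u t‖ ≤ r := fun t ht => by
    rcases ht.eq_or_lt with h | h
    · rw [h]; exact ht₀'
    · exact (hlt t h).le
  have hNx : ∀ x : E, ‖x‖ ≤ r → ‖oddSum A x‖ ≤ 1 / 8 * r := by
    intro x hx
    have h := hA.norm_oddSum_sub_le hD hx (y := 0) (by simpa using hr.le)
    rw [oddSum_zero, sub_zero, sub_zero] at h
    exact h.trans (mul_le_mul hN hx (norm_nonneg _) (by norm_num))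
  have hGx : ∀ t ≤ t₀, ‖drift (A.pw (Set.Icc (0 : ℝ) T)) (B.pw _) (pointwise R) u t‖ ≤
      driftLip D D' ‖R‖ r * r := by
    intro t ht
    rw [drift_pw hA hB]
    have h := norm_drift_sub_le (R := R) hA hB le_rfl hD hD' (hle t ht) (y := 0) (by simpa using hr.le)
    rw [drift_zero, sub_zero, sub_zero] at h
    exact h.trans (mul_le_mul_of_nonneg_left (hle t ht)
      (driftLip_nonneg hD hD' (norm_nonneg _)))
  have h1 : u t₀ = S.map t₀ u₀ + (oddSum A (u t₀) - S.map t₀ (oddSum A u₀) +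
      S.map t₀ (∫ t' in (0 : ℝ)..t₀, duhamelFn S hT
        (drift (A.pw (Set.Icc (0 : ℝ) T)) (B.pw _) (pointwise R) u) t')) := by
    conv_lhs => rw [hu]
    rw [ContinuousMap.add_apply, nonlinearPart, ContinuousMap.add_apply, ContinuousMap.sub_apply,
      flow_apply, flow_apply, duhamel_apply, hA.oddSum_pw, hA.oddSum_pw, h0]
  have h2 := norm_integral_duhamelFn_le S hT _ t₀
    (mul_nonneg (driftLip_nonneg hD hD' (norm_nonneg R)) hr.le) hGx
  have h3 : ‖S.map t₀ (oddSum A u₀)‖ ≤ 1 / 8 * r := by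
    rw [S.norm_map]; exact hNx u₀ (by linarith)
  have h4 : ‖S.map t₀ u₀‖ < r / 2 := by rw [S.norm_map]; exact hu₀
  have h5 := hNx (u t₀) ht₀'
  have h6 : T * (driftLip D D' ‖R‖ r * r) ≤ 1 / 8 * r := by
    rw [← mul_assoc]; gcongr
  have h7 : r ≤ ‖u t₀‖ := ht₀
  -- At `t₀` the free evolution is below r/2, and the two boundary terms and the integral are at
  -- most r/8 each. The total is below 7r/8, contradicting r ≤ ‖u t₀‖.
  rw [h1] at h7
  have h8 := norm_add_le (S.map t₀ u₀) (oddSum A (u t₀) - S.map t₀ (oddSum A u₀) +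
      S.map t₀ (∫ t' in (0 : ℝ)..t₀, duhamelFn S hT
        (drift (A.pw (Set.Icc (0 : ℝ) T)) (B.pw _) (pointwise R) u) t'))
  have h9 := norm_add_le (oddSum A (u t₀) - S.map t₀ (oddSum A u₀))
      (S.map t₀ (∫ t' in (0 : ℝ)..t₀, duhamelFn S hT
        (drift (A.pw (Set.Icc (0 : ℝ) T)) (B.pw _) (pointwise R) u) t'))
  have h10 := norm_sub_le (oddSum A (u t₀)) (S.map t₀ (oddSum A u₀))
  linarith

end Duhamel


/-! ### ### The normal form equation as an equation in a Banach space -/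

section NormalForm

variable {s p : ℝ} [hp : Fact (1 < p)] {K D D' : ℝ}

/-- The propagator as an isometric flow. -/
noncomputable def propFlow (s p : ℝ) [Fact (1 < p)] : IsometricFlow (FL s p) :=
  ⟨propL, norm_propL, continuous_propL⟩

theorem duhamel_coeff {s p : ℝ} [Fact (1 < p)] {T : ℝ} (hT : 0 ≤ T)
    (g : C(Set.Icc (0 : ℝ) T, FL s p)) (t : Set.Icc (0 : ℝ) T)
    (n : Freq) : (duhamel (propFlow s p) hT g t).coeff n =
      ∫ t' in (0 : ℝ)..t, propagator (t - t') (g (Set.projIcc 0 T hT t')).coeff n := by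
  have h : ∀ t', (duhamelFn (propFlow s p) hT g t').coeff n =
      propagator (-t') (g (Set.projIcc 0 T hT t')).coeff n := fun t' => by
    rw [← propL_coeff]; rfl
  have h2 := (coeffL (s := s) (p := p) n).intervalIntegral_comp_comm (μ := MeasureTheory.volume)
    ((continuous_duhamelFn (propFlow s p) hT g).intervalIntegrable 0 t)
  simp only [coeffL_apply] at h2
  rw [duhamel_apply]
  change (propL t _).coeff n = _
  rw [propL_coeff, propagator, ← h2, ← intervalIntegral.integral_const_mul]
  refine intervalIntegral.integral_congr fun t' _ => ?_
  have := congrFun (propagator_add t (-t') (g (Set.projIcc 0 T hT t')).coeff) n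
  rw [propagator] at this
  change _ * _ = _
  rw [h, this, ← sub_eq_add_neg]

theorem continuous_coeff_integrand {s p : ℝ} [Fact (1 < p)] {T : ℝ} (hT : 0 ≤ T)
    (g : C(Set.Icc (0 : ℝ) T, FL s p)) (t : ℝ) (n : Freq) :
    Continuous fun t' => propagator (t - t') (g (Set.projIcc 0 T hT t')).coeff n := by
  have h0 : Continuous fun t' : ℝ => g (Set.projIcc 0 T hT t') :=
    g.continuous.comp continuous_projIcc
  have h1 : Continuous fun t' : ℝ => ((t - t', g (Set.projIcc 0 T hT t')) : ℝ × FL s p) :=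
    (continuous_const.sub continuous_id).prodMk h0
  have h2 := Continuous.comp (g := fun z : ℝ × FL s p => propL z.1 z.2) continuous_propL h1
  refine ((coeffL n).continuous.comp h2).congr fun t' => ?_
  exact congrFun (propL_coeff _ _) n

theorem NormalFormData.bounded_N0 (dat : NormalFormData s p K D D') :
    OddFamily.BoundedBy dat.N0 D := dat.norm_N0

theorem NormalFormData.bounded_N1 (dat : NormalFormData s p K D D') :
    OddFamily.BoundedBy dat.N1 D' := dat.norm_N1

theorem NormalFormData.tsum_frakN0 (dat : NormalFormData s p K D D') (t : ℝ) (f : FL s p)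
    (n : Freq) : ∑' j, frakN0 K p j t f.coeff n = (oddSum dat.N0 f).coeff n := by
  refine (tsum_congr fun j => ?_).trans
    ((coeffL n).map_tsum (dat.bounded_N0.summable f).of_norm).symm
  rw [coeffL_apply, dat.coeff_N0 j t f]

theorem NormalFormData.tsum_frakN1 (dat : NormalFormData s p K D D') (t : ℝ) (f : FL s p)
    (n : Freq) : ∑' j, frakN1 K p j t f.coeff n = (oddSum dat.N1 f).coeff n := by
  refine (tsum_congr fun j => ?_).trans
    ((coeffL n).map_tsum (dat.bounded_N1.summable f).of_norm).symm
  rw [coeffL_apply, dat.coeff_N1 j t f]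

theorem frakR_zero (dat : NormalFormData s p K D D') (t : ℝ) (f : FL s p) :
    frakR K p 0 t f.coeff = (diag3 dat.R1 f).coeff := by
  rw [frakR]
  change propagator t (calR1 (propagator (-t) f.coeff)) = _
  rw [calR1_propagator, propagator_add, add_neg_cancel, propagator_zero]
  exact (dat.coeff_R1 f).symm

theorem frakR_succ (dat : NormalFormData s p K D D') (j : ℕ) (t : ℝ) (f : FL s p) :
    frakR K p (j + 1) t f.coeff =
      (-(OddFamily.insertion dat.N0 j fun _ => (f, diag3 dat.R1 f))).coeff := by
  rw [OddFamily.insertion_apply, ← dat.coeff_R j t f]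
  rfl

/-- The term j = 0 is the cubic ℛ⁽¹⁾; the others are minus the insertions of ℛ⁽¹⁾ into 𝔑₀. -/
theorem NormalFormData.tsum_frakR (dat : NormalFormData s p K D D') (t : ℝ) (f : FL s p)
    (n : Freq) : ∑' j, frakR K p j t f.coeff n =
      (diag3 dat.R1 f - oddSum (OddFamily.insertion dat.N0) (f, diag3 dat.R1 f)).coeff n := by
  have hsum := (dat.bounded_N0.insertion.summable (f, diag3 dat.R1 f)).of_norm
  have h1 : HasSum (fun j => frakR K p (j + 1) t f.coeff n)
      (-(oddSum (OddFamily.insertion dat.N0) (f, diag3 dat.R1 f)).coeff n) := by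
    refine ((hsum.hasSum.mapL (coeffL n)).neg).congr_fun fun j => ?_
    rw [frakR_succ dat, FL.coeff_neg, coeffL_apply]
  have h2 := (hasSum_nat_add_iff (f := fun j => frakR K p j t f.coeff n) 1).mp h1
  rw [h2.tsum_eq, Finset.sum_range_one, frakR_zero dat, FL.coeff_sub]
  ring

theorem NormalFormData.tsum_drift (dat : NormalFormData s p K D D') (t : ℝ) (f : FL s p)
    (n : Freq) : (∑' j, frakN1 K p j t f.coeff n) + ∑' j, frakR K p j t f.coeff n =
      (drift dat.N0 dat.N1 dat.R1 f).coeff n := by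
  rw [dat.tsum_frakN1, dat.tsum_frakR, drift, FL.coeff_sub, FL.coeff_sub, FL.coeff_add]
  ring

theorem NormalFormData.operatorsConverge (dat : NormalFormData s p K D D') (hs : 1 - 1 / p < s)
    (t : ℝ) (f : FL s p) : OperatorsConverge s p K t f.coeff where
  sq := let ⟨_, _, h⟩ := exists_l2_bound (s := s) (p := p) hs; (h f).1
  sumN0 _ T m := dat.summable_N0 T m t f
  sumN1 _ T m := dat.summable_N1 T m t f
  sumR _ T m := dat.summable_R T m t f
  seriesN0 := ⟨fun j => dat.N0 j fun _ => f, fun j => dat.coeff_N0 j t f,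
    dat.bounded_N0.summable f⟩
  seriesN1 := ⟨fun j => dat.N1 j fun _ => f, fun j => dat.coeff_N1 j t f,
    dat.bounded_N1.summable f⟩
  seriesR := by
    refine ⟨fun j => Nat.casesOn j (diag3 dat.R1 f)
      fun i => -(OddFamily.insertion dat.N0 i fun _ => (f, diag3 dat.R1 f)), ?_, ?_⟩
    · rintro (_ | j)
      · exact (frakR_zero dat t f).symm
      · exact (frakR_succ dat j t f).symm
    · rw [← summable_nat_add_iff 1]
      simpa only [norm_neg] using dat.bounded_N0.insertion.summable (f, diag3 dat.R1 f)

variable {T : ℝ}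

theorem traj_of_mem (u : C(Set.Icc (0 : ℝ) T, FL s p)) {t : ℝ} (ht : t ∈ Set.Icc (0 : ℝ) T) :
    traj u t = (u ⟨t, ht⟩).coeff := dif_pos ht

theorem NormalFormData.integrand_eq (dat : NormalFormData s p K D D') (hT : 0 ≤ T)
    (u : C(Set.Icc (0 : ℝ) T, FL s p)) (t : ℝ) (n : Freq) {t' : ℝ}
    (ht' : t' ∈ Set.Icc (0 : ℝ) T) : integrand K u t n t' = propagator (t - t')
      (drift (OddFamily.pw _ dat.N0) (OddFamily.pw _ dat.N1) (pointwise dat.R1) u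
        (Set.projIcc 0 T hT t')).coeff n := by
  rw [Set.projIcc_of_mem hT ht', drift_pw dat.bounded_N0 dat.bounded_N1, integrand,
    traj_of_mem u ht', propagator, propagator, dat.tsum_drift]

theorem NormalFormData.nfConverges (dat : NormalFormData s p K D D') (hs : 1 - 1 / p < s)
    (hT : 0 ≤ T) (u : C(Set.Icc (0 : ℝ) T, FL s p)) : NFConverges K u where
  operators t ht := by
    rw [traj_of_mem u ht]
    exact dat.operatorsConverge hs t _
  integrable t ht n := by
    refine IntervalIntegrable.congr (fun t' ht' => ?_)
      ((continuous_coeff_integrand hT (drift (OddFamily.pw _ dat.N0) (OddFamily.pw _ dat.N1)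
        (pointwise dat.R1) u) t n).intervalIntegrable 0 t)
    rw [Set.uIoc_of_le ht.1] at ht'
    exact (dat.integrand_eq hT u t n ⟨ht'.1.le, ht'.2.trans ht.2⟩).symm

/-- The right-hand side of the normal form equation as an element of `C([0,T]; FL^{s,p})`. -/
noncomputable def NormalFormData.rhs (dat : NormalFormData s p K D D') (hT : 0 ≤ T)
    (u₀ : FL s p) (u : C(Set.Icc (0 : ℝ) T, FL s p)) : C(Set.Icc (0 : ℝ) T, FL s p) :=
  flow (propFlow s p) T u₀ + nonlinearPart (propFlow s p) dat.N0 dat.N1 dat.R1 hT u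

/-- The scalar series and integrals of the equation are the coefficients of Banach space valued
ones, because each coefficient is a continuous linear functional. -/
theorem NormalFormData.nfRHS_eq (dat : NormalFormData s p K D D') (hT : 0 ≤ T)
    (u₀ : FL s p) (u : C(Set.Icc (0 : ℝ) T, FL s p)) {t : ℝ} (ht : t ∈ Set.Icc (0 : ℝ) T)
    (n : Freq) : nfRHS K u₀ u t n = (dat.rhs hT u₀ u ⟨t, ht⟩).coeff n := by
  have h0 : (0 : ℝ) ∈ Set.Icc (0 : ℝ) T := ⟨le_rfl, hT⟩
  have e1 : (flow (propFlow s p) T u₀ ⟨t, ht⟩).coeff n = propagator t u₀.coeff n := by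
    rw [flow_apply, ← propL_coeff]; rfl
  have e2 : ∑' j, frakN0 K p j t (traj u t) n =
      (oddSum (OddFamily.pw _ dat.N0) u ⟨t, ht⟩).coeff n := by
    rw [traj_of_mem u ht, dat.tsum_frakN0, dat.bounded_N0.oddSum_pw]
  have e3 : propagator t (fun m => ∑' j, frakN0 K p j 0 (traj u 0) m) n =
      (flow (propFlow s p) T (oddSum (OddFamily.pw _ dat.N0) u ⟨0, h0⟩) ⟨t, ht⟩).coeff n := by
    rw [flow_apply, dat.bounded_N0.oddSum_pw, traj_of_mem u h0]
    change _ = (propL t _).coeff n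
    rw [propL_coeff]
    congr 1
    funext m
    exact dat.tsum_frakN0 0 _ m
  have e4 : ∫ t' in (0 : ℝ)..t, integrand K u t n t' = (duhamel (propFlow s p) hT
      (drift (OddFamily.pw _ dat.N0) (OddFamily.pw _ dat.N1) (pointwise dat.R1) u)
        ⟨t, ht⟩).coeff n := by
    rw [duhamel_coeff]
    refine intervalIntegral.integral_congr fun t' ht' => ?_
    rw [Set.uIcc_of_le ht.1] at ht'
    exact dat.integrand_eq hT u t n ⟨ht'.1, ht'.2.trans ht.2⟩
  rw [nfRHS, e2, e3, e4, ← e1, NormalFormData.rhs, ContinuousMap.add_apply, nonlinearPart,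
    ContinuousMap.add_apply, ContinuousMap.sub_apply, FL.coeff_add, FL.coeff_add, FL.coeff_sub]
  ring

theorem NormalFormData.isNFImage_iff (dat : NormalFormData s p K D D') (hs : 1 - 1 / p < s)
    (hT : 0 ≤ T) (u₀ : FL s p) (u w : C(Set.Icc (0 : ℝ) T, FL s p)) :
    IsNFImage K u₀ u w ↔ w = dat.rhs hT u₀ u := by
  constructor
  · rintro ⟨-, h⟩
    ext t
    refine FL.coeff_injective (funext fun n => ?_)
    rw [← dat.nfRHS_eq hT u₀ u t.2 n, ← h t t.2 n, traj_of_mem w t.2]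
  · rintro rfl
    refine ⟨dat.nfConverges hs hT u, fun t ht n => ?_⟩
    rw [dat.nfRHS_eq hT u₀ u ht n, traj_of_mem _ ht]

/-- The initial condition is automatic: at t = 0 the boundary terms cancel and the integral
vanishes. -/
theorem NormalFormData.isNFSolution_iff (dat : NormalFormData s p K D D') (hs : 1 - 1 / p < s)
    (hT : 0 ≤ T) (u₀ : FL s p) (u : C(Set.Icc (0 : ℝ) T, FL s p)) :
    IsNFSolution K u₀ u ↔ u = dat.rhs hT u₀ u := by
  rw [IsNFSolution, dat.isNFImage_iff hs hT]
  refine and_iff_right_of_imp fun h => ?_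
  rw [traj_of_mem u ⟨le_rfl, hT⟩, h, NormalFormData.rhs, ContinuousMap.add_apply,
    nonlinearPart_apply_zero _ hT propL_zero, add_zero, flow_apply]
  exact congrArg _ (propL_zero u₀)

end NormalForm


/-! ### ### Well-posedness -/

section WellPosedness

variable {s p : ℝ} [hp : Fact (1 < p)]

instance {T : ℝ} [h : Fact (0 ≤ T)] : Nontrivial C(Set.Icc (0 : ℝ) T, FL s p) := by
  obtain ⟨f, hf⟩ := exists_ne (0 : FL s p)
  refine ⟨ContinuousMap.const _ f, 0, fun h0 => hf ?_⟩
  exact congrArg (fun u : C(Set.Icc (0 : ℝ) T, FL s p) => u ⟨0, le_rfl, h.out⟩) h0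

/-- Well-posedness on the ball of radius `r / 2` if the nonlinearity is small on the ball of
radius `r`. -/
theorem NormalFormData.wellPosed {K D D' : ℝ} (dat : NormalFormData s p K D D')
    (hs : 1 - 1 / p < s) (hD : 0 ≤ D) (hD' : 0 ≤ D') {T r : ℝ} (hT : 0 ≤ T) (hr : 0 < r)
    (hN : Real.exp (3 * D * r ^ 2) - 1 ≤ 1 / 8)
    (hG : T * driftLip D D' ‖dat.R1‖ r ≤ 1 / 8) :
    (∀ u v : C(Set.Icc (0 : ℝ) T, FL s p), ‖u‖ ≤ r → ‖v‖ ≤ r → ∀ u₀ : FL s p,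
      ‖dat.rhs hT u₀ u - dat.rhs hT u₀ v‖ ≤ 3 / 8 * ‖u - v‖) ∧
    (∀ u : C(Set.Icc (0 : ℝ) T, FL s p), ‖u‖ ≤ r → ∀ u₀ : FL s p,
      ‖dat.rhs hT u₀ u‖ ≤ ‖u₀‖ + 3 / 8 * ‖u‖) ∧
    ∃ Ψ : FL s p → C(Set.Icc (0 : ℝ) T, FL s p),
      ContDiffOn ℝ ∞ Ψ (Metric.ball 0 (r / 4)) ∧
      ∀ u₀ : FL s p, ‖u₀‖ < r / 4 → ‖Ψ u₀‖ ≤ r / 2 ∧ IsNFSolution K u₀ (Ψ u₀) ∧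
        ∀ u : C(Set.Icc (0 : ℝ) T, FL s p), IsNFSolution K u₀ u → u = Ψ u₀ := by
  have : Fact (0 ≤ T) := ⟨hT⟩
  set Q := nonlinearPart (propFlow s p) dat.N0 dat.N1 dat.R1 hT with hQ
  have hlip : ∀ u v : C(Set.Icc (0 : ℝ) T, FL s p), ‖u‖ ≤ r → ‖v‖ ≤ r →
      ‖Q u - Q v‖ ≤ 3 / 8 * ‖u - v‖ := by
    intro u v hu hv
    refine (norm_nonlinearPart_sub_le (propFlow s p) dat.bounded_N0 dat.bounded_N1 hD hD' hT hu
      hv).trans (mul_le_mul_of_nonneg_right ?_ (norm_nonneg _))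
    linarith
  have hQ0 : Q 0 = 0 := nonlinearPart_zero _ hT
  refine ⟨fun u v hu hv u₀ => ?_, fun u hu u₀ => ?_, ?_⟩
  · rw [NormalFormData.rhs, NormalFormData.rhs, add_sub_add_left_eq_sub]
    exact hlip u v hu hv
  · have h := hlip u 0 hu (by simpa using hr.le)
    rw [hQ0, sub_zero, sub_zero] at h
    exact (norm_add_le _ _).trans (add_le_add (norm_flow_le _ _) h)
  -- The fixed point theorem is applied with M = r/2 and θ = 3/8 = 2/8 + 1/8; the data radius r/4 is
  -- below (1 - θ)M = 5r/16.
  · have e : 2 * (r / 2) = r := by ring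
    obtain ⟨Ψ, hΨ, h⟩ := exists_contDiff_fixedPoint (flow (propFlow s p) T)
      (fun f => norm_flow_le _ f) (contDiff_nonlinearPart (propFlow s p) dat.bounded_N0
        dat.bounded_N1 (R := dat.R1) hT) hQ0 (M := r / 2) (R := r / 4) (θ := 3 / 8) (by norm_num)
      (by norm_num) (by positivity) (by rw [e]; exact hlip) (by linarith)
    refine ⟨Ψ, hΨ, fun u₀ hu₀ => ?_⟩
    obtain ⟨h1, h2, h3⟩ := h u₀ hu₀
    refine ⟨h1, (dat.isNFSolution_iff hs hT u₀ _).mpr h2, fun u hu => ?_⟩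
    have hu' := (dat.isNFSolution_iff hs hT u₀ u).mp hu
    refine h3 u ?_ hu'
    rw [e]
    -- The a priori bound puts an arbitrary solution into the ball of radius r, where the fixed
    -- point is unique.
    exact norm_lt_of_eq_flow_add (propFlow s p) dat.bounded_N0 dat.bounded_N1 hD hD' hT propL_zero
      hr hN hG (by linarith) hu'

theorem exp_sub_one_le_of_le {x : ℝ} (h0 : 0 ≤ x) (h : x ≤ 1 / 9) : Real.exp x - 1 ≤ 1 / 8 := by
  have h1 := Real.exp_bound_div_one_sub_of_interval h0 (by linarith)
  have h2 : 1 / (1 - x) ≤ 9 / 8 := by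
    rw [div_le_iff₀ (by linarith)]; linarith
  linarith

theorem exists_wellPosed (hs : 1 - 1 / p < s) {R : ℝ} (hR : 0 < R) :
    ∃ K₀ : ℝ, 1 ≤ K₀ ∧ ∀ K : ℝ, K₀ ≤ K → ∃ T₀ : ℝ, 0 < T₀ ∧ ∀ T : ℝ, 0 < T → T ≤ T₀ →
      ∃ M θ : ℝ, 0 < M ∧ 0 ≤ θ ∧ θ < 1 ∧
        (∀ u₀ : FL s p, ‖u₀‖ < R →
          (∀ v : C(Set.Icc (0 : ℝ) T, FL s p), ‖v‖ ≤ M →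
            ∃ w : C(Set.Icc (0 : ℝ) T, FL s p), ‖w‖ ≤ M ∧ IsNFImage K u₀ v w) ∧
          (∀ v₁ v₂ w₁ w₂ : C(Set.Icc (0 : ℝ) T, FL s p), ‖v₁‖ ≤ M → ‖v₂‖ ≤ M →
            IsNFImage K u₀ v₁ w₁ → IsNFImage K u₀ v₂ w₂ → ‖w₁ - w₂‖ ≤ θ * ‖v₁ - v₂‖)) ∧
        ∃ Ψ : FL s p → C(Set.Icc (0 : ℝ) T, FL s p),
          ContDiffOn ℝ ∞ Ψ (Metric.ball 0 R) ∧
          ∀ u₀ : FL s p, ‖u₀‖ < R →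
            ‖Ψ u₀‖ ≤ M ∧ IsNFSolution K u₀ (Ψ u₀) ∧
            ∀ u : C(Set.Icc (0 : ℝ) T, FL s p), IsNFSolution K u₀ u → u = Ψ u₀ := by
  obtain ⟨D, hD, hdat⟩ := exists_normalFormData (s := s) (p := p) hs
  -- With r = 4R the boundary terms require 3DK^{-2}(4R)² ≤ 1/9, that is, K² ≥ 432DR²; for K ≥ 1 it
  -- suffices that K exceeds the right-hand side.
  refine ⟨1 + 432 * D * R ^ 2, by nlinarith [mul_nonneg hD (sq_nonneg R)], fun K hK => ?_⟩
  have hDR : 0 ≤ 432 * D * R ^ 2 := by positivity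
  have hK1 : 1 ≤ K := by linarith
  have hK0 : 0 < K := by linarith
  obtain ⟨D', hD', ⟨dat⟩⟩ := hdat K hK1
  have hDK : 0 ≤ D * (K ^ 2)⁻¹ := by positivity
  set Λ := driftLip (D * (K ^ 2)⁻¹) D' ‖dat.R1‖ (4 * R) with hΛ
  have hΛ0 : 0 ≤ Λ := driftLip_nonneg hDK hD' (norm_nonneg _)
  have hN : Real.exp (3 * (D * (K ^ 2)⁻¹) * (4 * R) ^ 2) - 1 ≤ 1 / 8 := by
    refine exp_sub_one_le_of_le (by positivity) ?_
    rw [show 3 * (D * (K ^ 2)⁻¹) * (4 * R) ^ 2 = (48 * D * R ^ 2) / K ^ 2 by field_simp; ring,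
      div_le_iff₀ (by positivity)]
    nlinarith
  -- Λ depends on K through D', hence T₀ is chosen after K. The summand 1 avoids division by zero.
  refine ⟨1 / (8 * (Λ + 1)), by positivity, fun T hT hT0 => ?_⟩
  have hG : T * Λ ≤ 1 / 8 := by
    rw [le_div_iff₀ (by positivity)] at hT0
    nlinarith
  obtain ⟨h1, h2, Ψ, hΨ, h3⟩ := dat.wellPosed hs hDK hD' hT.le (r := 4 * R) (by positivity) hN hG
  rw [show 4 * R / 4 = R by ring, show 4 * R / 2 = 2 * R by ring] at *
  refine ⟨2 * R, 3 / 8, by positivity, by norm_num, by norm_num, fun u₀ hu₀ => ⟨fun v hv => ?_,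
    fun v₁ v₂ w₁ w₂ hv₁ hv₂ hw₁ hw₂ => ?_⟩, Ψ, hΨ, h3⟩
  · refine ⟨dat.rhs hT.le u₀ v, ?_, (dat.isNFImage_iff hs hT.le u₀ v _).mpr rfl⟩
    have := h2 v (by linarith) u₀
    linarith
  · rw [(dat.isNFImage_iff hs hT.le u₀ _ _).mp hw₁, (dat.isNFImage_iff hs hT.le u₀ _ _).mp hw₂]
    exact h1 v₁ v₂ (by linarith) (by linarith) u₀

theorem exists_nfConverges (hs : 1 - 1 / p < s) {K : ℝ} (hK : 1 ≤ K) {T : ℝ} (hT : 0 < T)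
    (u : C(Set.Icc (0 : ℝ) T, FL s p)) : NFConverges K u := by
  obtain ⟨D, hD, hdat⟩ := exists_normalFormData (s := s) (p := p) hs
  obtain ⟨D', hD', ⟨dat⟩⟩ := hdat K hK
  exact dat.nfConverges hs hT.le u

end WellPosedness


/-! ### The first generation on the diagonal -/

section Diagonal

variable {K p : ℝ}

/-- The tree of the first generation. -/
def cherry : OrderedTree 1 where
  node _ := []
  root_first _ _ := rfl
  grows k hk := absurd (by omega) hk
  injective := Function.injective_of_subsingleton _

theorem node_one (T : OrderedTree 1) (k : Fin 1) : T.node k = [] :=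
  T.root_first k (by omega)

theorem nonterminal_one (T : OrderedTree 1) : T.nonterminal = {[]} := by
  ext a
  rw [OrderedTree.nonterminal, Finset.mem_image, Finset.mem_singleton]
  constructor
  · rintro ⟨k, -, rfl⟩; exact node_one T k
  · rintro rfl; exact ⟨0, Finset.mem_univ _, node_one T 0⟩

theorem nodes_one (T : OrderedTree 1) : T.nodes = {[], [0], [1], [2]} := by
  rw [OrderedTree.nodes, nonterminal_one]
  decide

theorem terminal_one (T : OrderedTree 1) : T.terminal = {[0], [1], [2]} := by
  rw [OrderedTree.terminal, nonterminal_one, nodes_one]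
  decide

theorem prod_terminal_one {M : Type*} [CommMonoid M] (T : OrderedTree 1) (f : Node → M) :
    ∏ a ∈ T.terminal, f a = f [0] * f [1] * f [2] := by
  rw [terminal_one, Finset.prod_insert (by decide), Finset.prod_insert (by decide),
    Finset.prod_singleton, mul_assoc]

theorem sgn_one (T : OrderedTree (0 + 1)) : T.sgn = 1 := by
  rw [OrderedTree.sgn, pow_zero, one_mul]
  refine Finset.prod_eq_one fun k _ => ?_
  rw [node_one T k]; simp [Node.sign]

theorem phase_zero {j : ℕ} (T : OrderedTree (j + 1)) (n : Node → Freq) : T.phase 0 n = 1 := by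
  simp [OrderedTree.phase]

theorem root_eq_one {T : OrderedTree 1} {n : Node → Freq} {m : Freq} (hn : n ∈ T.indexFn m) :
    m = n [0] - n [1] + n [2] := by
  rw [← hn.2.1]
  exact (hn.2.2 [] (by rw [nonterminal_one]; exact Finset.mem_singleton_self _)).1

/-- The form |n|₋² vanishes on the line n₁ = n₂, and this line is closed under n₁ - n₂ + n₃. All
interactions are exactly resonant, so 𝒩₀ of the first generation vanishes and 𝒩₁ keeps every term.
-/
theorem modSum_one_eq_zero {T : OrderedTree (0 + 1)} {n : Node → Freq} {m : Freq}
    (hn : n ∈ T.indexFn m) (h0 : (n [0]).1 = (n [0]).2) (h1 : (n [1]).1 = (n [1]).2)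
    (h2 : (n [2]).1 = (n [2]).2) (k : Fin (0 + 1)) : T.modSum n k = 0 := by
  have hk : k = Fin.last 0 := Fin.ext (by have := k.2; rw [Fin.val_last]; omega)
  have hm := root_eq_one hn
  have hm' : m.1 = m.2 := by
    rw [hm]; simp only [Prod.fst_add, Prod.fst_sub, Prod.snd_add, Prod.snd_sub, h0, h1, h2]
  rw [hk, OrderedTree.modSum_last]
  refine Finset.sum_eq_zero fun l _ => ?_
  rw [node_one T l, modulation, hn.2.1]
  simp [hsq, h0, h1, h2, hm']

theorem near_of_modSum_eq_zero (hK : 0 ≤ K) {J : ℕ} {T : OrderedTree J} {n : Node → Freq}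
    {k : Fin J} (h : T.modSum n k = 0) : T.Near K p n k := by
  rw [OrderedTree.Near, h, Int.cast_zero, abs_zero]
  exact Real.rpow_nonneg (by positivity) _

theorem diagonal_of_prod_ne_zero {v : Freq → ℂ} (hv : ∀ n : Freq, n.1 ≠ n.2 → v n = 0) (T : OrderedTree 1) {n : Node → Freq}
    (h : ∏ a ∈ T.terminal, a.star (v (n a)) ≠ 0) :
    (n [0]).1 = (n [0]).2 ∧ (n [1]).1 = (n [1]).2 ∧ (n [2]).1 = (n [2]).2 := by
  have h' := Finset.prod_ne_zero_iff.mp h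
  rw [terminal_one] at h'
  have key : ∀ a : Node, a.star (v (n a)) ≠ 0 → (n a).1 = (n a).2 := by
    intro a ha
    by_contra hne
    rw [hv _ hne] at ha
    exact ha (by rw [← norm_eq_zero, Node.norm_star, norm_zero])
  exact ⟨key _ (h' _ (by simp)), key _ (h' _ (by simp)), key _ (h' _ (by simp))⟩

theorem termN0_diagonal {v : Freq → ℂ} (hv : ∀ n : Freq, n.1 ≠ n.2 → v n = 0) (hK : 0 ≤ K)
    (T : OrderedTree (0 + 1)) {n : Node → Freq} {m : Freq} (hn : n ∈ T.indexFn m) (t : ℝ) :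
    termN0 K p T t v n = 0 := by
  rw [termN0_eq]
  by_cases h : ∏ a ∈ T.terminal, a.star (v (n a)) = 0
  · rw [h, mul_zero, mul_zero]
  · obtain ⟨h0, h1, h2⟩ := diagonal_of_prod_ne_zero hv T h
    rw [coefN0, if_neg, zero_mul]
    intro hfar
    exact hfar 0 (near_of_modSum_eq_zero hK (modSum_one_eq_zero hn h0 h1 h2 0))

theorem termN1_diagonal {v : Freq → ℂ} (hv : ∀ n : Freq, n.1 ≠ n.2 → v n = 0) (hK : 0 ≤ K)
    (T : OrderedTree (0 + 1)) {n : Node → Freq} {m : Freq} (hn : n ∈ T.indexFn m) :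
    termN1 K p T 0 v n = Complex.I * ∏ a ∈ T.terminal, a.star (v (n a)) := by
  rw [termN1_eq, phase_zero, one_mul]
  by_cases h : ∏ a ∈ T.terminal, a.star (v (n a)) = 0
  · rw [h, mul_zero, mul_zero]
  · obtain ⟨h0, h1, h2⟩ := diagonal_of_prod_ne_zero hv T h
    rw [coefN1, if_pos, sgn_one]
    · simp
    · exact ⟨fun k => k.elim0, near_of_modSum_eq_zero hK (modSum_one_eq_zero hn h0 h1 h2 _)⟩

/-- The indicator function of a set of diagonal frequencies. -/
noncomputable def diagInd (A : Finset ℤ) (n : Freq) : ℝ := if n.1 = n.2 ∧ n.1 ∈ A then 1 else 0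

theorem diagInd_nonneg (A : Finset ℤ) (n : Freq) : 0 ≤ diagInd A n := by
  unfold diagInd; split_ifs <;> norm_num

theorem diagInd_diag {A : Finset ℤ} {k : ℤ} (hk : k ∈ A) : diagInd A (k, k) = 1 :=
  if_pos ⟨rfl, hk⟩

theorem diagInd_off (A : Finset ℤ) {n : Freq} (hn : n.1 ≠ n.2) : diagInd A n = 0 :=
  if_neg fun h => hn h.1

theorem support_diagInd_finite (A : Finset ℤ) :
    (Function.support fun n => (diagInd A n : ℂ)).Finite := by
  refine ((A.image fun k : ℤ => ((k, k) : Freq)).finite_toSet).subset fun n hn => ?_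
  by_contra h
  refine hn ?_
  have : diagInd A n = 0 := if_neg fun hA => h ?_
  · simp [this]
  · rw [Finset.mem_coe, Finset.mem_image]
    exact ⟨n.1, hA.2, Prod.ext rfl hA.1⟩

theorem prod_star_diagInd (A : Finset ℤ) (T : OrderedTree 1) (n : Node → Freq) :
    ∏ a ∈ T.terminal, a.star ((diagInd A (n a) : ℝ) : ℂ) =
      ((∏ a ∈ T.terminal, diagInd A (n a) : ℝ) : ℂ) := by
  rw [Complex.ofReal_prod]
  exact Finset.prod_congr rfl fun a _ => Node.star_ofReal a _

theorem calN0_diagInd (A : Finset ℤ) (hK : 0 ≤ K) (m : Freq) :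
    calN0 K p 0 0 (fun n => (diagInd A n : ℂ)) m = 0 := by
  refine Finset.sum_eq_zero fun T _ => ?_
  rw [tsum_congr fun n : T.indexFn m => termN0_diagonal (K := K) (p := p)
    (v := fun n => (diagInd A n : ℂ)) (fun n hn => by rw [diagInd_off A hn, Complex.ofReal_zero])
    hK T n.2 0, tsum_zero]

/-- The number of the nonzero terms of `𝒩₁` of the first generation. -/
noncomputable def diagCount (A : Finset ℤ) (m : Freq) : ℝ :=
  ∑ T : OrderedTree (0 + 1), ∑' n : T.indexFn m, ∏ a ∈ T.terminal, diagInd A (n.1 a)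

theorem termN1_diagInd (A : Finset ℤ) (hK : 0 ≤ K) (T : OrderedTree (0 + 1)) {m : Freq}
    (n : T.indexFn m) : termN1 K p T 0 (fun n => (diagInd A n : ℂ)) n.1 =
      Complex.I * ((∏ a ∈ T.terminal, diagInd A (n.1 a) : ℝ) : ℂ) := by
  rw [termN1_diagonal (fun n hn => by rw [diagInd_off A hn, Complex.ofReal_zero]) hK T n.2,
    prod_star_diagInd]

theorem calN1_diagInd (A : Finset ℤ) (hK : 0 ≤ K) (m : Freq) :
    calN1 K p 0 0 (fun n => (diagInd A n : ℂ)) m = Complex.I * (diagCount A m : ℂ) := by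
  rw [calN1, diagCount, Complex.ofReal_sum, Finset.mul_sum]
  refine Finset.sum_congr rfl fun T _ => ?_
  rw [Complex.ofReal_tsum, ← tsum_mul_left]
  exact tsum_congr fun n => termN1_diagInd A hK T n

theorem calR1_diagInd (A : Finset ℤ) (n : Freq) :
    calR1 (fun n => (diagInd A n : ℂ)) n = Complex.I *
      ((-(diagInd A n) ^ 3 + 2 * (∑' m, diagInd A m ^ 2) * diagInd A n : ℝ) : ℂ) := by
  have h : ∀ m, (diagInd A m : ℂ) * (starRingEnd ℂ) (diagInd A m : ℂ) =
      ((diagInd A m ^ 2 : ℝ) : ℂ) := fun m => by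
    rw [Complex.conj_ofReal]; push_cast; ring
  rw [calR1]
  simp only [h]
  rw [← Complex.ofReal_tsum]
  push_cast
  ring

/-- The mass dominates each single square. The resonant part therefore has the same sign as the
count in 𝒩₁ and cannot cancel it. -/
theorem calR1_diagInd_nonneg (A : Finset ℤ) (hS : Summable fun m => diagInd A m ^ 2) (n : Freq) :
    0 ≤ -(diagInd A n) ^ 3 + 2 * (∑' m, diagInd A m ^ 2) * diagInd A n := by
  have h1 : diagInd A n ^ 2 ≤ ∑' m, diagInd A m ^ 2 := hS.le_tsum n fun _ _ => sq_nonneg _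
  have h2 := diagInd_nonneg A n
  nlinarith [sq_nonneg (diagInd A n), mul_nonneg h2 (sub_nonneg.mpr h1)]

theorem diagCount_off (A : Finset ℤ) {m : Freq} (hm : m.1 ≠ m.2) : diagCount A m = 0 := by
  refine Finset.sum_eq_zero fun T _ => ?_
  refine (tsum_congr (g := fun _ => (0 : ℝ)) fun n => ?_).trans tsum_zero
  by_contra h
  have h' : ∏ a ∈ T.terminal, a.star ((diagInd A (n.1 a) : ℝ) : ℂ) ≠ 0 := by
    rw [prod_star_diagInd]; exact_mod_cast h
  obtain ⟨h0, h1, h2⟩ := diagonal_of_prod_ne_zero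
    (v := fun n => (diagInd A n : ℂ))
    (fun n hn => by rw [diagInd_off A hn, Complex.ofReal_zero]) T h'
  refine hm ?_
  rw [root_eq_one n.2]
  simp only [Prod.fst_add, Prod.fst_sub, Prod.snd_add, Prod.snd_sub, h0, h1, h2]

/-- An index function on the tree of the first generation. -/
def cherryIndex (m a b : ℤ) : Node → Freq := fun x =>
  if x = [] then (m, m) else if x = [0] then (a, a) else if x = [1] then (b, b) else
    if x = [2] then (m - a + b, m - a + b) else 0

theorem cherryIndex_mem {m a b : ℤ} (ha : a < m) (hab : a < b) :
    cherryIndex m a b ∈ cherry.indexFn (m, m) := by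
  refine ⟨fun x hx => ?_, by simp [cherryIndex], fun x hx => ?_⟩
  · rw [nodes_one] at hx
    simp only [Finset.mem_insert, Finset.mem_singleton, not_or] at hx
    simp [cherryIndex, hx]
  · rw [nonterminal_one, Finset.mem_singleton] at hx
    subst hx
    constructor
    · simp [cherryIndex]
    · simp [cherryIndex, Set.disjoint_left]
      omega

/-- For m in [3N, 4N) choose a in [N, 2N) and b in [2N, 3N) freely. The third frequency m - a + b
then lies in [N, 6N), and a < b, a < m exclude the forbidden coincidences. This gives N² index
functions. -/
theorem le_diagCount {N : ℕ} (A : Finset ℤ) (hA : A = Finset.Ico (N : ℤ) (6 * N))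
    {m : ℤ} (hm : m ∈ Finset.Ico (3 * N : ℤ) (4 * N))
    (hsum : Summable fun n : cherry.indexFn (m, m) => ∏ a ∈ cherry.terminal, diagInd A (n.1 a)) :
    (N : ℝ) ^ 2 ≤ diagCount A (m, m) := by
  rw [Finset.mem_Ico] at hm
  have hnn : ∀ (T : OrderedTree (0 + 1)) (n : Node → Freq),
      0 ≤ ∏ a ∈ T.terminal, diagInd A (n a) := fun T n =>
    Finset.prod_nonneg fun a _ => diagInd_nonneg A _
  have h1 : ∑' n : cherry.indexFn (m, m), ∏ a ∈ cherry.terminal, diagInd A (n.1 a) ≤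
      diagCount A (m, m) :=
    Finset.single_le_sum (f := fun T : OrderedTree (0 + 1) =>
      ∑' n : T.indexFn (m, m), ∏ a ∈ T.terminal, diagInd A (n.1 a))
      (fun T _ => tsum_nonneg fun n => hnn T n.1) (Finset.mem_univ (cherry : OrderedTree (0 + 1)))
  refine le_trans ?_ h1
  let e : Fin N × Fin N → cherry.indexFn (m, m) := fun z =>
    ⟨cherryIndex m (N + (z.1 : ℕ)) (2 * N + (z.2 : ℕ)),
      cherryIndex_mem (by have := z.1.2; omega) (by have := z.1.2; omega)⟩
  have he : Function.Injective e := by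
    intro z w h
    have h' := congrArg Subtype.val h
    have ha := congrArg Prod.fst (congrFun h' [0])
    have hb := congrArg Prod.fst (congrFun h' [1])
    simp [e, cherryIndex] at ha hb
    exact Prod.ext (Fin.ext ha) (Fin.ext hb)
  have hval : ∀ z, ∏ a ∈ cherry.terminal, diagInd A ((e z).1 a) = 1 := by
    intro z
    have hz1 := z.1.2
    have hz2 := z.2.2
    rw [prod_terminal_one]
    have v0 : (e z).1 [0] = ((N : ℤ) + (z.1 : ℕ), (N : ℤ) + (z.1 : ℕ)) := by simp [e, cherryIndex]
    have v1 : (e z).1 [1] = (2 * (N : ℤ) + (z.2 : ℕ), 2 * (N : ℤ) + (z.2 : ℕ)) := by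
      simp [e, cherryIndex]
    have v2 : (e z).1 [2] = (m - ((N : ℤ) + (z.1 : ℕ)) + (2 * (N : ℤ) + (z.2 : ℕ)),
        m - ((N : ℤ) + (z.1 : ℕ)) + (2 * (N : ℤ) + (z.2 : ℕ))) := by
      simp [e, cherryIndex]
    rw [v0, v1, v2, diagInd_diag, diagInd_diag, diagInd_diag]
    · norm_num
    all_goals rw [hA, Finset.mem_Ico]; omega
  have h2 := hsum.sum_le_tsum (Finset.univ.map ⟨e, he⟩) fun n _ => hnn cherry n.1
  rw [Finset.sum_map] at h2
  refine le_trans (le_of_eq ?_) h2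
  refine Eq.trans ?_ (Finset.sum_congr rfl fun z _ => hval z).symm
  simp [sq]

end Diagonal


/-! ### The cubic expansion of small solutions -/

section Expansion

theorem exp_sub_one_le_mul {x c : ℝ} (hx : x ≤ c) (hx0 : 0 ≤ x) :
    Real.exp x - 1 ≤ Real.exp c * x := by
  have h1 : 1 - x ≤ Real.exp (-x) := by linarith [Real.add_one_le_exp (-x)]
  have h2 : Real.exp x * (1 - x) ≤ 1 := by
    calc Real.exp x * (1 - x) ≤ Real.exp x * Real.exp (-x) := by gcongr
      _ = 1 := by rw [← Real.exp_add, add_neg_cancel, Real.exp_zero]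
  have h3 : Real.exp x * x ≤ Real.exp c * x := by gcongr
  linarith

/-- The nonlinearity has no part of degree below three, so its Lipschitz constant is O(r²). For
arbitrary K and T, small data thus do the work of large K and small T. -/
theorem exists_lip_le_sq {D D' κ T : ℝ} (hD : 0 ≤ D) (hD' : 0 ≤ D') (hκ : 0 ≤ κ) (hT : 0 ≤ T) :
    ∃ C : ℝ, 0 ≤ C ∧ ∀ r : ℝ, 0 ≤ r → r ≤ 1 →
      2 * (Real.exp (3 * D * r ^ 2) - 1) + T * driftLip D D' κ r ≤ C * r ^ 2 := by
  set c₁ := Real.exp (3 * D) * (3 * D) with hc₁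
  set c₂ := Real.exp (3 * D') * (3 * D') with hc₂
  set c₃ := Real.exp (9 * D * (1 + κ) ^ 2) * (9 * D * (1 + κ) ^ 2) with hc₃
  refine ⟨2 * c₁ + T * (c₂ + 3 * κ + c₃ * (1 + 3 * κ)), by positivity, fun r hr hr1 => ?_⟩
  have hr2 : r ^ 2 ≤ 1 := pow_le_one₀ hr hr1
  have hle : ∀ c : ℝ, 0 ≤ c → Real.exp (c * r ^ 2) - 1 ≤ Real.exp c * c * r ^ 2 := by
    intro c hc
    have := exp_sub_one_le_mul (x := c * r ^ 2) (c := c) (by nlinarith) (by positivity)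
    linarith
  have h1 := hle (3 * D) (by positivity)
  have h2 := hle (3 * D') (by positivity)
  have hm : max r (κ * r ^ 3) ≤ (1 + κ) * r := by
    refine max_le (by nlinarith [mul_nonneg hκ hr]) ?_
    calc κ * r ^ 3 = κ * r * r ^ 2 := by ring
      _ ≤ κ * r * 1 := by gcongr
      _ ≤ (1 + κ) * r := by linarith
  have hm0 : 0 ≤ max r (κ * r ^ 3) := hr.trans (le_max_left _ _)
  have h3 : Real.exp (3 * (3 * D) * (max r (κ * r ^ 3)) ^ 2) - 1 ≤ c₃ * r ^ 2 := by
    refine le_trans ?_ (hle (9 * D * (1 + κ) ^ 2) (by positivity))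
    rw [sub_le_sub_iff_right, Real.exp_le_exp]
    calc 3 * (3 * D) * (max r (κ * r ^ 3)) ^ 2 ≤ 3 * (3 * D) * ((1 + κ) * r) ^ 2 := by gcongr
      _ = _ := by ring
  have h4 : max 1 (3 * κ * r ^ 2) ≤ 1 + 3 * κ :=
    max_le (by linarith) (by nlinarith)
  have h5 : (Real.exp (3 * (3 * D) * (max r (κ * r ^ 3)) ^ 2) - 1) * max 1 (3 * κ * r ^ 2) ≤
      (c₃ * r ^ 2) * (1 + 3 * κ) :=
    mul_le_mul h3 h4 (zero_le_one.trans (le_max_left _ _)) (by positivity)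
  have h6 : driftLip D D' κ r ≤ (c₂ + 3 * κ + c₃ * (1 + 3 * κ)) * r ^ 2 := by
    unfold driftLip
    linarith
  have h7 := mul_le_mul_of_nonneg_left h6 hT
  linarith

variable {E : Type*} [NormedAddCommGroup E] [NormedSpace ℝ E] [CompleteSpace E]
  (S : IsometricFlow E) {T : ℝ}

theorem diag3_smul (R : ContinuousMultilinearMap ℝ (fun _ : Fin 3 => E) E) (c : ℝ) (x : E) :
    diag3 R (c • x) = c ^ 3 • diag3 R x := by
  have h := R.map_smul_univ (fun _ => c) (fun _ => x)
  simpa [diag3] using h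

theorem duhamel_const (hT : 0 ≤ T) {q : E} (hq : ∀ t, S.map t q = q) (t : Set.Icc (0 : ℝ) T) :
    duhamel S hT (ContinuousMap.const _ q) t = (t : ℝ) • q := by
  have h : ∀ t', duhamelFn S hT (ContinuousMap.const _ q) t' = q := fun t' => hq _
  rw [duhamel_apply, intervalIntegral.integral_congr (g := fun _ => q) fun t' _ => h t',
    intervalIntegral.integral_const, sub_zero, map_smul, hq]

/-- A single Picard step. Since Q(u) = O(ε³), replacing u by εg inside Q changes it by O(ε⁵). As g
and q are invariant under the flow and the cubic boundary term vanishes at g, Q(εg) at time t is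
tε³q up to O(ε⁵). -/
theorem exists_cubic_expansion {A B : OddFamily E E}
    {R : ContinuousMultilinearMap ℝ (fun _ : Fin 3 => E) E} {D D' : ℝ}
    (hA : A.BoundedBy D) (hB : B.BoundedBy D') (hD : 0 ≤ D)
    (hD' : 0 ≤ D') (hT : 0 ≤ T) {g q : E} (hg : ∀ t, S.map t g = g) (hAg : diag3 (A 0) g = 0)
    (hq : q = diag3 (B 0) g + diag3 R g) (hSq : ∀ t, S.map t q = q) :
    ∃ C δ : ℝ, 0 < δ ∧ ∀ ε : ℝ, 0 < ε → ε ≤ δ → ∀ u : C(Set.Icc (0 : ℝ) T, E),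
      ‖u‖ ≤ 2 * (ε * ‖g‖) → u = flow S T (ε • g) + nonlinearPart S A B R hT u →
      ∀ t : Set.Icc (0 : ℝ) T, ‖u t - (ε • g + (ε ^ 3 * t) • q)‖ ≤ C * ε ^ 5 := by
  obtain ⟨C₁, hC₁, hlip⟩ := exists_lip_le_sq hD hD' (norm_nonneg R) hT
  set C₂ := C₁ ^ 2 + 2 * D ^ 2 +
    T * (D' ^ 2 + Real.exp (3 * D) * (3 * D) * ‖R‖) with hC₂
  set G := ‖g‖ with hG
  have hG0 : 0 ≤ G := norm_nonneg g
  refine ⟨C₂ * (2 * G) ^ 5, 1 / (2 * (G + 1) * (1 + D + D')), by positivity,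
    fun ε hε hεδ u hu hue t => ?_⟩
  set r := 2 * (ε * G) with hr
  have hr0 : 0 ≤ r := by positivity
  have hr1 : r * (1 + D + D') ≤ 1 := by
    rw [le_div_iff₀ (by positivity)] at hεδ
    have : 2 * (ε * G) * (1 + D + D') ≤ ε * (2 * (G + 1) * (1 + D + D')) := by
      nlinarith [mul_pos hε (show 0 < 1 + D + D' by positivity)]
    exact this.trans hεδ
  have hrle : r ≤ 1 := by nlinarith [mul_nonneg hr0 hD, mul_nonneg hr0 hD']
  have hDr : ∀ x : E, ‖x‖ ≤ r → D * ‖x‖ ^ 2 ≤ 1 := by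
    intro x hx
    have : ‖x‖ ^ 2 ≤ r := by nlinarith [norm_nonneg x]
    nlinarith [mul_nonneg hr0 hD']
  have hDr' : ∀ x : E, ‖x‖ ≤ r → D' * ‖x‖ ^ 2 ≤ 1 := by
    intro x hx
    have : ‖x‖ ^ 2 ≤ r := by nlinarith [norm_nonneg x]
    nlinarith [mul_nonneg hr0 hD]
  set Q := nonlinearPart S A B R hT with hQ
  set w := flow S T (ε • g) with hw
  have hwt : ∀ t, w t = ε • g := fun t => by rw [hw, flow_apply, map_smul, hg]
  have hεg : ‖ε • g‖ ≤ r := by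
    rw [norm_smul, Real.norm_of_nonneg hε.le, hr]
    have : 0 ≤ ε * G := by positivity
    linarith
  have hwr : ‖w‖ ≤ r := (norm_flow_le S _).trans hεg
  have hlipQ : ∀ v z : C(Set.Icc (0 : ℝ) T, E), ‖v‖ ≤ r → ‖z‖ ≤ r →
      ‖Q v - Q z‖ ≤ C₁ * r ^ 2 * ‖v - z‖ := fun v z hv hz =>
    (norm_nonlinearPart_sub_le S hA hB hD hD' hT hv hz).trans
      (mul_le_mul_of_nonneg_right (hlip r hr0 hrle) (norm_nonneg _))
  have h1 : ‖Q u‖ ≤ C₁ * r ^ 3 := by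
    have h := hlipQ u 0 hu (by simpa using hr0)
    rw [hQ, nonlinearPart_zero, sub_zero, sub_zero] at h
    calc ‖Q u‖ ≤ C₁ * r ^ 2 * ‖u‖ := h
      _ ≤ C₁ * r ^ 2 * r := by gcongr
      _ = _ := by ring
  have h2 : ‖Q u - Q w‖ ≤ C₁ ^ 2 * r ^ 5 := by
    have e : u - w = Q u := by nth_rewrite 1 [hue]; abel
    have h := hlipQ u w hu hwr
    rw [e] at h
    calc ‖Q u - Q w‖ ≤ C₁ * r ^ 2 * ‖Q u‖ := h
      _ ≤ C₁ * r ^ 2 * (C₁ * r ^ 3) := by gcongr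
      _ = _ := by ring
  have h3 : ‖oddSum A (ε • g)‖ ≤ D ^ 2 * r ^ 5 := by
    have h := hA.norm_oddSum_sub_zero_le hD (hDr _ hεg)
    have e : (A 0 fun _ => ε • g) = 0 := by
      have := diag3_smul (A 0) ε g
      rw [hAg, smul_zero] at this
      exact this
    rw [e, sub_zero] at h
    calc ‖oddSum A (ε • g)‖ ≤ ‖ε • g‖ * (D * ‖ε • g‖ ^ 2) ^ 2 := h
      _ ≤ r * (D * r ^ 2) ^ 2 := by gcongr
      _ = _ := by ring
  have h4 : ‖drift A B R (ε • g) - ε ^ 3 • q‖ ≤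
      (D' ^ 2 + Real.exp (3 * D) * (3 * D) * ‖R‖) * r ^ 5 := by
    have h := norm_drift_sub_cubic_le hA hB (R := R) le_rfl hD' hD (hDr' _ hεg)
    have e : diag3 (B 0) (ε • g) + diag3 R (ε • g) = ε ^ 3 • q := by
      rw [diag3_smul, hq, smul_add]
      congr 1
      exact diag3_smul R ε g
    rw [e] at h
    refine h.trans ?_
    have h5 : Real.exp (3 * D * ‖ε • g‖ ^ 2) - 1 ≤ Real.exp (3 * D) * (3 * D * r ^ 2) := by
      have hx : ‖ε • g‖ ^ 2 ≤ 1 := pow_le_one₀ (norm_nonneg _) (hεg.trans hrle)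
      refine (exp_sub_one_le_mul (c := 3 * D) (by nlinarith) (by positivity)).trans ?_
      gcongr
    calc _ ≤ r * (D' * r ^ 2) ^ 2 +
        Real.exp (3 * D) * (3 * D * r ^ 2) * (‖R‖ * r ^ 3) := by gcongr
      _ = _ := by ring
  set d := drift (A.pw (Set.Icc (0 : ℝ) T)) (B.pw _) (pointwise R) w with hd
  have h6 : ‖d - ContinuousMap.const _ (ε ^ 3 • q)‖ ≤
      (D' ^ 2 + Real.exp (3 * D) * (3 * D) * ‖R‖) * r ^ 5 := by
    rw [ContinuousMap.norm_le _ (by positivity)]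
    intro t'
    rw [ContinuousMap.sub_apply, hd, drift_pw hA hB, hwt]
    exact h4
  have h7 : ‖duhamel S hT d t - (ε ^ 3 * t) • q‖ ≤
      T * ((D' ^ 2 + Real.exp (3 * D) * (3 * D) * ‖R‖) * r ^ 5) := by
    have e : (ε ^ 3 * t) • q = duhamel S hT (ContinuousMap.const _ (ε ^ 3 • q)) t := by
      rw [duhamel_const S hT (fun t => by rw [map_smul, hSq]), smul_smul, mul_comm]
    rw [e, ← ContinuousMap.sub_apply, ← map_sub]
    exact ((ContinuousMap.norm_coe_le_norm _ t).trans (norm_duhamel_le S hT _)).trans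
      (mul_le_mul_of_nonneg_left h6 hT)
  have hQw : Q w t = oddSum A (ε • g) - S.map t (oddSum A (ε • g)) + duhamel S hT d t := by
    rw [hQ, nonlinearPart, ContinuousMap.add_apply, ContinuousMap.sub_apply, flow_apply,
      hA.oddSum_pw, hA.oddSum_pw, hwt, hwt]
  have e : u t - (ε • g + (ε ^ 3 * t) • q) = (Q u - Q w) t + (oddSum A (ε • g) -
      S.map t (oddSum A (ε • g)) + (duhamel S hT d t - (ε ^ 3 * t) • q)) := by
    have : u t = ε • g + Q u t := by
      conv_lhs => rw [hue]
      rw [ContinuousMap.add_apply, hwt]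
    rw [this, ContinuousMap.sub_apply, hQw]
    abel
  rw [e]
  have h8 := (ContinuousMap.norm_coe_le_norm (Q u - Q w) t).trans h2
  have h9 := norm_add_le ((Q u - Q w) t) (oddSum A (ε • g) -
      S.map t (oddSum A (ε • g)) + (duhamel S hT d t - (ε ^ 3 * t) • q))
  have h10 := norm_add_le (oddSum A (ε • g) - S.map t (oddSum A (ε • g)))
    (duhamel S hT d t - (ε ^ 3 * t) • q)
  have h11 := norm_sub_le (oddSum A (ε • g)) (S.map t (oddSum A (ε • g)))
  rw [S.norm_map] at h11
  have e5 : C₂ * (2 * G) ^ 5 * ε ^ 5 = C₂ * r ^ 5 := by rw [hr]; ring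
  rw [e5, hC₂]
  linarith

end Expansion


/-! ### Third order coefficients of `C³` maps -/

section Taylor

open Filter Topology Asymptotics

/-- The third difference P(4ε) - 3P(3ε) + 3P(2ε) - P(ε) of the polynomial is 6c₃ε³. It uses positive
ε only. -/
theorem eq_zero_of_cubic_isLittleO {c₀ c₁ c₂ c₃ : ℂ}
    (h : (fun ε : ℝ => c₀ + (ε : ℂ) * c₁ + (ε : ℂ) ^ 2 * c₂ + (ε : ℂ) ^ 3 * c₃)
      =o[𝓝[>] 0] fun ε : ℝ => ε ^ 3) : c₃ = 0 := by
  have hscale : ∀ k : ℝ, 0 < k → (fun ε : ℝ => c₀ + ((k * ε : ℝ) : ℂ) * c₁ +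
      ((k * ε : ℝ) : ℂ) ^ 2 * c₂ + ((k * ε : ℝ) : ℂ) ^ 3 * c₃) =o[𝓝[>] 0] fun ε : ℝ => ε ^ 3 := by
    intro k hk
    have ht : Tendsto (fun ε : ℝ => k * ε) (𝓝[>] 0) (𝓝[>] 0) := by
      refine tendsto_nhdsWithin_iff.mpr ⟨?_, ?_⟩
      · have : Tendsto (fun ε : ℝ => k * ε) (𝓝 0) (𝓝 (k * 0)) :=
          (continuous_const.mul continuous_id).tendsto 0
        rw [mul_zero] at this
        exact this.mono_left nhdsWithin_le_nhds
      · filter_upwards [self_mem_nhdsWithin] with ε hε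
        exact mul_pos hk hε
    refine (h.comp_tendsto ht).trans_isBigO ?_
    refine IsBigO.of_bound (k ^ 3) (Eventually.of_forall fun ε => ?_)
    simp only [Function.comp_apply, norm_pow, mul_pow, norm_mul, Real.norm_of_nonneg hk.le]
    exact le_rfl
  have h4 := (((hscale 4 (by norm_num)).sub ((hscale 3 (by norm_num)).const_mul_left 3)).add
    ((hscale 2 (by norm_num)).const_mul_left 3)).sub (hscale 1 (by norm_num))
  have h5 : (fun ε : ℝ => (ε : ℂ) ^ 3 * (6 * c₃)) =o[𝓝[>] 0] fun ε : ℝ => ε ^ 3 := by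
    refine h4.congr_left fun ε => ?_
    push_cast
    ring
  have h6 : Tendsto (fun ε : ℝ => ‖6 * c₃‖) (𝓝[>] 0) (𝓝 0) := by
    have h7 := h5.norm_norm.tendsto_div_nhds_zero
    refine h7.congr' ?_
    filter_upwards [self_mem_nhdsWithin] with ε hε
    have hε' : (0 : ℝ) < ε := hε
    rw [norm_mul, norm_pow, Complex.norm_real, norm_pow, Real.norm_of_nonneg hε'.le]
    field_simp
  have h8 := tendsto_nhds_unique h6 tendsto_const_nhds
  simpa using h8.symm

variable {F H : Type*} [NormedAddCommGroup F] [NormedSpace ℝ F] [NormedAddCommGroup H]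
  [NormedSpace ℝ H]

/-- The third order coefficient of a `C³` map along rays is bounded by a trilinear form. -/
theorem exists_cubic_coefficient {Φ : F → H} (hΦ : ContDiffAt ℝ 3 Φ 0) :
    ∃ C : ℝ, ∀ f : F, ∃ h : H, ‖h‖ ≤ C * ‖f‖ ^ 3 ∧ ∀ (l : H →L[ℝ] ℂ) (a b : ℂ) (C' : ℝ),
      (∀ᶠ ε : ℝ in 𝓝[>] 0, ‖l (Φ (ε • f)) - ((ε : ℂ) * a + (ε : ℂ) ^ 3 * b)‖ ≤ C' * ε ^ 5) →
      l h = b := by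
  obtain ⟨u, huo, h0u, hu⟩ := ContDiffWithinAt.contDiffOn' (m := 3) le_rfl (by simp)
    (hΦ.contDiffWithinAt (s := Set.univ))
  rw [Set.insert_eq_of_mem (Set.mem_univ _), Set.univ_inter] at hu
  obtain ⟨δ, hδ, hball⟩ := Metric.isOpen_iff.mp huo 0 h0u
  have hon : ContDiffOn ℝ 3 Φ (Metric.ball 0 δ) := hu.mono hball
  set D3 := iteratedFDerivWithin ℝ 3 Φ (Metric.ball 0 δ) 0 with hD3
  -- The element h is the third Taylor coefficient D³Φ(0)(f, f, f)/6 along the ray through f. It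
  -- does not depend on the functional l, so one norm bound serves all Fourier coefficients.
  refine ⟨6⁻¹ * ‖D3‖, fun f => ⟨(6⁻¹ : ℝ) • D3 fun _ => f, ?_, fun l a b C' hl => ?_⟩⟩
  · rw [norm_smul, mul_assoc]
    have := D3.le_opNorm fun _ => f
    rw [Finset.prod_const, Finset.card_univ, Fintype.card_fin] at this
    rw [Real.norm_of_nonneg (by norm_num)]
    gcongr
  let L : ℝ →L[ℝ] F := ContinuousLinearMap.toSpanSingleton ℝ f
  have hL : ∀ ε : ℝ, L ε = ε • f := fun ε => rfl
  set I : Set ℝ := L ⁻¹' Metric.ball 0 δ with hI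
  have hIo : IsOpen I := Metric.isOpen_ball.preimage L.continuous
  have hIc : Convex ℝ I := (convex_ball (0 : F) δ).linear_preimage L.toLinearMap
  have h0I : (0 : ℝ) ∈ I := by simp [hI, hδ]
  have hψ : ContDiffOn ℝ 3 (Φ ∘ L) I := hon.comp L.contDiff.contDiffOn fun x hx => hx
  have htay := taylor_isLittleO (n := 3) hIc h0I hψ
  set e : ℕ → H := fun k => iteratedDerivWithin k (Φ ∘ L) I 0 with he
  have he3 : e 3 = D3 fun _ => f := by
    have h1 := L.iteratedFDerivWithin_comp_right hon Metric.isOpen_ball.uniqueDiffOn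
      hIo.uniqueDiffOn (x := 0) h0I (i := 3) le_rfl
    change iteratedFDerivWithin ℝ 3 (Φ ∘ L) (L ⁻¹' Metric.ball 0 δ) 0 (fun _ => 1) = _
    rw [h1, ContinuousMultilinearMap.compContinuousLinearMap_apply, map_zero]
    simp only [hL, one_smul]
    rfl
  have hT : ∀ ε : ℝ, taylorWithinEval (Φ ∘ L) 3 I 0 ε =
      e 0 + ε • e 1 + (2⁻¹ * ε ^ 2) • e 2 + (6⁻¹ * ε ^ 3) • e 3 := by
    intro ε
    rw [taylor_within_apply]
    simp [Finset.sum_range_succ, Nat.factorial, he]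
  have h1 : (fun ε : ℝ => l (Φ (ε • f)) - (l (e 0) + (ε : ℂ) * l (e 1) +
      (2⁻¹ * (ε : ℂ) ^ 2) * l (e 2) + (6⁻¹ * (ε : ℂ) ^ 3) * l (e 3))) =o[𝓝[>] 0]
      fun ε : ℝ => ε ^ 3 := by
    have h2 : (fun ε : ℝ => l ((Φ ∘ L) ε - taylorWithinEval (Φ ∘ L) 3 I 0 ε)) =o[𝓝[I] 0]
        fun ε : ℝ => (ε - 0) ^ 3 := (l.isBigO_comp _ _).trans_isLittleO htay
    rw [hIo.nhdsWithin_eq h0I] at h2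
    refine (h2.mono nhdsWithin_le_nhds).congr (fun ε => ?_) fun ε => by rw [sub_zero]
    rw [map_sub, hT, map_add, map_add, map_add, map_smul, map_smul, map_smul, Complex.real_smul,
      Complex.real_smul, Complex.real_smul, Function.comp_apply, hL]
    push_cast
    rfl
  have h2 : (fun ε : ℝ => l (Φ (ε • f)) - ((ε : ℂ) * a + (ε : ℂ) ^ 3 * b)) =o[𝓝[>] 0]
      fun ε : ℝ => ε ^ 3 := by
    have h3 : (fun ε : ℝ => l (Φ (ε • f)) - ((ε : ℂ) * a + (ε : ℂ) ^ 3 * b)) =O[𝓝[>] 0]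
        fun ε : ℝ => ε ^ 5 := by
      refine IsBigO.of_bound C' ?_
      filter_upwards [hl, self_mem_nhdsWithin] with ε hε hpos
      have hpos' : (0 : ℝ) < ε := hpos
      rwa [Real.norm_of_nonneg (by positivity)]
    refine h3.trans_isLittleO ?_
    exact (isLittleO_pow_pow (𝕜 := ℝ) (m := 3) (n := 5) (by norm_num)).mono nhdsWithin_le_nhds
  -- The assumed expansion and the Taylor expansion differ by o(ε³), so their cubic coefficients
  -- agree.
  have h4 : (fun ε : ℝ => (l (e 0)) + (ε : ℂ) * (l (e 1) - a) + (ε : ℂ) ^ 2 * (2⁻¹ * l (e 2)) +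
      (ε : ℂ) ^ 3 * (6⁻¹ * l (e 3) - b)) =o[𝓝[>] 0] fun ε : ℝ => ε ^ 3 := by
    refine (h2.sub h1).congr_left fun ε => ?_
    ring
  have h5 := eq_zero_of_cubic_isLittleO h4
  rw [← he3, map_smul, Complex.real_smul]
  push_cast
  exact sub_eq_zero.mp h5

end Taylor


/-! ### Norms of functions on the diagonal -/

section DiagonalNorms

variable {s p : ℝ} [hp : Fact (1 < p)]

theorem rpow_mul_le_norm (f : FL s p) (A : Finset ℤ) {b : ℝ} (hb : 0 ≤ b)
    (h : ∀ k ∈ A, b ≤ jap (k, k) ^ s * ‖f.coeff (k, k)‖) :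
    (A.card : ℝ) ^ (1 / p) * b ≤ ‖f‖ := by
  have hp0 : 0 < p := by linarith [hp.out]
  have h1 := ENNReal.sum_le_tsum (f := fun n : Freq =>
    (ENNReal.ofReal (jap n ^ s) * ‖f.coeff n‖ₑ) ^ p)
    (A.map ⟨fun k : ℤ => ((k, k) : Freq), fun a b hab => congrArg Prod.fst hab⟩)
  have e : ∑' n : Freq, (ENNReal.ofReal (jap n ^ s) * ‖f.coeff n‖ₑ) ^ p = ‖f‖ₑ ^ p := flE_coeff f
  rw [e, Finset.sum_map] at h1
  have h2 : ∑ _k ∈ A, ENNReal.ofReal b ^ p ≤ ‖f‖ₑ ^ p := by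
    refine (Finset.sum_le_sum fun k hk => ?_).trans h1
    refine ENNReal.rpow_le_rpow ?_ hp0.le
    change _ ≤ ENNReal.ofReal (jap (k, k) ^ s) * ‖f.coeff (k, k)‖ₑ
    rw [← ofReal_norm, ← ENNReal.ofReal_mul (Real.rpow_nonneg (jap_pos _).le _)]
    exact ENNReal.ofReal_le_ofReal (h k hk)
  rw [Finset.sum_const, nsmul_eq_mul, ← ofReal_norm, ENNReal.ofReal_rpow_of_nonneg hb hp0.le,
    ENNReal.ofReal_rpow_of_nonneg (norm_nonneg _) hp0.le, ← ENNReal.ofReal_natCast,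
    ← ENNReal.ofReal_mul (Nat.cast_nonneg _), ENNReal.ofReal_le_ofReal_iff (by positivity)] at h2
  have h3 := Real.rpow_le_rpow (by positivity) h2 (show 0 ≤ 1 / p by positivity)
  rwa [Real.mul_rpow (Nat.cast_nonneg _) (by positivity), ← Real.rpow_mul hb,
    ← Real.rpow_mul (norm_nonneg _), mul_one_div_cancel hp0.ne', Real.rpow_one, Real.rpow_one] at h3

theorem norm_le_rpow_mul (f : FL s p) (A : Finset ℤ) {b : ℝ} (hb : 0 ≤ b)
    (hf : f.coeff = fun n => (diagInd A n : ℂ))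
    (h : ∀ k ∈ A, jap (k, k) ^ s ≤ b) : ‖f‖ ≤ (A.card : ℝ) ^ (1 / p) * b := by
  have hp0 : 0 < p := by linarith [hp.out]
  set S := A.map ⟨fun k : ℤ => ((k, k) : Freq), fun a b hab => congrArg Prod.fst hab⟩ with hS
  have e : ‖f‖ₑ ^ p = ∑ n ∈ S, (ENNReal.ofReal (jap n ^ s) * ‖f.coeff n‖ₑ) ^ p := by
    rw [← flE_coeff, flE]
    refine tsum_eq_sum fun n hn => ?_
    have h0 : f.coeff n = 0 := by
      rw [hf]
      have : diagInd A n = 0 := if_neg fun hA => hn ?_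
      · simp [this]
      · rw [hS, Finset.mem_map]
        exact ⟨n.1, hA.2, Prod.ext rfl hA.1⟩
    rw [h0, enorm_zero, mul_zero, ENNReal.zero_rpow_of_pos hp0]
  have h2 : ‖f‖ₑ ^ p ≤ ∑ _k ∈ A, ENNReal.ofReal b ^ p := by
    rw [e, hS, Finset.sum_map]
    refine Finset.sum_le_sum fun k hk => ENNReal.rpow_le_rpow ?_ hp0.le
    change ENNReal.ofReal (jap (k, k) ^ s) * ‖f.coeff (k, k)‖ₑ ≤ _
    have h1 : ‖f.coeff (k, k)‖ₑ = 1 := by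
      rw [hf]
      simp only
      rw [diagInd_diag hk]
      simp
    rw [h1, mul_one]
    exact ENNReal.ofReal_le_ofReal (h k hk)
  rw [Finset.sum_const, nsmul_eq_mul, ← ofReal_norm, ENNReal.ofReal_rpow_of_nonneg hb hp0.le,
    ENNReal.ofReal_rpow_of_nonneg (norm_nonneg _) hp0.le, ← ENNReal.ofReal_natCast,
    ← ENNReal.ofReal_mul (Nat.cast_nonneg _), ENNReal.ofReal_le_ofReal_iff (by positivity)] at h2
  have h3 := Real.rpow_le_rpow (by positivity) h2 (show 0 ≤ 1 / p by positivity)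
  rwa [Real.mul_rpow (Nat.cast_nonneg _) (by positivity), ← Real.rpow_mul hb,
    ← Real.rpow_mul (norm_nonneg _), mul_one_div_cancel hp0.ne', Real.rpow_one, Real.rpow_one] at h3

/-- The quotient of ⟨(k,k)⟩ by N lies between 1 and 10; the absolute value of s covers both signs of
the exponent. -/
theorem jap_diag_rpow_bounds (s : ℝ) {N : ℕ} (hN : 1 ≤ N) {k : ℤ} (h1 : (N : ℤ) ≤ k)
    (h2 : k < 6 * N) : 10 ^ (-|s|) * (N : ℝ) ^ s ≤ jap (k, k) ^ s ∧
      jap (k, k) ^ s ≤ 10 ^ |s| * (N : ℝ) ^ s := by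
  have hN' : (1 : ℝ) ≤ N := by exact_mod_cast hN
  have hk1 : (N : ℝ) ≤ k := by exact_mod_cast h1
  have hk2 : (k : ℝ) < 6 * N := by exact_mod_cast h2
  have hlo : (N : ℝ) ≤ jap (k, k) := by
    apply Real.le_sqrt_of_sq_le
    nlinarith
  have hhi : jap (k, k) ≤ 10 * N := by
    rw [jap, Real.sqrt_le_left (by positivity)]
    nlinarith
  obtain ⟨x, hx, hx1, hx10⟩ : ∃ x : ℝ, jap (k, k) = N * x ∧ 1 ≤ x ∧ x ≤ 10 := by
    refine ⟨jap (k, k) / N, by field_simp, ?_, ?_⟩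
    · rw [le_div_iff₀ (by positivity)]; linarith
    · rw [div_le_iff₀ (by positivity)]; exact hhi
  have hx0 : 0 ≤ x := by linarith
  rw [hx, Real.mul_rpow (by positivity) hx0, mul_comm ((N : ℝ) ^ s)]
  have hNs : 0 ≤ (N : ℝ) ^ s := by positivity
  constructor
  · refine mul_le_mul_of_nonneg_right ?_ hNs
    calc (10 : ℝ) ^ (-|s|) ≤ x ^ (-|s|) :=
          Real.rpow_le_rpow_of_nonpos (by linarith) hx10 (by simp)
      _ ≤ x ^ s := Real.rpow_le_rpow_of_exponent_le hx1 (neg_abs_le s)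
  · refine mul_le_mul_of_nonneg_right ?_ hNs
    calc x ^ s ≤ x ^ |s| := Real.rpow_le_rpow_of_exponent_le hx1 (le_abs_self s)
      _ ≤ 10 ^ |s| := Real.rpow_le_rpow hx0 hx10 (abs_nonneg s)

theorem propL_eq_self {f : FL s p} (hf : ∀ n : Freq, n.1 ≠ n.2 → f.coeff n = 0) (t : ℝ) :
    propL t f = f := by
  refine FL.coeff_injective (funext fun n => ?_)
  rw [propL_coeff, propagator]
  by_cases hn : n.1 = n.2
  · simp [hsq, hn]
  · rw [hf n hn, mul_zero]

end DiagonalNorms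

/-! ### The cubic term for data on the diagonal -/

section CubicTerm

variable {σ p K D D' : ℝ} [hp : Fact (1 < p)]

/-- The cubic part of the nonlinearity under the time integral. -/
noncomputable def NormalFormData.cubic (dat : NormalFormData σ p K D D') (g : FL σ p) : FL σ p :=
  diag3 (dat.N1 0) g + diag3 dat.R1 g

theorem NormalFormData.diag3_N0_diagInd (dat : NormalFormData σ p K D D') (hK : 0 ≤ K)
    {A : Finset ℤ} {g : FL σ p} (hg : g.coeff = fun n => (diagInd A n : ℂ)) :
    diag3 (dat.N0 0) g = 0 := by
  refine FL.coeff_injective (funext fun n => ?_)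
  rw [FL.coeff_zero]
  change ((dat.N0 0) fun _ => g).coeff n = 0
  rw [dat.coeff_N0 0 0 g, frakN0, neg_zero, propagator_zero, propagator_zero, hg,
    calN0_diagInd A hK]

theorem NormalFormData.cubic_coeff (dat : NormalFormData σ p K D D') (hK : 0 ≤ K)
    {A : Finset ℤ} {g : FL σ p} (hg : g.coeff = fun n => (diagInd A n : ℂ)) (n : Freq) :
    (dat.cubic g).coeff n = Complex.I * ((diagCount A n +
      (-(diagInd A n) ^ 3 + 2 * (∑' m, diagInd A m ^ 2) * diagInd A n) : ℝ) : ℂ) := by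
  rw [NormalFormData.cubic, FL.coeff_add]
  have h1 : (diag3 (dat.N1 0) g).coeff n = Complex.I * (diagCount A n : ℂ) := by
    change ((dat.N1 0) fun _ => g).coeff n = _
    rw [dat.coeff_N1 0 0 g, frakN1, neg_zero, propagator_zero, propagator_zero, hg,
      calN1_diagInd A hK]
  have h2 : (diag3 dat.R1 g).coeff n = Complex.I *
      ((-(diagInd A n) ^ 3 + 2 * (∑' m, diagInd A m ^ 2) * diagInd A n : ℝ) : ℂ) := by
    change (dat.R1 fun _ => g).coeff n = _
    rw [dat.coeff_R1, hg, calR1_diagInd]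
  rw [h1, h2, ← mul_add, ← Complex.ofReal_add]

theorem NormalFormData.cubic_coeff_off (dat : NormalFormData σ p K D D') (hK : 0 ≤ K)
    {A : Finset ℤ} {g : FL σ p} (hg : g.coeff = fun n => (diagInd A n : ℂ)) {n : Freq}
    (hn : n.1 ≠ n.2) : (dat.cubic g).coeff n = 0 := by
  rw [dat.cubic_coeff hK hg, diagCount_off A hn, diagInd_off A hn]
  simp

/-- The coefficient is i times a sum of two nonnegative reals, so its modulus is at least the count.
-/
theorem NormalFormData.le_norm_cubic_coeff (dat : NormalFormData σ p K D D') (hK : 0 ≤ K)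
    {N : ℕ} {A : Finset ℤ} (hA : A = Finset.Ico (N : ℤ) (6 * N)) {g : FL σ p}
    (hg : g.coeff = fun n => (diagInd A n : ℂ)) {m : ℤ} (hm : m ∈ Finset.Ico (3 * N : ℤ) (4 * N)) :
    (N : ℝ) ^ 2 ≤ ‖(dat.cubic g).coeff (m, m)‖ := by
  have hS : Summable fun m => diagInd A m ^ 2 := by
    refine summable_of_hasFiniteSupport ((support_diagInd_finite A).subset fun n hn => ?_)
    rw [Function.mem_support] at hn ⊢
    intro h
    have : diagInd A n = 0 := by exact_mod_cast h
    exact hn (by rw [this]; norm_num)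
  have hsum : Summable fun n : cherry.indexFn (m, m) =>
      ∏ a ∈ cherry.terminal, diagInd A (n.1 a) := by
    refine (dat.summable_N1 (j := 0) cherry (m, m) 0 g).congr fun n => ?_
    rw [neg_zero, propagator_zero, hg, termN1_diagInd A hK, norm_mul, Complex.norm_I, one_mul,
      Complex.norm_real, Real.norm_of_nonneg (Finset.prod_nonneg fun a _ => diagInd_nonneg A _)]
  have h1 := le_diagCount A hA hm hsum
  have h2 := calR1_diagInd_nonneg A hS (m, m)
  rw [dat.cubic_coeff hK hg, norm_mul, Complex.norm_I, one_mul, Complex.norm_real]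
  exact (le_add_of_le_of_nonneg h1 h2).trans (le_abs_self _)

end CubicTerm

/-! ### Failure of `C³` regularity -/

section IllPosedness

variable {s σ p : ℝ} [hp : Fact (1 < p)]

-- The datum is ε times the indicator of N ≤ k < 6N on the null line. Its cubic coefficient at time
-- t, computed in the smoother space, has to be the one of Φ. The trilinear bound for Φ then
-- contradicts its size N² at N frequencies as N → ∞.
open Filter Topology in
theorem not_exists_contDiffAt_of_solutions {K D D' : ℝ} (dat : NormalFormData σ p K D D')
    (hσ : 1 - 1 / p < σ) (hs : s < 1 - 1 / p) (hK : 0 ≤ K) (hD : 0 ≤ D) (hD' : 0 ≤ D') {T : ℝ}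
    (hT : 0 ≤ T) {r : ℝ} (hr : 0 < r) (hN : Real.exp (3 * D * r ^ 2) - 1 ≤ 1 / 8)
    (hG : T * driftLip D D' ‖dat.R1‖ r ≤ 1 / 8) {ρ : ℝ} (hρ : 0 < ρ) (hρr : ρ ≤ r / 4) {t : ℝ}
    (ht : 0 < t) (htT : t ≤ T) :
    ¬ ∃ Φ : FL s p → FL s p, ContDiffAt ℝ 3 Φ 0 ∧
      ∀ (f : FL s p) (g : FL σ p) (u : C(Set.Icc (0 : ℝ) T, FL σ p)),
        ‖g‖ < ρ → (Function.support g.coeff).Finite → f.coeff = g.coeff →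
        IsNFSolution K g u → (Φ f).coeff = traj u t := by
  rintro ⟨Φ, hΦ, hsol⟩
  obtain ⟨-, hself, Ψ, -, hΨ⟩ := dat.wellPosed hσ hD hD' hT hr hN hG
  obtain ⟨C, hC⟩ := exists_cubic_coefficient hΦ
  have hp0 : 0 < p := by linarith [hp.out]
  have htm : t ∈ Set.Icc (0 : ℝ) T := ⟨ht.le, htT⟩
  have key : ∀ N : ℕ, 1 ≤ N → (N : ℝ) ^ (1 / p) * (10 ^ (-|s|) * (N : ℝ) ^ s * (t * (N : ℝ) ^ 2)) ≤
      |C| * (((5 * N : ℕ) : ℝ) ^ (1 / p) * (10 ^ |s| * (N : ℝ) ^ s)) ^ 3 := by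
    intro N hN1
    set A := Finset.Ico (N : ℤ) (6 * N) with hA
    obtain ⟨f, hf⟩ := exists_finite_support_coeff (s := s) (p := p) (support_diagInd_finite A)
    obtain ⟨g, hg⟩ := exists_finite_support_coeff (s := σ) (p := p) (support_diagInd_finite A)
    set q := dat.cubic g with hq
    have hSg : ∀ t, propL t g = g := propL_eq_self fun n hn => by
      rw [hg]; simp only; rw [diagInd_off A hn, Complex.ofReal_zero]
    have hSq : ∀ t, propL t q = q := propL_eq_self fun n hn => dat.cubic_coeff_off hK hg hn
    obtain ⟨C₁, δ, hδ, hexp⟩ := exists_cubic_expansion (propFlow σ p) dat.bounded_N0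
      dat.bounded_N1 (R := dat.R1) hD hD' hT hSg (dat.diag3_N0_diagInd hK hg) hq hSq
    obtain ⟨h, hh, hhl⟩ := hC f
    have hcoeff : ∀ n, h.coeff n = (t : ℂ) * q.coeff n := by
      intro n
      refine hhl (coeffL n) (g.coeff n) _ (jap n ^ (-σ) * C₁) ?_
      have hρ' : 0 < ρ / (‖g‖ + 1) := by positivity
      filter_upwards [self_mem_nhdsWithin, nhdsWithin_le_nhds (Iio_mem_nhds hδ),
        nhdsWithin_le_nhds (Iio_mem_nhds hρ')] with ε hε hεδ hερ
      have hε0 : (0 : ℝ) < ε := hε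
      have hn : ‖ε • g‖ = ε * ‖g‖ := by rw [norm_smul, Real.norm_of_nonneg hε0.le]
      have hgρ : ‖ε • g‖ < ρ := by
        rw [hn]
        have hερ' : ε < ρ / (‖g‖ + 1) := hερ
        rw [lt_div_iff₀ (by positivity)] at hερ'
        nlinarith [norm_nonneg g]
      obtain ⟨hu1, hu2, -⟩ := hΨ (ε • g) (by linarith)
      set u := Ψ (ε • g) with hu
      have hueq := (dat.isNFSolution_iff hσ hT _ u).mp hu2
      -- From ‖u‖ ≤ ‖εg‖ + (3/8)‖u‖, which even gives the factor 8/5.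
      have hunorm : ‖u‖ ≤ 2 * (ε * ‖g‖) := by
        have h1 := hself u (by linarith) (ε • g)
        rw [← hueq] at h1
        rw [← hn]
        linarith [norm_nonneg (ε • g)]
      have h2 := hexp ε hε0 (le_of_lt hεδ) u hunorm hueq ⟨t, htm⟩
      have h3 : (Φ (ε • f)).coeff = traj u t := by
        refine hsol (ε • f) (ε • g) u hgρ ?_ ?_ hu2
        · refine (support_diagInd_finite A).subset fun m hm => ?_
          rw [Function.mem_support, FL.coeff_smul, hg] at hm
          exact right_ne_zero_of_mul hm
        · funext m
          rw [FL.coeff_smul, FL.coeff_smul, hf, hg]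
      have h4 := norm_coeff_le (u ⟨t, htm⟩ - (ε • g + (ε ^ 3 * t) • q)) n
      have h5 : coeffL n (Φ (ε • f)) - ((ε : ℂ) * g.coeff n + (ε : ℂ) ^ 3 * ((t : ℂ) * q.coeff n)) =
          (u ⟨t, htm⟩ - (ε • g + (ε ^ 3 * t) • q)).coeff n := by
        rw [coeffL_apply, h3, traj_of_mem u htm, FL.coeff_sub, FL.coeff_add, FL.coeff_smul,
          FL.coeff_smul]
        push_cast
        ring
      rw [h5]
      refine h4.trans ?_
      rw [mul_assoc]
      exact mul_le_mul_of_nonneg_left h2 (Real.rpow_nonneg (jap_pos n).le _)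
    have hlow := rpow_mul_le_norm h (Finset.Ico (3 * N : ℤ) (4 * N))
      (b := 10 ^ (-|s|) * (N : ℝ) ^ s * (t * (N : ℝ) ^ 2)) (by positivity) fun k hk => by
        have hk' := Finset.mem_Ico.mp hk
        rw [hcoeff, norm_mul, Complex.norm_real, Real.norm_of_nonneg ht.le]
        refine mul_le_mul (jap_diag_rpow_bounds s hN1 (by omega) (by omega)).1
          (mul_le_mul_of_nonneg_left (dat.le_norm_cubic_coeff hK hA hg hk) ht.le)
          (by positivity) (Real.rpow_nonneg (jap_pos _).le _)
    have hup := norm_le_rpow_mul f A (b := 10 ^ |s| * (N : ℝ) ^ s) (by positivity) hf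
      fun k hk => by
        have hk' := Finset.mem_Ico.mp hk
        exact (jap_diag_rpow_bounds s hN1 hk'.1 hk'.2).2
    have hc1 : (Finset.Ico (3 * N : ℤ) (4 * N)).card = N := by
      rw [Int.card_Ico]; omega
    have hc2 : A.card = 5 * N := by
      rw [hA, Int.card_Ico]; omega
    rw [hc1] at hlow
    rw [hc2] at hup
    calc _ ≤ ‖h‖ := hlow
      _ ≤ C * ‖f‖ ^ 3 := hh
      _ ≤ |C| * ‖f‖ ^ 3 := by gcongr; exact le_abs_self C
      _ ≤ _ := by gcongr
  -- Dividing `key` by the cube of X = N^{1/p+s} leaves N²/X² = N^η on the left, up to constants.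
  set η := 2 * (1 - 1 / p - s) with hη
  have hη0 : 0 < η := by linarith
  set B := |C| * ((5 : ℝ) ^ (1 / p) * 10 ^ |s|) ^ 3 / (10 ^ (-|s|) * t) with hB
  have hbound : ∀ N : ℕ, 1 ≤ N → (N : ℝ) ^ η ≤ B := by
    intro N hN1
    have hN0 : (0 : ℝ) < N := by exact_mod_cast hN1
    have hk := key N hN1
    rw [hB, le_div_iff₀ (by positivity)]
    set X := (N : ℝ) ^ (1 / p) * (N : ℝ) ^ s with hX
    have hX0 : 0 < X := by positivity
    have e1 : (N : ℝ) ^ (1 / p) * (10 ^ (-|s|) * (N : ℝ) ^ s * (t * (N : ℝ) ^ 2)) =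
        (N : ℝ) ^ 2 * (10 ^ (-|s|) * t) * X := by rw [hX]; ring
    have e2 : |C| * (((5 * N : ℕ) : ℝ) ^ (1 / p) * (10 ^ |s| * (N : ℝ) ^ s)) ^ 3 =
        |C| * ((5 : ℝ) ^ (1 / p) * 10 ^ |s|) ^ 3 * X ^ 2 * X := by
      rw [hX]
      push_cast
      rw [Real.mul_rpow (by norm_num) hN0.le]
      ring
    rw [e1, e2] at hk
    have hk' := le_of_mul_le_mul_right hk hX0
    have e3 : (N : ℝ) ^ 2 = (N : ℝ) ^ η * X ^ 2 := by
      rw [hX, hη, mul_pow, ← Real.rpow_natCast, ← Real.rpow_natCast, ← Real.rpow_natCast,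
        ← Real.rpow_mul hN0.le, ← Real.rpow_mul hN0.le, ← Real.rpow_add hN0, ← Real.rpow_add hN0]
      congr 1
      push_cast
      ring
    rw [e3] at hk'
    have hX2 : 0 < X ^ 2 := by positivity
    refine le_of_mul_le_mul_right ?_ hX2
    linarith
  have htend : Tendsto (fun N : ℕ => (N : ℝ) ^ η) atTop atTop :=
    (tendsto_rpow_atTop hη0).comp tendsto_natCast_atTop_atTop
  obtain ⟨N, hN1, hNB⟩ := ((eventually_ge_atTop 1).and (htend.eventually_gt_atTop B)).exists
  exact absurd (hbound N hN1) (not_le.mpr hNB)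

theorem exists_illPosed (hs : s < 1 - 1 / p) {K : ℝ} (hK : 1 ≤ K) {T : ℝ} (hT : 0 < T)
    (hσ : 1 - 1 / p < σ) :
    ∃ ρ₀ : ℝ, 0 < ρ₀ ∧
      (∀ g : FL σ p, ‖g‖ < ρ₀ → ∃! u : C(Set.Icc (0 : ℝ) T, FL σ p), IsNFSolution K g u) ∧
      ∀ ρ : ℝ, 0 < ρ → ρ ≤ ρ₀ → ∀ t : ℝ, 0 < t → t ≤ T →
        ¬ ∃ Φ : FL s p → FL s p, ContDiffAt ℝ 3 Φ 0 ∧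
          ∀ (f : FL s p) (g : FL σ p) (u : C(Set.Icc (0 : ℝ) T, FL σ p)),
            ‖g‖ < ρ → (Function.support g.coeff).Finite → f.coeff = g.coeff →
            IsNFSolution K g u → (Φ f).coeff = traj u t := by
  obtain ⟨D₀, hD₀, hdat⟩ := exists_normalFormData (s := σ) (p := p) hσ
  obtain ⟨D', hD', ⟨dat⟩⟩ := hdat K hK
  have hK0 : 0 < K := by linarith
  have hD : 0 ≤ D₀ * (K ^ 2)⁻¹ := by positivity
  generalize D₀ * (K ^ 2)⁻¹ = D at dat hD
  obtain ⟨C, hC, hlip⟩ := exists_lip_le_sq hD hD' (norm_nonneg dat.R1) hT.le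
  -- Then Cr² ≤ 1/8. Both summands of the Lipschitz constant are nonnegative, so each is at most
  -- 1/8, as well-posedness requires.
  set r := 1 / (8 * (C + 1)) with hr
  have hr0 : 0 < r := by positivity
  have hrC : r * (8 * (C + 1)) = 1 := by rw [hr]; field_simp
  have hr1 : r ≤ 1 := by nlinarith [mul_nonneg hr0.le hC]
  have h1 : C * r ^ 2 ≤ 1 / 8 := by nlinarith [mul_nonneg hr0.le hC]
  have h2 := (hlip r hr0.le hr1).trans h1
  have h3 : 0 ≤ Real.exp (3 * D * r ^ 2) - 1 := by
    linarith [Real.one_le_exp (show 0 ≤ 3 * D * r ^ 2 by positivity)]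
  have h4 : 0 ≤ T * driftLip D D' ‖dat.R1‖ r :=
    mul_nonneg hT.le (driftLip_nonneg hD hD' (norm_nonneg _))
  have hN : Real.exp (3 * D * r ^ 2) - 1 ≤ 1 / 8 := by linarith
  have hG : T * driftLip D D' ‖dat.R1‖ r ≤ 1 / 8 := by linarith
  obtain ⟨-, -, Ψ, -, hΨ⟩ := dat.wellPosed hσ hD hD' hT.le hr0 hN hG
  refine ⟨r / 4, by positivity, fun g hg => ⟨Ψ g, (hΨ g hg).2.1, (hΨ g hg).2.2⟩,
    fun ρ hρ hρr t ht htT => ?_⟩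
  exact not_exists_contDiffAt_of_solutions dat hσ hs hK0.le hD hD' hT.le hr0 hN hG hρ hρr ht htT

end IllPosedness

end HNLS

theorem theorem1p3 (p : ℝ) [Fact (1 < p)] :
    -- (i) unconditional semilinear local well-posedness for `s > 1 - 1/p`
    (∀ s : ℝ, 1 - 1 / p < s →
      -- the equation makes sense for every `u ∈ C([0,T]; FL^{s,p})`
      (∀ K : ℝ, 1 ≤ K → ∀ T : ℝ, 0 < T → ∀ u : C(Set.Icc (0 : ℝ) T, FL s p), NFConverges K u) ∧
      ∀ R : ℝ, 0 < R → ∃ K₀ : ℝ, 1 ≤ K₀ ∧ ∀ K : ℝ, K₀ ≤ K →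
        ∃ T₀ : ℝ, 0 < T₀ ∧ ∀ T : ℝ, 0 < T → T ≤ T₀ →
          ∃ M θ : ℝ, 0 < M ∧ 0 ≤ θ ∧ θ < 1 ∧
            -- contraction on the ball of radius `M` in `C([0,T]; FL^{s,p})`
            (∀ u₀ : FL s p, ‖u₀‖ < R →
              (∀ v : C(Set.Icc (0 : ℝ) T, FL s p), ‖v‖ ≤ M →
                ∃ w : C(Set.Icc (0 : ℝ) T, FL s p), ‖w‖ ≤ M ∧ IsNFImage K u₀ v w) ∧
              (∀ v₁ v₂ w₁ w₂ : C(Set.Icc (0 : ℝ) T, FL s p), ‖v₁‖ ≤ M → ‖v₂‖ ≤ M →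
                IsNFImage K u₀ v₁ w₁ → IsNFImage K u₀ v₂ w₂ → ‖w₁ - w₂‖ ≤ θ * ‖v₁ - v₂‖)) ∧
            -- existence, uniqueness in all of `C([0,T]; FL^{s,p})`, smooth solution map
            ∃ Ψ : FL s p → C(Set.Icc (0 : ℝ) T, FL s p),
              ContDiffOn ℝ ∞ Ψ (Metric.ball 0 R) ∧
              ∀ u₀ : FL s p, ‖u₀‖ < R →
                ‖Ψ u₀‖ ≤ M ∧ IsNFSolution K u₀ (Ψ u₀) ∧
                ∀ u : C(Set.Icc (0 : ℝ) T, FL s p), IsNFSolution K u₀ u → u = Ψ u₀) ∧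
    -- (ii) failure of `C³` for `s < 1 - 1/p`: at no time `t > 0` does the solution map, which is
    -- well defined for small data in a smoother space `FL^{σ,p}`, have an extension from
    -- trigonometric polynomials to `FL^{s,p}` that is `C³` near the origin
    (∀ s : ℝ, s < 1 - 1 / p → ∀ K : ℝ, 1 ≤ K → ∀ T : ℝ, 0 < T → ∀ σ : ℝ, 1 - 1 / p < σ →
      ∃ ρ₀ : ℝ, 0 < ρ₀ ∧
        (∀ g : FL σ p, ‖g‖ < ρ₀ →
          ∃! u : C(Set.Icc (0 : ℝ) T, FL σ p), IsNFSolution K g u) ∧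
        ∀ ρ : ℝ, 0 < ρ → ρ ≤ ρ₀ → ∀ t : ℝ, 0 < t → t ≤ T →
          ¬ ∃ Φ : FL s p → FL s p, ContDiffAt ℝ 3 Φ 0 ∧
            ∀ (f : FL s p) (g : FL σ p) (u : C(Set.Icc (0 : ℝ) T, FL σ p)),
              ‖g‖ < ρ → (Function.support g.coeff).Finite → f.coeff = g.coeff →
              IsNFSolution K g u → (Φ f).coeff = traj u t) := by
  exact ⟨fun s hs => ⟨fun K hK T hT u => exists_nfConverges hs hK hT u,
      fun R hR => exists_wellPosed hs hR⟩,
    fun s hs K hK T hT σ hσ => exists_illPosed hs hK hT hσ⟩
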